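/- **Tangled-diagrams.** A tangled-diagram over $[n]=\{1,\dots,n\}$ is a labeled graph on $[n]$ of degree at most $2$ (double arcs and loops are allowed, a loop counts $2$ in the degree), with arcs $(i,j)$, $i\le j$, drawn in the upper half-plane over the vertices placed on a line. For every vertex at which two non-loop arcs meet it is part of the drawing whether these two arcs are crossing there or not (for a double arc $(i,j),(i,j)$ there is one choice). Two arcs $(i_1,j_1),(i_2,j_2)$ are *crossing* if $i_1<i_2<j_1<j_2$ or if they meet at a vertex and are drawn crossing there. They are *nesting* if $i_1<i_2\le j_2<j_1$, or if they have a common lefthand or a common righthand endpoint and are not drawn crossing there. A tangled-diagram is *$k$-noncrossing* (*$k$-nonnesting*) if it contains no $k$ arcs (counted with multiplicity) that are mutually crossing (mutually nesting). **Inflation.** Order $1<1'<2<2'<\dots<n<n'$. The inflation $\iota(G)$ of a tangled-diagram $G$ is the partial matching obtained by splitting every vertex $v$ of degree $2$ into $v,v'$ and replacing arcs as follows: $(i,j_1),(i,j_2)$ with $i<j_1<j_2$ become $(i,j_1),(i',j_2)$ if crossing and $(i,j_2),(i',j_1)$ if nesting; $(i_1,j),(i_2,j)$ with $i_1<i_2<j$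 become $(i_1,j),(i_2,j')$ if crossing and $(i_1,j'),(i_2,j)$ if nesting; a double arc $(i,j),(i,j)$ becomes $(i,j),(i',j')$ if crossing and $(i,j'),(i',j)$ if nesting; $(i,j),(j,h)$ with $i<j<h$ become $(i,j'),(j,h)$ if crossing and $(i,j),(j',h)$ if not; a loop $(i,i)$ becomes $(i,i')$. **Vacillating tableaux.** A vacillating tableau of empty shape and length $2n$ is a sequence $(\lambda^0,\dots,\lambda^{2n})$ of Young diagrams with $\lambda^0=\lambda^{2n}=\varnothing$ such that for $1\le j\le n$ the two steps $\lambda^{2j-2}\to\lambda^{2j-1}\to\lambda^{2j}$ are: do nothing twice; or remove a square, then do nothing; or do nothing, then add a square; or add or remove one square in each of the two steps. To a tangled-diagram $G$ over $[n]$ corresponds the sequence of the shapes of the tableaux $T_0,\dots,T_{2n}$ constructed from right to left, starting with $T_{2n}=\varnothing$: for $j=n,\dots,1$, if $j$ has degree $2$, then the step from $T_{2j}$ to $T_{2j-1}$ treats $j'$ and the step from $T_{2j-1}$ to $T_{2j-2}$ treats $j$; if $j$ has degree at most $1$, then the first of these two steps treats $j$ if $j$ is a lefthand endpoint, the second treats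 $j$ if $j$ is a righthand endpoint, and otherwise nothing is done. Here treating a righthand endpoint $x$ of an arc $(i,x)$ of $\iota(G)$ means inserting $i$ by RSK row insertion, and treating a lefthand endpoint $x$ means removing the square with entry $x$. **Theorem.** Let $n\ge 0$. This correspondence is a bijection $\beta^{-1}$ from the set of tangled-diagrams over $[n]$ onto the set of vacillating tableaux of empty shape and length $2n$. For every $k\ge 0$, a tangled-diagram is $k$-noncrossing if and only if all shapes $\lambda^0,\dots,\lambda^{2n}$ of its corresponding vacillating tableau have fewer than $k$ rows; that is, $\beta$ maps the set of vacillating tableaux all of whose shapes have fewer than $k$ rows bijectively onto the set of $k$-noncrossing tangled-diagrams. Furthermore, for every $k$ there is a bijection between the set of $k$-noncrossing and the set of $k$-nonnesting tangled-diagrams over $[n]$. -/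

import Mathlib

/-- A tangled-diagram over the vertex set `{1, …, n}` (modelled by `Fin n`): a labeled graph of
degree at most two, loops and double arcs allowed, together with the way it is drawn. -/
@[ext]
structure TangledDiagram (n : ℕ) where
  /-- the arcs `(i, j)`, `i ≤ j`, with multiplicity; `(i, i)` is a loop -/
  arcs : Multiset (Fin n × Fin n)
  arcs_le : ∀ a ∈ arcs, a.1 ≤ a.2
  /-- a loop contributes two to the degree of its vertex -/
  degree_le : ∀ v, arcs.countP (fun a => a.1 = v) + arcs.countP (fun a => a.2 = v) ≤ 2
  /-- the vertices at which the two arcs that meet there are drawn crossing -/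
  crossAt : Finset (Fin n)
  /-- only where two arcs meet is there something to choose -/
  crossAt_degree : ∀ v ∈ crossAt,
    arcs.countP (fun a => a.1 = v) + arcs.countP (fun a => a.2 = v) = 2 ∧ (v, v) ∉ arcs
  /-- two parallel arcs cross or do not cross: one single choice for their two common endpoints -/
  crossAt_double : ∀ a, 2 ≤ arcs.count a → (a.1 ∈ crossAt ↔ a.2 ∈ crossAt)

namespace TangledDiagram

variable {n : ℕ} (G : TangledDiagram n)

/-- The degree of a vertex. -/
def degree (v : Fin n) : ℕ :=
  G.arcs.countP (fun a => a.1 = v) + G.arcs.countP (fun a => a.2 = v)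

/-- The arcs `a` and `b` (two different members of the multiset of arcs) are crossing: either
`i₁ < i₂ < j₁ < j₂`, or they meet at a vertex and are drawn crossing there. -/
def Crossing (a b : Fin n × Fin n) : Prop :=
  (a.1 < b.1 ∧ b.1 < a.2 ∧ a.2 < b.2) ∨ (b.1 < a.1 ∧ a.1 < b.2 ∧ b.2 < a.2) ∨
    ∃ v ∈ G.crossAt, (a.1 = v ∨ a.2 = v) ∧ (b.1 = v ∨ b.2 = v)

/-- The arcs `a` and `b` (two different members of the multiset of arcs) are nesting: either
`i₁ < i₂ ≤ j₂ < j₁` (where `i₂ = j₂` is a loop lying below an arc), or they have a common lefthand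
or a common righthand endpoint and are not drawn crossing there. -/
def Nesting (a b : Fin n × Fin n) : Prop :=
  (a.1 < b.1 ∧ b.2 < a.2) ∨ (b.1 < a.1 ∧ a.2 < b.2) ∨
    (a.1 = b.1 ∧ a.1 ∉ G.crossAt) ∨ (a.2 = b.2 ∧ a.2 ∉ G.crossAt)

/-- No `k` arcs (counted with multiplicity) are mutually crossing. -/
def IsNoncrossing (k : ℕ) : Prop :=
  ¬ ∃ S : Finset G.arcs.ToType, S.card = k ∧
    ∀ a ∈ S, ∀ b ∈ S, a ≠ b → G.Crossing a.1 b.1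

/-- No `k` arcs (counted with multiplicity) are mutually nesting. -/
def IsNonnesting (k : ℕ) : Prop :=
  ¬ ∃ S : Finset G.arcs.ToType, S.card = k ∧
    ∀ a ∈ S, ∀ b ∈ S, a ≠ b → G.Nesting a.1 b.1

end TangledDiagram

/-- The linearly ordered set `1 < 1' < 2 < 2' < ⋯ < n < n'`: the pair `(i, false)` is `i` and the
pair `(i, true)` is `i'`. -/
abbrev Label (n : ℕ) : Type := Fin n ×ₗ Bool

/-- The label `i` (for `b = false`) or `i'` (for `b = true`). -/
def label {n : ℕ} (i : Fin n) (b : Bool) : Label n := toLex (i, b)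

namespace TangledDiagram

variable {n : ℕ} (G : TangledDiagram n)

/-- Whether the lefthand endpoint of the arc `a` (of multiplicity one) becomes primed in the
inflation. Arcs with common lefthand endpoint `i` and `j₁ < j₂` become `(i, j₁), (i', j₂)` if
crossing and `(i, j₂), (i', j₁)` if nesting; `(i, j)` and `(j, h)` with `i < j < h` become
`(i, j'), (j, h)` if crossing and `(i, j), (j', h)` if not. -/
def leftPrimed (a : Fin n × Fin n) : Bool :=
  decide ((∃ b ∈ G.arcs, b ≠ a ∧ b.1 = a.1 ∧ (a.1 ∈ G.crossAt ↔ b.2 < a.2)) ∨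
    (∃ b ∈ G.arcs, b ≠ a ∧ b.2 = a.1 ∧ a.1 ∉ G.crossAt))

/-- Whether the righthand endpoint of the arc `a` (of multiplicity one) becomes primed in the
inflation. A loop `(i, i)` becomes `(i, i')`; arcs with common righthand endpoint `j` and `i₁ < i₂`
become `(i₁, j), (i₂, j')` if crossing and `(i₁, j'), (i₂, j)` if nesting; the remaining case is as
for lefthand endpoints. -/
def rightPrimed (a : Fin n × Fin n) : Bool :=
  decide (a.1 = a.2 ∨
    (∃ b ∈ G.arcs, b ≠ a ∧ b.2 = a.2 ∧ (a.2 ∈ G.crossAt ↔ b.1 < a.1)) ∨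
    (∃ b ∈ G.arcs, b ≠ a ∧ b.1 = a.2 ∧ a.2 ∈ G.crossAt))

/-- The arcs of the inflation of `G`, a partial matching on the labels. A double arc `(i, j)`
becomes `(i, j), (i', j')` if crossing and `(i, j'), (i', j)` if nesting. -/
def inflation : Finset (Label n × Label n) :=
  G.arcs.toFinset.biUnion fun a =>
    if 2 ≤ G.arcs.count a then
      if a.1 ∈ G.crossAt then
        {(label a.1 false, label a.2 false), (label a.1 true, label a.2 true)}
      else {(label a.1 false, label a.2 true), (label a.1 true, label a.2 false)}
    else {(label a.1 (G.leftPrimed a), label a.2 (G.rightPrimed a))}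

end TangledDiagram

/-- Row insertion (RSK): `x` is appended to the first row if no entry there is larger; otherwise it
replaces the leftmost larger entry, which is then inserted into the remaining rows. A tableau is
given by the list of its rows. -/
def rowInsert {α : Type*} [LinearOrder α] : List (List α) → α → List (List α)
  | [], x => [[x]]
  | r :: T, x =>
    match r.find? (fun y => decide (x < y)) with
    | none => (r ++ [x]) :: T
    | some y => r.map (fun z => if z = y then x else z) :: rowInsert T y

/-- Remove the square with entry `x`. -/
def removeEntry {α : Type*} [DecidableEq α] (T : List (List α)) (x : α) : List (List α) :=
  T.map fun r => r.filter fun y => decide (y ≠ x)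

/-- The squares of a tableau that is given by its rows, as (row, column). -/
def squares {α : Type*} (T : List (List α)) : Finset (ℕ × ℕ) :=
  (Finset.range T.length).biUnion fun r =>
    (Finset.range (T.getD r []).length).image fun c => (r, c)

namespace TangledDiagram

variable {n : ℕ} (G : TangledDiagram n)

/-- The label `i` such that `(i, x)` is an arc of the inflation, if there is one. -/
def partner (x : Label n) : Option (Label n) :=
  (((List.finRange n).map fun i => label i false) ++ (List.finRange n).map fun i => label i true)
    |>.find? fun i => decide ((i, x) ∈ G.inflation)

/-- If `x` is a righthand endpoint, insert the lefthand endpoint of its arc. -/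
def closeStep (x : Label n) (T : List (List (Label n))) : List (List (Label n)) :=
  match G.partner x with
  | some i => rowInsert T i
  | none => T

/-- If `x` is a lefthand endpoint, remove the square with entry `x`. -/
def openStep (x : Label n) (T : List (List (Label n))) : List (List (Label n)) :=
  if x ∈ G.inflation.image Prod.fst then removeEntry T x else T

/-- From `T_{2j}` to `T_{2j-1}`: a vertex of degree two acts here through `j'`, a vertex of smaller
degree acts here only if it is a lefthand endpoint. -/
def secondStep (j : Fin n) (T : List (List (Label n))) : List (List (Label n)) :=
  if G.degree j = 2 then G.closeStep (label j true) (G.openStep (label j true) T)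
  else G.openStep (label j false) T

/-- From `T_{2j-1}` to `T_{2j-2}`: a vertex of degree two acts here through `j`, a vertex of smaller
degree acts here only if it is a righthand endpoint. -/
def firstStep (j : Fin n) (T : List (List (Label n))) : List (List (Label n)) :=
  if G.degree j = 2 then G.closeStep (label j false) (G.openStep (label j false) T)
  else G.closeStep (label j false) T

/-- The tableaux `T_0, …, T_{2n}` of a tangled-diagram, constructed from right to left, starting with
the empty tableau `T_{2n}`. -/
def tableau : Fin (2 * n + 1) → List (List (Label n)) :=
  Fin.reverseInduction (motive := fun _ => List (List (Label n))) []
    fun p T =>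
      if (p : ℕ) % 2 = 1 then G.secondStep ⟨(p : ℕ) / 2, by omega⟩ T
      else G.firstStep ⟨(p : ℕ) / 2, by omega⟩ T

end TangledDiagram

/-- The shape `ν` arises from the shape `μ` by adding one square. -/
def AddSquare (μ ν : YoungDiagram) : Prop :=
  μ ≤ ν ∧ ν.card = μ.card + 1

/-- A (generalized) vacillating tableau of empty shape and length `2n`: the elementary moves are
`(∅, ∅)`, `(-□, ∅)`, `(∅, +□)` and `(±□, ±□)`. -/
@[ext]
structure VacillatingTableau (n : ℕ) where
  shape : Fin (2 * n + 1) → YoungDiagram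
  shape_zero : shape 0 = ⊥
  shape_last : shape (Fin.last (2 * n)) = ⊥
  move : ∀ (j : ℕ) (hj : j < n),
    let μ₀ := shape ⟨2 * j, by omega⟩
    let μ₁ := shape ⟨2 * j + 1, by omega⟩
    let μ₂ := shape ⟨2 * j + 2, by omega⟩
    (μ₁ = μ₀ ∧ μ₂ = μ₁) ∨ (AddSquare μ₁ μ₀ ∧ μ₂ = μ₁) ∨ (μ₁ = μ₀ ∧ AddSquare μ₁ μ₂) ∨
      ((AddSquare μ₀ μ₁ ∨ AddSquare μ₁ μ₀) ∧ (AddSquare μ₁ μ₂ ∨ AddSquare μ₂ μ₁))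

/-- All shapes of the vacillating tableau have less than `k` rows. -/
def VacillatingTableau.RowsLT {n : ℕ} (V : VacillatingTableau n) (k : ℕ) : Prop :=
  ∀ h, (V.shape h).rowLens.length < k

/-! Read from right to left, the construction only inserts letters (the lefthand endpoints of arcs,
at their righthand endpoints) and removes them again in decreasing order, so the removed letter is
always the largest one present. List the lefthand endpoints of the arcs open at a position in order
of insertion, that is, by decreasing righthand endpoint. Up to Knuth equivalence this word is the
reading word of the tableau (`TableauAt.step`): row insertion amounts to appending a letter, and
removing the maximum restricts both words to the smaller letters.

The lengths of the longest strictly decreasing and strictly increasing subwords are Knuth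
invariants, and for a tableau they are the numbers of rows and columns (`hasChain_gt_readingWord`,
`hasChain_lt_readingWord`). In the word of open arcs a decreasing subword consists of mutually
crossing arcs, an increasing one of mutually nesting arcs. Conversely, mutually crossing or mutually
nesting arcs of a matching are all open at some common position (`exists_openAt_iff`). So the
largest numbers of mutually crossing and mutually nesting arcs are the largest numbers of rows and
columns among the shapes.

Inflation reduces tangled-diagrams to such matchings. It turns the crossings and nestings of the
diagram into those of the matching (`crossing_iff`, `nesting_iff`), and it is a bijection onto the
matchings of labels that use `i'` only together with `i` (`eq_of_isSplitting`, `eq_inflation`).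

For bijectivity the shapes are read from left to right, starting with the empty tableau. Where the
shape shrinks, a row insertion is undone at the vacated corner, which determines the inserted letter
(`rowInsert_injective`, `exists_rowInsert_eq`). Where it grows, the new square receives the label of
that position. This label is known in advance: a vertex has degree two exactly if both of its steps
change the shape. Thus the shapes determine all steps (`IsSchedule.ext_of_rowLength`), and every
vacillating tableau arises (`exists_schedule`, `exists_steps_eq`).

Finally, conjugating all shapes exchanges rows and columns and maps vacillating tableaux to
vacillating tableaux; this yields the bijection between noncrossing and nonnesting diagrams. -/

/-! ### Knuth equivalence and the lengths of monotone subwords -/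

section Knuth

variable {α : Type*}

/-- `w` has a sublist of length `k` that is a chain for the relation `R`. -/
def HasChain (R : α → α → Prop) (w : List α) (k : ℕ) : Prop :=
  ∃ l : List α, l.Sublist w ∧ l.Pairwise R ∧ l.length = k

/-- A chain splits into its parts in `u`, `s` and `v`. The middle part may be exchanged for any
chain of `t` of the same length which respects every bound from outside that the old part respected.
-/
theorem HasChain.congr_infix {R : α → α → Prop} {s t : List α}
    (h : ∀ l : List α, l.Sublist s → l.Pairwise R → ∃ l' : List α, l'.Sublist t ∧ l'.Pairwise R ∧
      l'.length = l.length ∧ (∀ a, (∀ b ∈ l, R a b) → ∀ b ∈ l', R a b) ∧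
      (∀ a, (∀ b ∈ l, R b a) → ∀ b ∈ l', R b a)) (u v : List α) {k : ℕ}
    (hk : HasChain R (u ++ s ++ v) k) : HasChain R (u ++ t ++ v) k := by
  obtain ⟨l, hl, hp, rfl⟩ := hk
  obtain ⟨l₁₂, l₃, rfl, h12, h3⟩ := List.sublist_append_iff.1 hl
  obtain ⟨l₁, l₂, rfl, h1, h2⟩ := List.sublist_append_iff.1 h12
  simp only [List.pairwise_append, List.mem_append] at hp
  obtain ⟨⟨p1, p2, p12⟩, p3, p123⟩ := hp
  obtain ⟨l', h', p', e', ha, hb⟩ := h l₂ h2 p2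
  refine ⟨l₁ ++ l' ++ l₃, (h1.append h').append h3, ?_, by simp [e']⟩
  simp only [List.pairwise_append, List.mem_append]
  refine ⟨⟨p1, p', fun a ha' => ha a (p12 a ha')⟩, p3, ?_⟩
  rintro a (ha' | ha') b hb'
  · exact p123 a (Or.inl ha') b hb'
  · exact hb b (fun c hc => p123 c (Or.inr hc) b hb') a ha'

/-- Only the chain `[x, z]` is lost by the move, and `[x, y]` takes its place. The relation is kept
abstract because the statements are needed for `<` and for `>`. -/
theorem exists_chain_xzy {R : α → α → Prop} [IsTrans α R] [Std.Asymm R] {x y z : α}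
    (hxy : R x y) (hyz : R y z) (l : List α) (hl : l.Sublist [x, z, y]) (hp : l.Pairwise R) :
    ∃ l' : List α, l'.Sublist [z, x, y] ∧ l'.Pairwise R ∧
      l'.length = l.length ∧ (∀ a, (∀ b ∈ l, R a b) → ∀ b ∈ l', R a b) ∧
      (∀ a, (∀ b ∈ l, R b a) → ∀ b ∈ l', R b a) := by
  have hxz : R x z := _root_.trans hxy hyz
  have hzy : ¬ R z y := asymm hyz
  rw [← List.mem_sublists'] at hl
  simp at hl
  by_cases hl' : l = [x, z]
  · subst hl'
    refine ⟨[x, y], ?_, by simp [hxy], rfl, ?_, ?_⟩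
    · rw [← List.mem_sublists']; simp
    · intro a h; simp at h ⊢; exact ⟨h.1, _root_.trans h.1 hxy⟩
    · intro a h; simp at h ⊢; exact ⟨h.1, _root_.trans hyz h.2⟩
  · refine ⟨l, ?_, hp, rfl, fun _ h => h, fun _ h => h⟩
    rw [← List.mem_sublists']
    rcases hl with rfl | rfl | rfl | rfl | rfl | rfl | rfl | rfl <;> simp_all

/-- In this direction no chain is lost, since `z` precedes letters to which it is not related. -/
theorem exists_chain_zxy {R : α → α → Prop} [IsTrans α R] [Std.Asymm R] {x y z : α}
    (hxy : R x y) (hyz : R y z) (l : List α) (hl : l.Sublist [z, x, y]) (hp : l.Pairwise R) :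
    ∃ l' : List α, l'.Sublist [x, z, y] ∧ l'.Pairwise R ∧
      l'.length = l.length ∧ (∀ a, (∀ b ∈ l, R a b) → ∀ b ∈ l', R a b) ∧
      (∀ a, (∀ b ∈ l, R b a) → ∀ b ∈ l', R b a) := by
  have hzx : ¬ R z x := asymm (_root_.trans hxy hyz)
  have hzy : ¬ R z y := asymm hyz
  rw [← List.mem_sublists'] at hl
  simp at hl
  refine ⟨l, ?_, hp, rfl, fun _ h => h, fun _ h => h⟩
  rw [← List.mem_sublists']
  rcases hl with rfl | rfl | rfl | rfl | rfl | rfl | rfl | rfl <;> simp_all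

/-- Here `[x, z]` is lost and `[y, z]` replaces it. -/
theorem exists_chain_yxz {R : α → α → Prop} [IsTrans α R] [Std.Asymm R] {x y z : α}
    (hxy : R x y) (hyz : R y z) (l : List α) (hl : l.Sublist [y, x, z]) (hp : l.Pairwise R) :
    ∃ l' : List α, l'.Sublist [y, z, x] ∧ l'.Pairwise R ∧
      l'.length = l.length ∧ (∀ a, (∀ b ∈ l, R a b) → ∀ b ∈ l', R a b) ∧
      (∀ a, (∀ b ∈ l, R b a) → ∀ b ∈ l', R b a) := by
  have hxz : R x z := _root_.trans hxy hyz
  have hyx : ¬ R y x := asymm hxy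
  rw [← List.mem_sublists'] at hl
  simp at hl
  by_cases hl' : l = [x, z]
  · subst hl'
    refine ⟨[y, z], ?_, by simp [hyz], rfl, ?_, ?_⟩
    · rw [← List.mem_sublists']; simp
    · intro a h; simp at h ⊢; exact ⟨_root_.trans h.1 hxy, h.2⟩
    · intro a h; simp at h ⊢; exact ⟨_root_.trans hyz h.2, h.2⟩
  · refine ⟨l, ?_, hp, rfl, fun _ h => h, fun _ h => h⟩
    rw [← List.mem_sublists']
    rcases hl with rfl | rfl | rfl | rfl | rfl | rfl | rfl | rfl <;> simp_all

theorem exists_chain_yzx {R : α → α → Prop} [IsTrans α R] [Std.Asymm R] {x y z : α}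
    (hxy : R x y) (hyz : R y z) (l : List α) (hl : l.Sublist [y, z, x]) (hp : l.Pairwise R) :
    ∃ l' : List α, l'.Sublist [y, x, z] ∧ l'.Pairwise R ∧
      l'.length = l.length ∧ (∀ a, (∀ b ∈ l, R a b) → ∀ b ∈ l', R a b) ∧
      (∀ a, (∀ b ∈ l, R b a) → ∀ b ∈ l', R b a) := by
  have hzx : ¬ R z x := asymm (_root_.trans hxy hyz)
  have hyx : ¬ R y x := asymm hxy
  rw [← List.mem_sublists'] at hl
  simp at hl
  refine ⟨l, ?_, hp, rfl, fun _ h => h, fun _ h => h⟩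
  rw [← List.mem_sublists']
  rcases hl with rfl | rfl | rfl | rfl | rfl | rfl | rfl | rfl <;> simp_all

variable [LinearOrder α]

/-- The elementary Knuth transformations of words. -/
inductive KnuthStep : List α → List α → Prop
  | swap_before (u v : List α) {x y z : α} (hxy : x < y) (hyz : y < z) :
      KnuthStep (u ++ [x, z, y] ++ v) (u ++ [z, x, y] ++ v)
  | swap_after (u v : List α) {x y z : α} (hxy : x < y) (hyz : y < z) :
      KnuthStep (u ++ [y, x, z] ++ v) (u ++ [y, z, x] ++ v)

/-- Knuth equivalence of words. -/
def KnuthEquiv : List α → List α → Prop := Relation.EqvGen KnuthStep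

theorem KnuthStep.append_left {s t : List α} (h : KnuthStep s t) (u : List α) :
    KnuthStep (u ++ s) (u ++ t) := by
  cases h with
  | swap_before a b hxy hyz => simpa using KnuthStep.swap_before (u ++ a) b hxy hyz
  | swap_after a b hxy hyz => simpa using KnuthStep.swap_after (u ++ a) b hxy hyz

theorem KnuthStep.append_right {s t : List α} (h : KnuthStep s t) (v : List α) :
    KnuthStep (s ++ v) (t ++ v) := by
  cases h with
  | swap_before a b hxy hyz => simpa using KnuthStep.swap_before a (b ++ v) hxy hyz
  | swap_after a b hxy hyz => simpa using KnuthStep.swap_after a (b ++ v) hxy hyz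

namespace KnuthEquiv

theorem refl (s : List α) : KnuthEquiv s s := Relation.EqvGen.refl s

theorem symm {s t : List α} (h : KnuthEquiv s t) : KnuthEquiv t s := Relation.EqvGen.symm _ _ h

theorem trans {s t u : List α} (h : KnuthEquiv s t) (h' : KnuthEquiv t u) : KnuthEquiv s u :=
  Relation.EqvGen.trans _ _ _ h h'

theorem of_step {s t : List α} (h : KnuthStep s t) : KnuthEquiv s t := Relation.EqvGen.rel _ _ h

theorem map_of {f : List α → List α} (hf : ∀ s t, KnuthStep s t → KnuthEquiv (f s) (f t))
    {s t : List α} (h : KnuthEquiv s t) : KnuthEquiv (f s) (f t) := by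
  induction h with
  | rel _ _ h => exact hf _ _ h
  | refl _ => exact refl _
  | symm _ _ _ ih => exact ih.symm
  | trans _ _ _ _ _ ih ih' => exact ih.trans ih'

theorem append_left {s t : List α} (h : KnuthEquiv s t) (u : List α) :
    KnuthEquiv (u ++ s) (u ++ t) :=
  map_of (f := fun s => u ++ s) (fun _ _ h => of_step (h.append_left u)) h

theorem append_right {s t : List α} (h : KnuthEquiv s t) (v : List α) :
    KnuthEquiv (s ++ v) (t ++ v) :=
  map_of (f := fun s => s ++ v) (fun _ _ h => of_step (h.append_right v)) h

theorem cons {s t : List α} (h : KnuthEquiv s t) (a : α) : KnuthEquiv (a :: s) (a :: t) :=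
  h.append_left [a]

/-- If the largest letter `z` of the triple survives, so does the whole move; if `z` is deleted,
both sides become equal. -/
theorem filter_lt {s t : List α} (h : KnuthEquiv s t) (c : α) :
    KnuthEquiv (s.filter (fun a => decide (a < c))) (t.filter (fun a => decide (a < c))) := by
  refine map_of (f := fun s => s.filter (fun a => decide (a < c))) (fun s t h => ?_) h
  cases h with
  | @swap_before u v x y z hxy hyz =>
    by_cases hz : z < c
    · simpa [List.filter_append, List.filter_cons, hz, hyz.trans hz, hxy.trans (hyz.trans hz)] using
        of_step (KnuthStep.swap_before (u.filter (fun a => decide (a < c)))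
          (v.filter (fun a => decide (a < c))) hxy hyz)
    · simpa [List.filter_append, List.filter_cons, hz] using refl _
  | @swap_after u v x y z hxy hyz =>
    by_cases hz : z < c
    · simpa [List.filter_append, List.filter_cons, hz, hyz.trans hz, hxy.trans (hyz.trans hz)] using
        of_step (KnuthStep.swap_after (u.filter (fun a => decide (a < c)))
          (v.filter (fun a => decide (a < c))) hxy hyz)
    · simpa [List.filter_append, List.filter_cons, hz] using refl _

theorem hasChain_lt_iff {s t : List α} (h : KnuthEquiv s t) (k : ℕ) :
    HasChain (· < ·) s k ↔ HasChain (· < ·) t k := by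
  induction h with
  | rel _ _ h =>
    cases h with
    | swap_before u v hxy hyz =>
      exact ⟨HasChain.congr_infix (exists_chain_xzy hxy hyz) u v,
        HasChain.congr_infix (exists_chain_zxy hxy hyz) u v⟩
    | swap_after u v hxy hyz =>
      exact ⟨HasChain.congr_infix (exists_chain_yxz hxy hyz) u v,
        HasChain.congr_infix (exists_chain_yzx hxy hyz) u v⟩
  | refl _ => rfl
  | symm _ _ _ ih => exact ih.symm
  | trans _ _ _ _ _ ih ih' => exact ih.trans ih'

/-- Reversing the order exchanges the names `x` and `z`, which turns each Knuth move into its own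
inverse. -/
theorem hasChain_gt_iff {s t : List α} (h : KnuthEquiv s t) (k : ℕ) :
    HasChain (· > ·) s k ↔ HasChain (· > ·) t k := by
  induction h with
  | rel _ _ h =>
    cases h with
    | swap_before u v hxy hyz =>
      exact ⟨HasChain.congr_infix (exists_chain_zxy (R := (· > ·)) hyz hxy) u v,
        HasChain.congr_infix (exists_chain_xzy (R := (· > ·)) hyz hxy) u v⟩
    | swap_after u v hxy hyz =>
      exact ⟨HasChain.congr_infix (exists_chain_yzx (R := (· > ·)) hyz hxy) u v,
        HasChain.congr_infix (exists_chain_yxz (R := (· > ·)) hyz hxy) u v⟩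
  | refl _ => rfl
  | symm _ _ _ ih => exact ih.symm
  | trans _ _ _ _ _ ih ih' => exact ih.trans ih'

/-- A letter moves to the left past an increasing run of larger letters. -/
theorem move_left {x : α} : ∀ {w : α} {m : List α}, (w :: m).Pairwise (· < ·) → x < w →
    KnuthEquiv (w :: m ++ [x]) (w :: x :: m)
  | _, [], _, _ => refl _
  | w, z :: m, h, hx => by
    have hwz : w < z := (List.pairwise_cons.1 h).1 z (by simp)
    have ih := (move_left (List.pairwise_cons.1 h).2 (hx.trans hwz)).cons w
    exact ih.trans (of_step (KnuthStep.swap_after [] m hx hwz)).symm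

/-- A letter moves to the front past an increasing run of smaller letters. -/
theorem move_front {x y : α} (hxy : x < y) : ∀ {l : List α}, l.Pairwise (· < ·) →
    (∀ a ∈ l, a < x) → KnuthEquiv (l ++ [y, x]) (y :: (l ++ [x]))
  | [], _, _ => refl _
  | [a], _, h => of_step (KnuthStep.swap_before [] [] (h a (by simp)) hxy)
  | a :: b :: l, hp, h => by
    have hab : a < b := (List.pairwise_cons.1 hp).1 b (by simp)
    have hby : b < y := (h b (by simp)).trans hxy
    have ih := (move_front hxy (List.pairwise_cons.1 hp).2
      (fun c hc => h c (List.mem_cons_of_mem _ hc))).cons a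
    exact ih.trans (of_step (KnuthStep.swap_before [] (l ++ [x]) hab hby))

/-- Bumping `y` from a row by inserting `x`. -/
theorem bump {l m : List α} {x y : α} (hp : (l ++ y :: m).Pairwise (· < ·))
    (hl : ∀ a ∈ l, a < x) (hxy : x < y) :
    KnuthEquiv (l ++ y :: m ++ [x]) (y :: (l ++ x :: m)) := by
  rw [List.pairwise_append] at hp
  -- First `x` travels left through `m` until it stands behind `y`; then `y` travels through `l` to
  -- the front.
  have h1 := (move_left hp.2.1 hxy).append_left l
  have h2 := (move_front hxy hp.1 hl).append_right m
  simp only [List.append_assoc, List.cons_append, List.nil_append] at h1 h2 ⊢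
  exact h1.trans h2

end KnuthEquiv

end Knuth

/-! ### Row insertion into tableaux and its inversion -/

section Tableau

variable {α : Type*}

/-- The rows of a tableau, continued by empty rows. -/
def tabRow (T : List (List α)) (r : ℕ) : List α := T.getD r []

/-- The word of a tableau: the rows are read from bottom to top. -/
def readingWord : List (List α) → List α
  | [] => []
  | r :: T => readingWord T ++ r

/-- The sequence of row lengths of a tableau. -/
def rowLength (T : List (List α)) (r : ℕ) : ℕ := (tabRow T r).length

/-- `g` arises from `f` by increasing the value at `r₀` by one. -/
def GrowsAt (r₀ : ℕ) (f g : ℕ → ℕ) : Prop := ∀ r, g r = f r + if r = r₀ then 1 else 0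

@[simp] theorem tabRow_cons_zero (r : List α) (T : List (List α)) : tabRow (r :: T) 0 = r := rfl

@[simp] theorem tabRow_cons_succ (r : List α) (T : List (List α)) (i : ℕ) :
    tabRow (r :: T) (i + 1) = tabRow T i := by simp [tabRow]

@[simp] theorem tabRow_nil (i : ℕ) : tabRow ([] : List (List α)) i = [] := by simp [tabRow]

@[simp] theorem tabRow_tail (T : List (List α)) (i : ℕ) : tabRow T.tail i = tabRow T (i + 1) := by
  cases T <;> simp

theorem readingWord_eq (T : List (List α)) : readingWord T = readingWord T.tail ++ tabRow T 0 := by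
  cases T <;> simp [readingWord]

theorem mem_readingWord {T : List (List α)} {x : α} : x ∈ readingWord T ↔ ∃ r, x ∈ tabRow T r := by
  induction T with
  | nil => simp [readingWord]
  | cons r T ih =>
    simp only [readingWord, List.mem_append, ih]
    constructor
    · rintro (⟨i, hi⟩ | h)
      · exact ⟨i + 1, by simpa using hi⟩
      · exact ⟨0, h⟩
    · rintro ⟨_ | i, hi⟩
      · exact Or.inr hi
      · exact Or.inl ⟨i, by simpa using hi⟩

variable [LinearOrder α]

/-- Every entry of the row `s` has a smaller entry of the row `r` directly above it. -/
def RowAbove (r s : List α) : Prop :=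
  ∀ (c : ℕ) (b : α), s[c]? = some b → ∃ a, r[c]? = some a ∧ a < b

/-- Rows and columns are increasing, and the entries are distinct. -/
structure IsTableau (T : List (List α)) : Prop where
  row_lt : ∀ r, (tabRow T r).Pairwise (· < ·)
  above : ∀ r, RowAbove (tabRow T r) (tabRow T (r + 1))
  nodup : (readingWord T).Nodup

theorem RowAbove.length_le {r s : List α} (h : RowAbove r s) : s.length ≤ r.length := by
  by_contra! hlt
  obtain ⟨a, ha, -⟩ := h r.length s[r.length] (List.getElem?_eq_getElem hlt)
  simp at ha

theorem rowAbove_nil (r : List α) : RowAbove r [] := by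
  intro c b h
  simp at h

namespace IsTableau

theorem nil : IsTableau ([] : List (List α)) where
  row_lt := by simp
  above := by simp [rowAbove_nil]
  nodup := by simp [readingWord]

theorem tail {T : List (List α)} (h : IsTableau T) : IsTableau T.tail where
  row_lt r := by simpa using h.row_lt (r + 1)
  above r := by simpa using h.above (r + 1)
  nodup := by
    have := h.nodup
    rw [readingWord_eq] at this
    exact this.of_append_left

theorem cons {T : List (List α)} (h : IsTableau T) {r : List α} (hr : r.Pairwise (· < ·))
    (ha : RowAbove r (tabRow T 0)) (hn : (readingWord T ++ r).Nodup) : IsTableau (r :: T) where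
  row_lt i := by
    cases i with
    | zero => exact hr
    | succ i => simpa using h.row_lt i
  above i := by
    cases i with
    | zero => simpa using ha
    | succ i => simpa using h.above i
  nodup := hn

theorem notMem_tail {T : List (List α)} (h : IsTableau T) {x : α} (hx : x ∈ tabRow T 0) :
    x ∉ readingWord T.tail := by
  have := h.nodup
  rw [readingWord_eq] at this
  exact fun h' => (List.nodup_append.1 this).2.2 x h' x hx rfl

theorem rowLength_antitone {T : List (List α)} (h : IsTableau T) : Antitone (rowLength T) :=
  antitone_nat_of_succ_le fun r => (h.above r).length_le

end IsTableau

theorem rowInsert_eq (T : List (List α)) (x : α) :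
    rowInsert T x = match (tabRow T 0).find? (fun y => decide (x < y)) with
      | none => (tabRow T 0 ++ [x]) :: T.tail
      | some y => (tabRow T 0).map (fun z => if z = y then x else z) :: rowInsert T.tail y := by
  cases T <;> rfl

/-- Removing entries can leave empty rows at the bottom of the list. Tableaux are therefore compared
through `tabRow`, and every operation has to respect this. -/
theorem tabRow_rowInsert_congr {T T' : List (List α)} (h : tabRow T = tabRow T') (x : α) :
    tabRow (rowInsert T x) = tabRow (rowInsert T' x) := by
  induction T generalizing T' x with
  | nil =>
    have h0 : ∀ i, tabRow T' i = [] := fun i => by rw [← h]; simp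
    rw [rowInsert_eq, rowInsert_eq T']
    simp only [h0, tabRow_nil, List.find?_nil]
    ext1 i
    cases i <;> simp [h0]
  | cons r T ih =>
    have ht : tabRow T = tabRow T'.tail := by
      funext i
      rw [tabRow_tail, ← h, tabRow_cons_succ]
    rw [rowInsert_eq, rowInsert_eq T', ← h]
    cases (tabRow (r :: T) 0).find? (fun y => decide (x < y)) with
    | none =>
      ext1 i
      cases i <;> simp [ht]
    | some y =>
      ext1 i
      cases i with
      | zero => simp
      | succ i => simpa using congrFun (ih ht y) i

/-- The working form of row insertion. Since the row is strictly increasing, `y` occurs in it once,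
and the `map` in the definition changes a single position. -/
theorem rowInsert_cases {T : List (List α)} (hr : (tabRow T 0).Pairwise (· < ·)) {x : α}
    (hx : x ∉ tabRow T 0) :
    ((∀ z ∈ tabRow T 0, z < x) ∧ rowInsert T x = (tabRow T 0 ++ [x]) :: T.tail) ∨
      ∃ l y m, tabRow T 0 = l ++ y :: m ∧ (∀ z ∈ l, z < x) ∧ x < y ∧
        rowInsert T x = (l ++ x :: m) :: rowInsert T.tail y := by
  rw [rowInsert_eq]
  cases hf : (tabRow T 0).find? (fun y => decide (x < y)) with
  | none =>
    left
    simp only [List.find?_eq_none, decide_eq_true_eq, not_lt] at hf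
    exact ⟨fun z hz => lt_of_le_of_ne (hf z hz) (by rintro rfl; exact hx hz), rfl⟩
  | some y =>
    right
    obtain ⟨hy, l, m, he, hl⟩ := List.find?_eq_some_iff_append.1 hf
    simp only [decide_eq_true_eq] at hy
    refine ⟨l, y, m, he, ?_, hy, ?_⟩
    · intro z hz
      have := hl z hz
      simp only [Bool.not_eq_eq_eq_not, Bool.not_true, decide_eq_false_iff_not, not_lt] at this
      exact lt_of_le_of_ne this (by rintro rfl; apply hx; rw [he]; simp [hz])
    · simp only [he, List.cons.injEq, and_true]
      rw [he, List.pairwise_append] at hr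
      have hm := (List.pairwise_cons.1 hr.2.1).1
      rw [List.map_append, List.map_cons, if_pos rfl]
      congr 1
      · exact (List.map_congr_left (g := id) fun z hz =>
          if_neg (hr.2.2 z hz y (by simp)).ne).trans (List.map_id l)
      · congr 1
        exact (List.map_congr_left (g := id) fun z hz =>
          if_neg (hm z hz).ne').trans (List.map_id m)

/-- The bumped `y` lands in the next row `s` in a column `d` that is not to the right of the column
it left, because the entry that stood below `y` was larger than `y`. Hence the entry now above `y`
is `x` or an entry of `l`, all smaller than `y`; elsewhere entries of the upper row have only
decreased. -/
theorem rowAbove_insert {l m s s' : List α} {x y : α} (h : RowAbove (l ++ y :: m) s)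
    (hl : ∀ z ∈ l, z < x) (hxy : x < y)
    (hs : ((∀ z ∈ s, z < y) ∧ s' = s ++ [y]) ∨
      ∃ l' y' m', s = l' ++ y' :: m' ∧ (∀ z ∈ l', z < y) ∧ y < y' ∧ s' = l' ++ y :: m') :
    RowAbove (l ++ x :: m) s' := by
  obtain ⟨d, hd, hs1, hs2⟩ : ∃ d, (∀ c b, c < d → s[c]? = some b → b < y) ∧
      (∀ c, c ≠ d → ∀ b, s'[c]? = some b → s[c]? = some b) ∧ (∀ b, s'[d]? = some b → b = y) ∧
      (∀ c < d, c < s.length) := by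
    rcases hs with ⟨hs, rfl⟩ | ⟨l', y', m', rfl, hl', -, rfl⟩
    · refine ⟨s.length, fun c b _ hb => hs b (List.mem_of_getElem? hb), ?_, ?_, fun c hc => hc⟩
      · intro c hc b hb
        rcases lt_or_ge c s.length with h' | h'
        · rwa [List.getElem?_append_left h'] at hb
        · rw [List.getElem?_eq_none (by simp; omega)] at hb
          cases hb
      · intro b hb
        simpa using hb.symm
    · refine ⟨l'.length, ?_, ?_, ?_, ?_⟩
      · intro c b hc hb
        rw [List.getElem?_append_left hc] at hb
        exact hl' b (List.mem_of_getElem? hb)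
      · intro c hc b hb
        rcases lt_or_ge c l'.length with h' | h'
        · rwa [List.getElem?_append_left h'] at hb ⊢
        · rw [List.getElem?_append_right h'] at hb ⊢
          obtain ⟨e, he⟩ : ∃ e, c - l'.length = e + 1 := ⟨c - l'.length - 1, by omega⟩
          rw [he] at hb ⊢
          simpa using hb
      · intro b hb
        simpa using hb.symm
      · intro c hc
        simp; omega
  -- Otherwise the entry of `s` under the old place of `y` would be left of column `d`, hence
  -- smaller than `y`.
  have hdl : d ≤ l.length := by
    by_contra! hlt
    have h1 := hs2.2 _ hlt
    have h2 : s[l.length]? = some s[l.length] := List.getElem?_eq_getElem h1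
    obtain ⟨a, ha, hab⟩ := h _ _ h2
    simp only [List.getElem?_append_right le_rfl, Nat.sub_self, List.getElem?_cons_zero,
      Option.some.injEq] at ha
    subst ha
    exact lt_asymm hab (hd _ _ hlt h2)
  intro c b hb
  by_cases hc : c = d
  · subst hc
    rw [hs2.1 b hb]
    rcases hdl.lt_or_eq with h' | h'
    · rw [List.getElem?_append_left h']
      exact ⟨l[c], List.getElem?_eq_getElem h', (hl _ (List.getElem_mem h')).trans hxy⟩
    · exact ⟨x, by simp [h'], hxy⟩
  · obtain ⟨a, ha, hab⟩ := h c b (hs1 c hc b hb)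
    rcases lt_trichotomy c l.length with h' | h' | h'
    · rw [List.getElem?_append_left h'] at ha ⊢
      exact ⟨a, ha, hab⟩
    · subst h'
      simp only [List.getElem?_append_right le_rfl, Nat.sub_self, List.getElem?_cons_zero,
        Option.some.injEq] at ha ⊢
      subst ha
      exact ⟨x, rfl, hxy.trans hab⟩
    · rw [List.getElem?_append_right h'.le] at ha ⊢
      obtain ⟨e, he⟩ : ∃ e, c - l.length = e + 1 := ⟨c - l.length - 1, by omega⟩
      rw [he] at ha ⊢
      exact ⟨a, by simpa using ha, hab⟩

theorem perm_readingWord_rowInsert (T : List (List α)) (hT : IsTableau T) (x : α)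
    (hx : x ∉ readingWord T) : (readingWord (rowInsert T x)).Perm (x :: readingWord T) := by
  induction T generalizing x with
  | nil => simp [rowInsert, readingWord]
  | cons r T ih =>
    simp only [readingWord, List.mem_append, not_or] at hx
    rcases rowInsert_cases (hT.row_lt 0) (x := x) hx.2 with ⟨-, h⟩ | ⟨l, y, m, he, hl, hxy, h⟩
    · rw [h]
      simp only [tabRow_cons_zero, List.tail_cons, readingWord]
      rw [← List.append_assoc]
      exact List.perm_append_singleton _ _
    · rw [h]
      simp only [tabRow_cons_zero] at he
      subst he
      have := ih hT.tail y (hT.notMem_tail (by simp))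
      simp only [List.tail_cons, readingWord]
      refine (this.append_right _).trans ?_
      rw [← Multiset.coe_eq_coe]
      simp only [← Multiset.cons_coe, ← Multiset.coe_add]
      simp only [← Multiset.singleton_add]
      abel

/-- A bump carries `y` to the front of its row, which in the reading word is the position right
behind the lower rows: there `y` is about to be inserted into them. -/
theorem knuthEquiv_rowInsert (T : List (List α)) (hT : IsTableau T) (x : α)
    (hx : x ∉ readingWord T) : KnuthEquiv (readingWord T ++ [x]) (readingWord (rowInsert T x)) := by
  induction T generalizing x with
  | nil => exact KnuthEquiv.refl _
  | cons r T ih =>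
    simp only [readingWord, List.mem_append, not_or] at hx
    have hr := hT.row_lt 0
    rcases rowInsert_cases hr (x := x) hx.2 with ⟨-, h⟩ | ⟨l, y, m, he, hl, hxy, h⟩
    · rw [h]
      simpa [readingWord] using KnuthEquiv.refl _
    · rw [h]
      simp only [tabRow_cons_zero] at he
      subst he
      have h1 := (KnuthEquiv.bump hr hl hxy).append_left (readingWord T)
      have h2 := (ih hT.tail y (hT.notMem_tail (by simp))).append_right (l ++ x :: m)
      simp only [List.tail_cons, readingWord, List.append_assoc, List.cons_append,
        List.nil_append] at h1 h2 ⊢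
      exact h1.trans h2

theorem growsAt_rowInsert (T : List (List α)) (hT : IsTableau T) (x : α)
    (hx : x ∉ readingWord T) : ∃ r₀, GrowsAt r₀ (rowLength T) (rowLength (rowInsert T x)) := by
  induction T generalizing x with
  | nil =>
    refine ⟨0, fun r => ?_⟩
    cases r <;> simp [rowInsert, rowLength]
  | cons r T ih =>
    simp only [readingWord, List.mem_append, not_or] at hx
    have hr := hT.row_lt 0
    rcases rowInsert_cases hr (x := x) hx.2 with ⟨-, h⟩ | ⟨l, y, m, he, hl, hxy, h⟩
    · rw [h]
      refine ⟨0, fun r => ?_⟩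
      cases r <;> simp [rowLength]
    · rw [h]
      simp only [tabRow_cons_zero] at he
      subst he
      obtain ⟨r₀, h₀⟩ := ih hT.tail y (hT.notMem_tail (by simp))
      refine ⟨r₀ + 1, fun r => ?_⟩
      cases r with
      | zero => simp [rowLength]
      | succ r => simpa [rowLength] using h₀ r

theorem isTableau_rowInsert (T : List (List α)) (hT : IsTableau T) (x : α)
    (hx : x ∉ readingWord T) : IsTableau (rowInsert T x) := by
  induction T generalizing x with
  | nil =>
    refine IsTableau.cons IsTableau.nil (by simp) (by simp [rowAbove_nil]) (by simp [readingWord])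
  | cons r T ih =>
    have hx' := hx
    simp only [readingWord, List.mem_append, not_or] at hx
    have hr := hT.row_lt 0
    have hn : (readingWord (rowInsert (r :: T) x)).Nodup :=
      (perm_readingWord_rowInsert _ hT x hx').nodup_iff.2 (List.nodup_cons.2 ⟨hx', hT.nodup⟩)
    rcases rowInsert_cases hr (x := x) hx.2 with ⟨hlt, h⟩ | ⟨l, y, m, he, hl, hxy, h⟩
    · rw [h] at hn ⊢
      refine hT.tail.cons ?_ ?_ hn
      · simp only [List.pairwise_append]
        exact ⟨hr, by simp, fun a ha b hb => by simp at hb; exact hb ▸ hlt a ha⟩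
      · intro c b hb
        obtain ⟨a, ha, hab⟩ := hT.above 0 c b (by simpa using hb)
        refine ⟨a, ?_, hab⟩
        obtain ⟨hc, -⟩ := List.getElem?_eq_some_iff.1 ha
        rwa [List.getElem?_append_left hc]
    · rw [h] at hn ⊢
      simp only [tabRow_cons_zero] at he hr
      subst he
      have hy := hT.notMem_tail (x := y) (by simp)
      refine (ih hT.tail y hy).cons ?_ ?_ hn
      · simp only [List.pairwise_append, List.pairwise_cons, List.mem_cons] at hr ⊢
        refine ⟨hr.1, ⟨fun b hb => hxy.trans (hr.2.1.1 b hb), hr.2.1.2⟩, ?_⟩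
        rintro a ha b (rfl | hb)
        · exact hl a ha
        · exact hr.2.2 a ha b (Or.inr hb)
      · have hT0 : tabRow T 0 = tabRow (List.tail ((l ++ y :: m) :: T)) 0 := rfl
        refine rowAbove_insert (s := tabRow T 0) (by simpa using hT.above 0) hl hxy ?_
        have hy0 : y ∉ tabRow T 0 := fun h' => hy (mem_readingWord.2 ⟨0, h'⟩)
        rcases rowInsert_cases (hT.tail.row_lt 0) (x := y) hy0 with
          ⟨hlt, h⟩ | ⟨l', y', m', he, hl', hxy', h⟩
        · left
          simp only [List.tail_cons] at h ⊢
          rw [h]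
          exact ⟨hlt, rfl⟩
        · right
          simp only [List.tail_cons] at h he ⊢
          rw [h]
          exact ⟨l', y', m', he, hl', hxy', rfl⟩

/-- Reversing a bump: the bumped letter determines row and inserted letter. -/
theorem bump_unique {l l' m m' : List α} {x x' y : α} (h : l ++ x :: m = l' ++ x' :: m')
    (hx : x < y) (hx' : x' < y) (hm : ∀ z ∈ m, y < z) (hm' : ∀ z ∈ m', y < z) :
    l = l' ∧ x = x' ∧ m = m' := by
  induction l generalizing l' with
  | nil =>
    cases l' with
    | nil => simpa using h
    | cons a l' =>
      simp only [List.nil_append, List.cons_append, List.cons.injEq] at h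
      have : x' ∈ m := by rw [h.2]; simp
      exact absurd (hm _ this) (lt_asymm hx')
  | cons a l ih =>
    cases l' with
    | nil =>
      simp only [List.nil_append, List.cons_append, List.cons.injEq] at h
      have : x ∈ m' := by rw [← h.2]; simp
      exact absurd (hm' _ this) (lt_asymm hx)
    | cons a' l' =>
      simp only [List.cons_append, List.cons.injEq] at h
      obtain ⟨h1, h2, h3⟩ := ih h.2
      exact ⟨by rw [h.1, h1], h2, h3⟩

/-- Comparing row lengths shows whether the first row was lengthened or bumped. In the latter case
the lower rows determine the bumped letter `y` by induction, and the inserted letter is the last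
entry smaller than `y` in the new first row. -/
theorem rowInsert_injective {T T' : List (List α)} (hT : IsTableau T) (hT' : IsTableau T')
    {x x' : α} (hx : x ∉ readingWord T) (hx' : x' ∉ readingWord T')
    (hs : rowLength T = rowLength T')
    (h : tabRow (rowInsert T x) = tabRow (rowInsert T' x')) :
    x = x' ∧ tabRow T = tabRow T' := by
  induction T generalizing T' x x' with
  | nil =>
    have h0 : ∀ i, tabRow T' i = [] := fun i => by
      rw [← List.length_eq_zero_iff]
      have := congrFun hs i
      simpa [rowLength] using this.symm
    rw [rowInsert_eq, rowInsert_eq T'] at h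
    have := congrFun h 0
    simp [h0] at this
    refine ⟨this, funext fun i => ?_⟩
    simp [h0]
  | cons r T ih =>
    have hr := hT.row_lt 0
    have hr' := hT'.row_lt 0
    have hs0 : r.length = (tabRow T' 0).length := congrFun hs 0
    have hst : rowLength T = rowLength T'.tail := by
      funext i
      have := congrFun hs (i + 1)
      simpa [rowLength] using this
    have e0 := congrFun h 0
    have e1 := fun i => congrFun h (i + 1)
    have hm : ∀ {l m : List α} {y : α}, (l ++ y :: m).Pairwise (· < ·) → ∀ z ∈ m, y < z := by
      intro l m y hp
      rw [List.pairwise_append, List.pairwise_cons] at hp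
      exact hp.2.1.1
    rcases rowInsert_cases hr (x := x) (fun h' => hx (mem_readingWord.2 ⟨0, h'⟩)) with
        ⟨-, h1⟩ | ⟨l, y, m, he, -, hxy, h1⟩ <;>
      rcases rowInsert_cases hr' (x := x') (fun h' => hx' (mem_readingWord.2 ⟨0, h'⟩)) with
        ⟨-, h2⟩ | ⟨l', y', m', he', -, hxy', h2⟩ <;>
      rw [h1, h2] at e0 e1 <;> simp only [tabRow_cons_zero, tabRow_cons_succ] at e0 e1
    · obtain ⟨a, b⟩ := List.append_inj e0 hs0
      refine ⟨by simpa using b, funext fun i => ?_⟩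
      cases i with
      | zero => simpa using a
      | succ i => simpa using e1 i
    · have := congrArg List.length e0
      simp [hs0, he'] at this
    · have := congrArg List.length e0
      simp only [tabRow_cons_zero] at he
      rw [he] at hs0
      simp [← hs0] at this
    · rw [he] at hr
      rw [he'] at hr'
      obtain ⟨rfl, ht⟩ := ih hT.tail hT'.tail (hT.notMem_tail (by rw [he]; simp))
        (hT'.notMem_tail (by rw [he']; simp)) hst (funext e1)
      obtain ⟨rfl, rfl, rfl⟩ := bump_unique e0 hxy hxy' (hm hr) (hm hr')
      refine ⟨rfl, funext fun i => ?_⟩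
      cases i with
      | zero => rw [he, he']
      | succ i => simpa using congrFun ht i

/-- The last entry smaller than `y` is the one that `y` has to displace when a bump is undone. -/
theorem exists_split_lt {r : List α} (hr : r.Pairwise (· < ·)) {y : α} (hy : y ∉ r)
    (h : ∃ a ∈ r, a < y) : ∃ l x m, r = l ++ x :: m ∧ x < y ∧ ∀ z ∈ m, y < z := by
  induction r with
  | nil => simp at h
  | cons a r ih =>
    simp only [List.mem_cons, not_or] at hy
    by_cases h' : ∃ b ∈ r, b < y
    · obtain ⟨l, x, m, rfl, hx, hm⟩ := ih (List.pairwise_cons.1 hr).2 hy.2 h'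
      exact ⟨a :: l, x, m, rfl, hx, hm⟩
    · push Not at h'
      obtain ⟨b, hb, hby⟩ := h
      rcases List.mem_cons.1 hb with rfl | hb
      · exact ⟨[], b, r, rfl, hby, fun z hz => lt_of_le_of_ne (h' z hz)
          (by rintro rfl; exact hy.2 hz)⟩
      · exact absurd hby (not_lt.2 (h' b hb))

/-- The first entry larger than `x` is unique; this identifies the letter bumped by row insertion
with the one placed there when undoing a bump. -/
theorem split_unique {l l' m m' : List α} {x y y' : α} (h : l ++ y :: m = l' ++ y' :: m')
    (hl : ∀ z ∈ l, z < x) (hl' : ∀ z ∈ l', z < x) (hy : x < y) (hy' : x < y') :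
    l = l' ∧ y = y' ∧ m = m' := by
  induction l generalizing l' with
  | nil =>
    cases l' with
    | nil => simpa using h
    | cons b l' =>
      simp only [List.nil_append, List.cons_append, List.cons.injEq] at h
      exact absurd (hl' b (by simp)) (h.1 ▸ lt_asymm hy)
  | cons b l ih =>
    cases l' with
    | nil =>
      simp only [List.nil_append, List.cons_append, List.cons.injEq] at h
      exact absurd (hl b (by simp)) (h.1 ▸ lt_asymm hy')
    | cons b' l' =>
      simp only [List.cons_append, List.cons.injEq] at h
      obtain ⟨h1, h2, h3⟩ := ih h.2 (fun z hz => hl z (List.mem_cons_of_mem _ hz))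
        (fun z hz => hl' z (List.mem_cons_of_mem _ hz))
      exact ⟨by rw [h.1, h1], h2, h3⟩

/-- The column of the inserted letter in the first row. -/
theorem exists_rowInsert_column {T : List (List α)} (hT : IsTableau T) {y : α}
    (hy : y ∉ readingWord T) :
    ∃ d : ℕ, (tabRow (rowInsert T y) 0)[d]? = some y ∧
      (∀ (c : ℕ) b, (tabRow T 0)[c]? = some b → c ≠ d → (tabRow (rowInsert T y) 0)[c]? = some b) ∧
      (∀ (c : ℕ) b, (tabRow T 0)[c]? = some b → d ≤ c → y < b) := by
  have hp := hT.row_lt 0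
  rcases rowInsert_cases (hT.row_lt 0) (x := y) (fun h' => hy (mem_readingWord.2 ⟨0, h'⟩))
    with ⟨-, h1⟩ | ⟨l, y', m, he, -, hxy, h1⟩
  · rw [h1]
    refine ⟨(tabRow T 0).length, by rw [tabRow_cons_zero]; simp, ?_, ?_⟩
    · intro c b hb hcd
      obtain ⟨hcl, -⟩ := List.getElem?_eq_some_iff.1 hb
      rw [tabRow_cons_zero, List.getElem?_append_left hcl, hb]
    · intro c b hb hcd
      obtain ⟨hcl, -⟩ := List.getElem?_eq_some_iff.1 hb
      omega
  · rw [h1]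
    rw [he] at hp ⊢
    refine ⟨l.length, by rw [tabRow_cons_zero]; simp, ?_, ?_⟩
    · intro c b hb hcd
      rw [tabRow_cons_zero]
      rcases lt_or_ge c l.length with h' | h'
      · rwa [List.getElem?_append_left h'] at hb ⊢
      · rw [List.getElem?_append_right h'] at hb ⊢
        obtain ⟨e, hce⟩ : ∃ e, c - l.length = e + 1 := ⟨c - l.length - 1, by omega⟩
        rw [hce] at hb ⊢
        simpa using hb
    · intro c b hb hcd
      rw [List.getElem?_append_right hcd] at hb
      rcases List.mem_cons.1 (List.mem_of_getElem? hb) with rfl | hbm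
      · exact hxy
      · rw [List.pairwise_append, List.pairwise_cons] at hp
        exact hxy.trans (hp.2.1.1 b hbm)

/-- Every corner of a tableau can be vacated by undoing a row insertion. -/
theorem exists_rowInsert_eq {T' : List (List α)} (hT' : IsTableau T') {r₀ : ℕ}
    (hc : rowLength T' (r₀ + 1) < rowLength T' r₀) :
    ∃ T x, IsTableau T ∧ x ∉ readingWord T ∧ rowInsert T x = T' ∧
      GrowsAt r₀ (rowLength T) (rowLength T') := by
  induction r₀ generalizing T' with
  | zero =>
    cases T' with
    | nil => simp [rowLength] at hc
    | cons r' T'' =>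
      obtain ⟨s, x, rfl⟩ : ∃ s x, r' = s ++ [x] := by
        rcases List.eq_nil_or_concat' r' with rfl | ⟨s, x, rfl⟩
        · simp [rowLength] at hc
        · exact ⟨s, x, rfl⟩
      have hr := hT'.row_lt 0
      have hn := hT'.nodup
      simp only [tabRow_cons_zero, List.pairwise_append] at hr
      simp only [readingWord, ← List.append_assoc] at hn
      have hlt : ∀ z ∈ s, z < x := fun z hz => hr.2.2 z hz x (by simp)
      have hT : IsTableau (s :: T'') := by
        refine hT'.tail.cons hr.1 ?_ hn.of_append_left
        intro c b hb
        obtain ⟨a, ha, hab⟩ := hT'.above 0 c b (by simpa using hb)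
        refine ⟨a, ?_, hab⟩
        obtain ⟨hcl, -⟩ := List.getElem?_eq_some_iff.1 hb
        simp [rowLength] at hc
        rw [List.tail_cons] at hcl
        rwa [tabRow_cons_zero, List.getElem?_append_left (by omega)] at ha
      have hx : x ∉ readingWord (s :: T'') := fun h' =>
        (List.nodup_append.1 hn).2.2 x h' x (by simp) rfl
      refine ⟨s :: T'', x, hT, hx, ?_, ?_⟩
      · rcases rowInsert_cases (hT.row_lt 0) (x := x) (fun h' => hx (mem_readingWord.2 ⟨0, h'⟩))
          with ⟨-, h1⟩ | ⟨l, y, m, he, -, hxy, -⟩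
        · simpa using h1
        · exact absurd (hlt y (by simp only [tabRow_cons_zero] at he; simp [he])) (lt_asymm hxy)
      · intro i
        cases i <;> simp [rowLength]
  | succ r₀ ih =>
    cases T' with
    | nil => simp [rowLength] at hc
    | cons r' T'' =>
      -- By induction the insertion into the lower rows is undone, which expels `y`. It returns to
      -- the first row and expels the last entry `x` smaller than `y`.
      obtain ⟨T, y, hT, hy, rfl, hg⟩ := ih (T' := T'') hT'.tail (by simpa [rowLength] using hc)
      have hr := hT'.row_lt 0
      have hab := hT'.above 0
      have hn := hT'.nodup
      simp only [tabRow_cons_zero, tabRow_cons_succ] at hr hab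
      have hyr : y ∉ r' := fun h' => hT'.notMem_tail (x := y) h'
        ((perm_readingWord_rowInsert T hT y hy).mem_iff.2 (by simp))
      -- The entry `a` above the column `d` of `y` is smaller than `y`. So a letter to be displaced
      -- exists, and it is in column `d` or further right.
      obtain ⟨d, hd, hd', hd''⟩ := exists_rowInsert_column hT hy
      obtain ⟨a, had, hay⟩ := hab d y hd
      obtain ⟨l, x, m, rfl, hxy, hm⟩ := exists_split_lt hr hyr ⟨a, List.mem_of_getElem? had, hay⟩
      have hdl : d ≤ l.length := by
        by_contra! hlt
        rw [List.getElem?_append_right hlt.le] at had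
        obtain ⟨e, hce⟩ : ∃ e, d - l.length = e + 1 := ⟨d - l.length - 1, by omega⟩
        rw [hce] at had
        exact lt_asymm hay (hm a (List.mem_of_getElem? (by simpa using had)))
      have hperm : (x :: (readingWord T ++ (l ++ y :: m))).Perm
          (readingWord (rowInsert T y) ++ (l ++ x :: m)) := by
        refine List.Perm.trans ?_ ((perm_readingWord_rowInsert T hT y hy).append_right _).symm
        rw [← Multiset.coe_eq_coe]
        simp only [← Multiset.cons_coe, ← Multiset.coe_add]
        simp only [← Multiset.singleton_add]
        abel
      have hn' := List.nodup_cons.1 (hperm.nodup_iff.2 hn)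
      simp only [List.pairwise_append, List.pairwise_cons, List.mem_cons] at hr
      have hT1 : IsTableau ((l ++ y :: m) :: T) := by
        refine hT.cons ?_ ?_ hn'.2
        · simp only [List.pairwise_append, List.pairwise_cons, List.mem_cons]
          refine ⟨hr.1, ⟨hm, hr.2.1.2⟩, ?_⟩
          rintro z hz w (rfl | hw)
          · exact (hr.2.2 z hz x (Or.inl rfl)).trans hxy
          · exact hr.2.2 z hz w (Or.inr hw)
        · intro c b hb
          -- In the column that receives `y` the entry below is one of those from column `d` on, all
          -- larger than `y`. In column `d` itself the old chain `a < y < b` is used. In all other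
          -- columns nothing has changed.
          by_cases hcl : c = l.length
          · subst hcl
            exact ⟨y, by simp, hd'' _ b hb hdl⟩
          · have heq : (l ++ y :: m)[c]? = (l ++ x :: m)[c]? := by
              rcases lt_or_ge c l.length with h' | h'
              · rw [List.getElem?_append_left h', List.getElem?_append_left h']
              · rw [List.getElem?_append_right h', List.getElem?_append_right h']
                obtain ⟨e, hce⟩ : ∃ e, c - l.length = e + 1 := ⟨c - l.length - 1, by omega⟩
                rw [hce]
                simp
            rw [heq]
            by_cases hcd : c = d
            · subst hcd
              exact ⟨a, had, hay.trans (hd'' _ b hb le_rfl)⟩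
            · exact hab c b (hd' c b hb hcd)
      refine ⟨(l ++ y :: m) :: T, x, hT1, hn'.1, ?_, ?_⟩
      · rcases rowInsert_cases (hT1.row_lt 0) (x := x)
          (fun h' => hn'.1 (mem_readingWord (T := (l ++ y :: m) :: T).2 ⟨0, h'⟩))
          with ⟨h2, -⟩ | ⟨l', y', m', he, hl', hxy', h1⟩
        · exact absurd (h2 y (by simp)) (lt_asymm hxy)
        · simp only [tabRow_cons_zero] at he
          have hl'' := split_unique he (fun z hz => hr.2.2 z hz x (Or.inl rfl)) hl' hxy hxy'
          obtain ⟨rfl, rfl, rfl⟩ := hl''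
          simpa using h1
      · intro i
        cases i with
        | zero => simp [rowLength]
        | succ i => simpa [rowLength] using hg i

end Tableau

/-! ### Longest monotone subwords of the reading word of a tableau -/

section TableauChains

variable {α : Type*} [LinearOrder α]

/-- A row is increasing, so it contributes at most one letter to a decreasing subword. -/
theorem rowLength_pos_of_chain_gt {T : List (List α)} (hT : IsTableau T) {l : List α}
    (hl : l.Sublist (readingWord T)) (hp : l.Pairwise (· > ·)) (hne : l ≠ []) :
    0 < rowLength T (l.length - 1) := by
  induction T generalizing l with
  | nil =>
    simp only [readingWord, List.sublist_nil] at hl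
    exact absurd hl hne
  | cons r T ih =>
    have hanti := hT.rowLength_antitone
    obtain ⟨l₁, l₂, rfl, h1, h2⟩ := List.sublist_append_iff.1 hl
    have hr : l₂.Pairwise (· < ·) := (hT.row_lt 0).sublist h2
    rw [List.pairwise_append] at hp
    have hlen : l₂.length ≤ 1 := by
      match l₂, hr, hp.2.1 with
      | [], _, _ => simp
      | [_], _, _ => simp
      | a :: b :: _, h, h' =>
        exact absurd ((List.pairwise_cons.1 h).1 b (by simp))
          (lt_asymm ((List.pairwise_cons.1 h').1 b (by simp)))
    by_cases hn : l₁ = []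
    · subst hn
      have h0 : l₂ ≠ [] := by simpa using hne
      have : 0 < rowLength (r :: T) 0 :=
        lt_of_lt_of_le (List.length_pos_iff.2 h0) h2.length_le
      convert this using 2
      simp; omega
    · have h3 := ih hT.tail h1 hp.1 hn
      have h4 : 0 < rowLength (r :: T) (l₁.length - 1 + 1) := by simpa [rowLength] using h3
      refine h4.trans_le (hanti ?_)
      have := List.length_pos_iff.2 hn
      simp; omega

/-- The first column, read from bottom to top, is such a chain. The last clause, a lower bound for
all its letters, lets the induction prepend a row. -/
theorem exists_chain_gt {T : List (List α)} (hT : IsTableau T) {k : ℕ} (hk : 0 < rowLength T k) :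
    ∃ l : List α, l.Sublist (readingWord T) ∧ l.Pairwise (· > ·) ∧ l.length = k + 1 ∧
      ∀ a, (tabRow T 0)[0]? = some a → ∀ z ∈ l, a ≤ z := by
  induction T generalizing k with
  | nil => simp [rowLength] at hk
  | cons r T ih =>
    have h0 : 0 < rowLength (r :: T) 0 := hk.trans_le (hT.rowLength_antitone (Nat.zero_le k))
    obtain ⟨a, r, rfl⟩ := List.exists_cons_of_ne_nil (List.length_pos_iff.1 h0)
    cases k with
    | zero =>
      refine ⟨[a], ?_, by simp, rfl, ?_⟩
      · simp [readingWord]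
      · intro b hb z hz
        simp at hb hz
        rw [hz, hb]
    | succ k =>
      have hk' : 0 < rowLength T k := by simpa [rowLength] using hk
      obtain ⟨l, hl, hp, hlen, hz⟩ := ih hT.tail hk'
      have h1 : 0 < (tabRow T 0).length :=
        hk'.trans_le (hT.tail.rowLength_antitone (Nat.zero_le k))
      obtain ⟨b, hb⟩ : ∃ b, (tabRow T 0)[0]? = some b := ⟨_, List.getElem?_eq_getElem h1⟩
      obtain ⟨a', ha', hab⟩ := hT.above 0 0 b (by simpa using hb)
      simp at ha'
      subst ha'
      have hlt : ∀ z ∈ l, a < z := fun z h => hab.trans_le (hz b hb z h)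
      refine ⟨l ++ [a], hl.append (by simp), ?_, by simp [hlen], ?_⟩
      · rw [List.pairwise_append]
        exact ⟨hp, by simp, fun z h w hw => by simp at hw; exact hw ▸ hlt z h⟩
      · intro c hc z hz'
        simp at hc hz'
        subst hc
        rcases hz' with h | rfl
        · exact (hlt z h).le
        · exact le_rfl

theorem hasChain_gt_readingWord {T : List (List α)} (hT : IsTableau T) (k : ℕ) :
    HasChain (· > ·) (readingWord T) (k + 1) ↔ 0 < rowLength T k := by
  constructor
  · rintro ⟨l, hl, hp, hk⟩
    have := rowLength_pos_of_chain_gt hT hl hp (by rintro rfl; simp at hk)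
    rwa [hk] at this
  · intro h
    obtain ⟨l, hl, hp, hk, -⟩ := exists_chain_gt hT h
    exact ⟨l, hl, hp, hk⟩

/-- Above every entry that is at most `b` stands another one in the same column. -/
theorem RowAbove.countP_le {r s : List α} (h : RowAbove r s) (b : α) :
    s.countP (fun z => decide (z ≤ b)) ≤ r.countP (fun z => decide (z ≤ b)) := by
  induction s generalizing r with
  | nil => simp
  | cons c s ih =>
    cases r with
    | nil =>
      obtain ⟨a, ha, -⟩ := h 0 c (by simp)
      simp at ha
    | cons a r =>
      obtain ⟨a', ha, hac⟩ := h 0 c (by simp)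
      simp at ha
      subst ha
      have := ih (r := r) (fun i y hy => by simpa using h (i + 1) y (by simpa using hy))
      rw [List.countP_cons, List.countP_cons]
      by_cases hc : c ≤ b
      · simp [hc, hac.le.trans hc, this]
      · simp [hc]; omega

/-- The bound `b` makes the induction work. If the part of the chain in the lower rows ends with
`c`, its length is at most the number of entries `≤ c` in the second row, hence in the first; the
remaining part consists of entries of the first row in the interval `(c, b]`. -/
theorem length_le_of_chain_lt {T : List (List α)} (hT : IsTableau T) {l : List α}
    (hl : l.Sublist (readingWord T)) (hp : l.Pairwise (· < ·)) {b : α} (hb : ∀ z ∈ l, z ≤ b) :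
    l.length ≤ (tabRow T 0).countP (fun z => decide (z ≤ b)) := by
  induction T generalizing l b with
  | nil =>
    simp only [readingWord, List.sublist_nil] at hl
    simp [hl]
  | cons r T ih =>
    obtain ⟨l₁, l₂, rfl, h1, h2⟩ := List.sublist_append_iff.1 hl
    rw [List.pairwise_append] at hp
    have hb2 : ∀ z ∈ l₂, z ≤ b := fun z hz => hb z (by simp [hz])
    rcases List.eq_nil_or_concat' l₁ with rfl | ⟨l₀, c, rfl⟩
    · have h3 := h2.countP_le (p := fun z => decide (z ≤ b))
      rw [List.countP_eq_length.2 (by simpa using hb2)] at h3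
      simpa using h3
    · have hc : ∀ z ∈ l₀ ++ [c], z ≤ c := by
        intro z hz
        have := hp.1
        rw [List.pairwise_append] at this
        rcases List.mem_append.1 hz with h | h
        · exact (this.2.2 z h c (by simp)).le
        · simp at h; exact h.le
      have h3 := (ih hT.tail h1 hp.1 hc).trans
        ((show RowAbove r (tabRow T 0) by simpa using hT.above 0).countP_le c)
      have h4 := h2.countP_le (p := fun z => decide (c < z ∧ z ≤ b))
      rw [List.countP_eq_length.2 (by
        intro z hz
        simpa using ⟨hp.2.2 c (by simp) z hz, hb2 z hz⟩)] at h4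
      have hcb : c ≤ b := hb c (by simp)
      have h5 : ∀ r : List α, r.countP (fun z => decide (z ≤ b)) =
          r.countP (fun z => decide (z ≤ c)) + r.countP (fun z => decide (c < z ∧ z ≤ b)) := by
        intro r
        induction r with
        | nil => simp
        | cons z r ih =>
          simp only [List.countP_cons, ih, decide_eq_true_eq]
          rcases le_or_gt z c with h | h
          · simp [h, h.trans hcb, not_lt.2 h]; omega
          · simp [h, not_le.2 h]; omega
      rw [List.length_append, tabRow_cons_zero, h5]
      exact Nat.add_le_add h3 h4

theorem hasChain_lt_readingWord {T : List (List α)} (hT : IsTableau T) (k : ℕ) :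
    HasChain (· < ·) (readingWord T) k ↔ k ≤ rowLength T 0 := by
  constructor
  · rintro ⟨l, hl, hp, rfl⟩
    rcases List.eq_nil_or_concat' l with rfl | ⟨l₀, c, rfl⟩
    · simp
    · refine (length_le_of_chain_lt hT hl hp (b := c) ?_).trans List.countP_le_length
      intro z hz
      rw [List.pairwise_append] at hp
      rcases List.mem_append.1 hz with h | h
      · exact (hp.2.2 z h c (by simp)).le
      · simp at h; exact h.le
  · intro h
    refine ⟨(tabRow T 0).take k, ?_, (hT.row_lt 0).sublist (List.take_sublist _ _), ?_⟩
    · rw [readingWord_eq]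
      exact (List.take_sublist _ _).trans (List.sublist_append_right _ _)
    · simpa [rowLength] using h

end TableauChains

/-! ### Adding and removing a largest entry -/

section AddEntry

variable {α : Type*}

/-- Append `x` to the row `r₀`. -/
def addEntry (x : α) : ℕ → List (List α) → List (List α)
  | 0, T => (tabRow T 0 ++ [x]) :: T.tail
  | r₀ + 1, T => tabRow T 0 :: addEntry x r₀ T.tail

theorem tabRow_addEntry (x : α) (r₀ : ℕ) (T : List (List α)) (i : ℕ) :
    tabRow (addEntry x r₀ T) i = tabRow T i ++ if i = r₀ then [x] else [] := by
  induction r₀ generalizing T i with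
  | zero => cases i <;> simp [addEntry]
  | succ r₀ ih => cases i <;> simp [addEntry, ih]

theorem perm_readingWord_addEntry (x : α) (r₀ : ℕ) (T : List (List α)) :
    (readingWord (addEntry x r₀ T)).Perm (x :: readingWord T) := by
  induction r₀ generalizing T with
  | zero =>
    rw [addEntry, readingWord_eq T, readingWord, ← List.append_assoc]
    exact List.perm_append_singleton _ _
  | succ r₀ ih =>
    rw [addEntry, readingWord_eq T, readingWord]
    exact (ih T.tail).append_right _

theorem growsAt_addEntry (x : α) (r₀ : ℕ) (T : List (List α)) :
    GrowsAt r₀ (rowLength T) (rowLength (addEntry x r₀ T)) := by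
  intro i
  rw [rowLength, rowLength, tabRow_addEntry]
  split_ifs <;> simp

end AddEntry

section RemoveEntry

variable {α : Type*} [LinearOrder α]

theorem tabRow_removeEntry (T : List (List α)) (x : α) (i : ℕ) :
    tabRow (removeEntry T x) i = (tabRow T i).filter (fun y => decide (y ≠ x)) := by
  simp only [tabRow, removeEntry, List.getD_eq_getElem?_getD, List.getElem?_map]
  cases T[i]? <;> simp

theorem readingWord_removeEntry (T : List (List α)) (x : α) :
    readingWord (removeEntry T x) = (readingWord T).filter (fun y => decide (y ≠ x)) := by
  induction T with
  | nil => rfl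
  | cons r T ih =>
    simp only [removeEntry, List.map_cons, readingWord, List.filter_append] at ih ⊢
    rw [ih]

/-- The maximum of an increasing row can only be its last entry, so removing it shifts no other
entry. -/
theorem filter_ne_max {r : List α} (hr : r.Pairwise (· < ·)) {x : α} (hx : ∀ z ∈ r, z ≤ x) :
    (x ∉ r ∧ r.filter (fun y => decide (y ≠ x)) = r) ∨
      r = r.filter (fun y => decide (y ≠ x)) ++ [x] := by
  by_cases h : x ∈ r
  · right
    rcases List.eq_nil_or_concat' r with rfl | ⟨s, c, rfl⟩
    · simp at h
    · rw [List.pairwise_append] at hr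
      have hc : c = x := by
        rcases List.mem_append.1 h with h' | h'
        · exact absurd (hr.2.2 x h' c (by simp)) (not_lt.2 (hx c (by simp)))
        · simp at h'; exact h'.symm
      subst hc
      have : s.filter (fun y => decide (y ≠ c)) = s := by
        rw [List.filter_eq_self]
        intro z hz
        simpa using (hr.2.2 z hz c (by simp)).ne
      rw [List.filter_append, this]
      simp
  · left
    refine ⟨h, ?_⟩
    rw [List.filter_eq_self]
    intro z hz
    simp only [decide_eq_true_eq]
    rintro rfl
    exact h hz

theorem getElem?_filter_ne_max {r : List α} (hr : r.Pairwise (· < ·)) {x : α}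
    (hx : ∀ z ∈ r, z ≤ x) (c : ℕ) (b : α) :
    (r.filter (fun y => decide (y ≠ x)))[c]? = some b ↔ r[c]? = some b ∧ b ≠ x := by
  rcases filter_ne_max hr hx with ⟨hxr, h⟩ | h
  · rw [h]
    refine ⟨fun hb => ⟨hb, ?_⟩, fun hb => hb.1⟩
    rintro rfl
    exact hxr (List.mem_of_getElem? hb)
  · generalize hs : r.filter (fun y => decide (y ≠ x)) = s at h
    subst h
    have hsx : x ∉ s := by
      rw [← hs]
      simp
    rcases lt_trichotomy c s.length with h' | h' | h'
    · rw [List.getElem?_append_left h']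
      refine ⟨fun hb => ⟨hb, ?_⟩, fun hb => hb.1⟩
      rintro rfl
      exact hsx (List.mem_of_getElem? hb)
    · subst h'
      simp only [List.getElem?_concat_length, Option.some.injEq]
      rw [List.getElem?_eq_none le_rfl]
      simp only [reduceCtorEq, ne_eq, false_iff, not_and, not_not]
      exact fun h => h.symm
    · rw [List.getElem?_eq_none (by omega), List.getElem?_eq_none (by simp; omega)]
      simp

/-- The entry above a surviving entry is smaller than it, hence different from the maximum `x`, and
survives in the same column. -/
theorem isTableau_removeEntry {T : List (List α)} (hT : IsTableau T) {x : α}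
    (hx : ∀ z ∈ readingWord T, z ≤ x) : IsTableau (removeEntry T x) where
  row_lt i := by
    rw [tabRow_removeEntry]
    exact (hT.row_lt i).sublist List.filter_sublist
  above i := by
    have hx' : ∀ i, ∀ z ∈ tabRow T i, z ≤ x := fun i z hz => hx z (mem_readingWord.2 ⟨i, hz⟩)
    intro c b hb
    rw [tabRow_removeEntry] at hb ⊢
    rw [getElem?_filter_ne_max (hT.row_lt _) (hx' _)] at hb
    obtain ⟨a, ha, hab⟩ := hT.above i c b hb.1
    refine ⟨a, ?_, hab⟩
    rw [getElem?_filter_ne_max (hT.row_lt _) (hx' _)]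
    exact ⟨ha, (hab.trans_le (hx' _ b (List.mem_of_getElem? hb.1))).ne⟩
  nodup := by
    rw [readingWord_removeEntry]
    exact hT.nodup.filter _

theorem growsAt_removeEntry {T : List (List α)} (hT : IsTableau T) {x : α}
    (hx : ∀ z ∈ readingWord T, z ≤ x) (hmem : x ∈ readingWord T) :
    ∃ r₀, GrowsAt r₀ (rowLength (removeEntry T x)) (rowLength T) := by
  induction T with
  | nil => simp [readingWord] at hmem
  | cons r T ih =>
    have hx0 : ∀ z ∈ r, z ≤ x := fun z hz => hx z (by simp [readingWord, hz])
    have hx1 : ∀ z ∈ readingWord T, z ≤ x := fun z hz => hx z (by simp [readingWord, hz])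
    rcases filter_ne_max (hT.row_lt 0) hx0 with ⟨hxr, h⟩ | h
    · have hm : x ∈ readingWord T := by
        simp only [readingWord, List.mem_append] at hmem
        exact hmem.resolve_right hxr
      obtain ⟨r₀, h₀⟩ := ih hT.tail hx1 hm
      refine ⟨r₀ + 1, fun i => ?_⟩
      cases i with
      | zero =>
        simp only [rowLength, tabRow_removeEntry, tabRow_cons_zero] at h ⊢
        rw [h]
        simp
      | succ i =>
        have := h₀ i
        simp only [rowLength, tabRow_removeEntry] at this
        simpa [rowLength, tabRow_removeEntry] using this
    · have hxr : x ∈ tabRow (r :: T) 0 := by rw [h]; simp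
      have hm := hT.notMem_tail hxr
      refine ⟨0, fun i => ?_⟩
      cases i with
      | zero =>
        simp only [rowLength, tabRow_removeEntry, tabRow_cons_zero] at h ⊢
        have := congrArg List.length h
        simpa using this
      | succ i =>
        simp only [rowLength, tabRow_removeEntry, tabRow_cons_succ]
        rw [List.filter_eq_self.2]
        · simp
        · intro z hz
          simp only [decide_eq_true_eq]
          rintro rfl
          exact hm (mem_readingWord.2 ⟨i, hz⟩)

theorem tabRow_removeEntry_congr {T T' : List (List α)} (h : tabRow T = tabRow T') (x : α) :
    tabRow (removeEntry T x) = tabRow (removeEntry T' x) := by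
  funext i
  rw [tabRow_removeEntry, tabRow_removeEntry, h]

/-- The row lengths before the removal reveal the row that ended with `x`. -/
theorem removeEntry_injective {T T' : List (List α)} (hT : IsTableau T) (hT' : IsTableau T')
    {x : α} (hx : ∀ z ∈ readingWord T, z ≤ x) (hx' : ∀ z ∈ readingWord T', z ≤ x)
    (hs : rowLength T = rowLength T')
    (h : tabRow (removeEntry T x) = tabRow (removeEntry T' x)) : tabRow T = tabRow T' := by
  funext i
  have hi := congrFun h i
  have hsi : (tabRow T i).length = (tabRow T' i).length := congrFun hs i
  rw [tabRow_removeEntry, tabRow_removeEntry] at hi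
  have c1 := filter_ne_max (hT.row_lt i) (fun z hz => hx z (mem_readingWord.2 ⟨i, hz⟩))
  have c2 := filter_ne_max (hT'.row_lt i) (fun z hz => hx' z (mem_readingWord.2 ⟨i, hz⟩))
  rw [hi] at c1
  rcases c1 with ⟨-, c1⟩ | c1 <;> rcases c2 with ⟨-, c2⟩ | c2
  · rw [← c1, c2]
  · rw [c2, ← c1] at hsi
    simp at hsi
  · rw [c1, c2] at hsi
    simp at hsi
  · exact c1.trans c2.symm

/-- A letter larger than all entries violates no inequality at the end of a row; the only condition
is that the new row lengths still decrease. -/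
theorem isTableau_addEntry {T : List (List α)} (hT : IsTableau T) {x : α} {r₀ : ℕ}
    (hx : ∀ z ∈ readingWord T, z < x) (hanti : Antitone (rowLength (addEntry x r₀ T))) :
    IsTableau (addEntry x r₀ T) where
  row_lt i := by
    rw [tabRow_addEntry, List.pairwise_append]
    refine ⟨hT.row_lt i, by split_ifs <;> simp, fun a ha b hb => ?_⟩
    split_ifs at hb
    · simp at hb
      exact hb ▸ hx a (mem_readingWord.2 ⟨i, ha⟩)
    · simp at hb
  above i := by
    intro c b hb
    rcases lt_or_ge c (tabRow T (i + 1)).length with hc | hc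
    · rw [tabRow_addEntry, List.getElem?_append_left hc] at hb
      obtain ⟨a, ha, hab⟩ := hT.above i c b hb
      refine ⟨a, ?_, hab⟩
      obtain ⟨hc', -⟩ := List.getElem?_eq_some_iff.1 ha
      rwa [tabRow_addEntry, List.getElem?_append_left hc']
    · obtain ⟨hc', -⟩ := List.getElem?_eq_some_iff.1 hb
      have hlen := hanti (Nat.le_succ i)
      simp only [rowLength, Nat.succ_eq_add_one] at hlen
      rw [tabRow_addEntry] at hb hc'
      rw [List.getElem?_append_right hc] at hb
      have hi : i + 1 = r₀ := by
        by_contra hne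
        rw [if_neg hne] at hb
        simp at hb
      rw [if_pos hi] at hb hc'
      have hb' : b = x := by simpa using List.mem_of_getElem? hb
      simp only [tabRow_addEntry, hi, if_true, if_neg (show i ≠ r₀ by omega), List.append_nil,
        List.length_append, List.length_singleton] at hlen hc'
      rw [tabRow_addEntry, if_neg (by omega), List.append_nil]
      have hc2 : c < (tabRow T i).length := by rw [hi] at hc; omega
      refine ⟨_, List.getElem?_eq_getElem hc2, ?_⟩
      rw [hb']
      exact hx _ (mem_readingWord.2 ⟨i, List.getElem_mem hc2⟩)
  nodup := (perm_readingWord_addEntry x r₀ T).nodup_iff.2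
    (List.nodup_cons.2 ⟨fun h => lt_irrefl x (hx x h), hT.nodup⟩)

theorem tabRow_removeEntry_addEntry {T : List (List α)} {x : α} (r₀ : ℕ)
    (hx : x ∉ readingWord T) : tabRow (removeEntry (addEntry x r₀ T) x) = tabRow T := by
  funext i
  rw [tabRow_removeEntry, tabRow_addEntry, List.filter_append, List.filter_eq_self.2]
  · split_ifs <;> simp
  · intro z hz
    simp only [decide_eq_true_eq]
    rintro rfl
    exact hx (mem_readingWord.2 ⟨i, hz⟩)

end RemoveEntry

/-! ### Sequences of insertions and removals, independently of diagrams -/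

/-- A step in a sequence of tableaux. -/
inductive TableauStep (α : Type*)
  | idle : TableauStep α
  | insert (x : α) : TableauStep α
  | remove (x : α) : TableauStep α

instance {α : Type*} : Inhabited (TableauStep α) := ⟨.idle⟩

section Schedule

theorem not_growsAt_self {r₀ : ℕ} {f : ℕ → ℕ} : ¬ GrowsAt r₀ f f := fun h => by
  have := h r₀
  simp at this

theorem GrowsAt.not_symm {r₀ r₁ : ℕ} {f g : ℕ → ℕ} (h : GrowsAt r₀ f g) : ¬ GrowsAt r₁ g f :=
  fun h' => by
    have h1 := h r₀
    have h2 := h' r₀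
    simp only [if_true] at h1
    omega

theorem readingWord_congr {α : Type*} {T T' : List (List α)} (h : tabRow T = tabRow T') :
    readingWord T = readingWord T' := by
  induction T generalizing T' with
  | nil =>
    induction T' with
    | nil => rfl
    | cons r T' ih =>
      have h0 := congrFun h 0
      simp only [tabRow_nil, tabRow_cons_zero] at h0
      rw [← h0]
      simp only [readingWord, List.append_nil]
      exact ih (funext fun i => by simpa using congrFun h (i + 1))
  | cons r T ih =>
    rw [readingWord_eq, readingWord_eq T', ← h, List.tail_cons,
      ih (T' := T'.tail) (funext fun i => by simpa using congrFun h (i + 1))]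

theorem rowLength_congr {α : Type*} {U U' : List (List α)} (h : tabRow U = tabRow U') :
    rowLength U = rowLength U' := by
  funext i
  rw [rowLength, rowLength, h]

variable {α : Type*} [LinearOrder α]

theorem IsTableau.congr {T T' : List (List α)} (hT : IsTableau T) (h : tabRow T = tabRow T') :
    IsTableau T' where
  row_lt := h ▸ hT.row_lt
  above := h ▸ hT.above
  nodup := readingWord_congr h ▸ hT.nodup

/-- The effect of a step on a tableau. -/
def TableauStep.apply : TableauStep α → List (List α) → List (List α)
  | .idle, T => T
  | .insert x, T => rowInsert T x
  | .remove x, T => removeEntry T x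

theorem TableauStep.tabRow_apply_congr {T T' : List (List α)} (h : tabRow T = tabRow T')
    (s : TableauStep α) : tabRow (s.apply T) = tabRow (s.apply T') := by
  cases s with
  | idle => exact h
  | insert x => exact tabRow_rowInsert_congr h x
  | remove x => exact tabRow_removeEntry_congr h x

/-- Read from right to left, every letter is inserted once and later removed, and the letters are
removed in decreasing order. -/
structure IsSchedule (N : ℕ) (s : ℕ → TableauStep α) : Prop where
  remove_lt : ∀ p q x y, p < q → q < N → s p = .remove x → s q = .remove y → x < y
  insert_of_remove : ∀ q x, q < N → s q = .remove x → ∃ p, q < p ∧ p < N ∧ s p = .insert x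
  remove_of_insert : ∀ p x, p < N → s p = .insert x → ∃ q, q < p ∧ s q = .remove x
  insert_unique : ∀ p q x, p < N → q < N → s p = .insert x → s q = .insert x → p = q

/-- The tableaux `T N, …, T 0` arise by the steps `s`, up to empty rows at the bottom. -/
structure IsRun (N : ℕ) (s : ℕ → TableauStep α) (T : ℕ → List (List α)) : Prop where
  last : tabRow (T N) = tabRow []
  step : ∀ p, p < N → tabRow (T p) = tabRow ((s p).apply (T (p + 1)))

/-- The letter `x` is present between the steps `p - 1` and `p`. -/
def OpenAt (N : ℕ) (s : ℕ → TableauStep α) (p : ℕ) (x : α) : Prop :=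
  (∃ q, q < p ∧ s q = .remove x) ∧ ∃ q, p ≤ q ∧ q < N ∧ s q = .insert x

/-- The step that inserts `x` is to the left of the step that inserts `y`. -/
def ClosesBefore (N : ℕ) (s : ℕ → TableauStep α) (x y : α) : Prop :=
  ∀ p q, p < N → q < N → s p = .insert x → s q = .insert y → p < q

/-- The tableau `T` is the one at position `p` of a schedule. -/
structure TableauAt (N : ℕ) (s : ℕ → TableauStep α) (p : ℕ) (T : List (List α)) : Prop where
  isTableau : IsTableau T
  mem_iff : ∀ x, x ∈ readingWord T ↔ OpenAt N s p x
  word : ∃ w : List α, KnuthEquiv w (readingWord T) ∧ w.Nodup ∧ (∀ x, x ∈ w ↔ OpenAt N s p x) ∧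
    w.Pairwise (fun x y => ClosesBefore N s y x)

variable {N : ℕ} {s : ℕ → TableauStep α} {T : ℕ → List (List α)}

theorem TableauAt.congr {p : ℕ} {U U' : List (List α)} (h : TableauAt N s p U)
    (hU : tabRow U = tabRow U') : TableauAt N s p U' where
  isTableau := h.isTableau.congr hU
  mem_iff := readingWord_congr hU ▸ h.mem_iff
  word := readingWord_congr hU ▸ h.word

theorem TableauAt.notMem_of_insert {p : ℕ} {U : List (List α)} (hs : IsSchedule N s)
    (h : TableauAt N s (p + 1) U) (hp : p < N) {x : α} (hx : s p = .insert x) :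
    x ∉ readingWord U := by
  rw [h.mem_iff]
  rintro ⟨-, q, hq, hqN, hqx⟩
  have := hs.insert_unique p q x hp hqN hx hqx
  omega

theorem TableauAt.mem_of_remove {p : ℕ} {U : List (List α)} (hs : IsSchedule N s)
    (h : TableauAt N s (p + 1) U) (hp : p < N) {x : α} (hx : s p = .remove x) :
    x ∈ readingWord U := by
  rw [h.mem_iff]
  obtain ⟨q, hq, hqN, hqx⟩ := hs.insert_of_remove p x hp hx
  exact ⟨⟨p, by omega, hx⟩, q, hq, hqN, hqx⟩

/-- A letter still present is removed further to the left or right now, and the letters removed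
further left are smaller. -/
theorem OpenAt.le_of_remove {p : ℕ} (hs : IsSchedule N s) (hp : p < N) {x : α}
    (hx : s p = .remove x) {z : α} (hz : OpenAt N s (p + 1) z) : z ≤ x := by
  obtain ⟨⟨q, hq, hqz⟩, -⟩ := hz
  rcases (Nat.lt_succ_iff.1 hq).lt_or_eq with h | rfl
  · exact (hs.remove_lt q p z x h hp hqz hx).le
  · rw [hx] at hqz
    cases hqz
    exact le_rfl

theorem TableauAt.le_of_remove {p : ℕ} {U : List (List α)} (hs : IsSchedule N s)
    (h : TableauAt N s (p + 1) U) (hp : p < N) {x : α} (hx : s p = .remove x) :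
    ∀ z ∈ readingWord U, z ≤ x :=
  fun z hz => ((h.mem_iff z).1 hz).le_of_remove hs hp hx

theorem openAt_idle {p : ℕ} (hi : s p = .idle) (z : α) :
    OpenAt N s p z ↔ OpenAt N s (p + 1) z := by
  constructor
  · rintro ⟨⟨q, hq, hqz⟩, q', hq', hN, hqz'⟩
    refine ⟨⟨q, by omega, hqz⟩, q', ?_, hN, hqz'⟩
    rcases hq'.lt_or_eq with h | rfl
    · exact h
    · rw [hi] at hqz'; cases hqz'
  · rintro ⟨⟨q, hq, hqz⟩, q', hq', hN, hqz'⟩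
    refine ⟨⟨q, ?_, hqz⟩, q', by omega, hN, hqz'⟩
    rcases (Nat.lt_succ_iff.1 hq).lt_or_eq with h | rfl
    · exact h
    · rw [hi] at hqz; cases hqz

theorem openAt_insert {p : ℕ} (hs : IsSchedule N s) (hp : p < N) {x : α} (hi : s p = .insert x)
    (z : α) : OpenAt N s p z ↔ z = x ∨ OpenAt N s (p + 1) z := by
  constructor
  · rintro ⟨⟨q, hq, hqz⟩, q', hq', hN, hqz'⟩
    rcases hq'.lt_or_eq with h | rfl
    · exact Or.inr ⟨⟨q, by omega, hqz⟩, q', h, hN, hqz'⟩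
    · rw [hi] at hqz'; cases hqz'; exact Or.inl rfl
  · rintro (rfl | ⟨⟨q, hq, hqz⟩, q', hq', hN, hqz'⟩)
    · obtain ⟨q, hq, hqz⟩ := hs.remove_of_insert p z hp hi
      exact ⟨⟨q, hq, hqz⟩, p, le_rfl, hp, hi⟩
    · refine ⟨⟨q, ?_, hqz⟩, q', by omega, hN, hqz'⟩
      rcases (Nat.lt_succ_iff.1 hq).lt_or_eq with h | rfl
      · exact h
      · rw [hi] at hqz; cases hqz

theorem openAt_remove {p : ℕ} (hs : IsSchedule N s) (hp : p < N) {x : α} (hi : s p = .remove x)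
    (z : α) : OpenAt N s p z ↔ OpenAt N s (p + 1) z ∧ z ≠ x := by
  constructor
  · rintro ⟨⟨q, hq, hqz⟩, q', hq', hN, hqz'⟩
    refine ⟨⟨⟨q, by omega, hqz⟩, q', ?_, hN, hqz'⟩, (hs.remove_lt q p z x hq hp hqz hi).ne⟩
    rcases hq'.lt_or_eq with h | rfl
    · exact h
    · rw [hi] at hqz'; cases hqz'
  · rintro ⟨⟨⟨q, hq, hqz⟩, q', hq', hN, hqz'⟩, hne⟩
    refine ⟨⟨q, ?_, hqz⟩, q', by omega, hN, hqz'⟩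
    rcases (Nat.lt_succ_iff.1 hq).lt_or_eq with h | rfl
    · exact h
    · rw [hi] at hqz; cases hqz; exact absurd rfl hne

/-- The invariant behind the whole proof: `w` lists the open letters in order of insertion. An
insertion appends `x` to `w`; a removal takes the maximum away, which is the same as restricting to
the letters below `x`. Both operations respect Knuth equivalence. -/
theorem TableauAt.step (hs : IsSchedule N s) {p : ℕ} (hp : p < N) {U : List (List α)}
    (h : TableauAt N s (p + 1) U) : TableauAt N s p ((s p).apply U) := by
  obtain ⟨w, hw, hn, hm, hc⟩ := h.word
  cases hi : s p with
  | idle =>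
    refine ⟨h.isTableau, fun x => ?_, w, hw, hn, fun x => ?_, hc⟩
    · rw [openAt_idle hi]; exact h.mem_iff x
    · rw [openAt_idle hi]; exact hm x
  | insert x =>
    have hx := h.notMem_of_insert hs hp hi
    have hxw : x ∉ w := by rwa [hm, ← h.mem_iff]
    refine ⟨isTableau_rowInsert U h.isTableau x hx, fun z => ?_, w ++ [x], ?_, ?_, fun z => ?_, ?_⟩
    · rw [openAt_insert hs hp hi, ← h.mem_iff]
      exact (perm_readingWord_rowInsert U h.isTableau x hx).mem_iff.trans List.mem_cons
    · exact (hw.append_right [x]).trans (knuthEquiv_rowInsert U h.isTableau x hx)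
    · exact (List.perm_append_singleton x w).nodup_iff.2 (List.nodup_cons.2 ⟨hxw, hn⟩)
    · rw [openAt_insert hs hp hi, ← hm]
      simp [or_comm]
    · rw [List.pairwise_append]
      refine ⟨hc, by simp, fun a ha b hb => ?_⟩
      simp only [List.mem_singleton] at hb
      subst hb
      intro q q' hq hq' hqx hqa
      rw [hs.insert_unique q p b hq hp hqx hi]
      obtain ⟨-, q'', h1, h2, h3⟩ := (hm a).1 ha
      rw [hs.insert_unique q' q'' a hq' h2 hqa h3]
      exact h1
  | remove x =>
    have hle := h.le_of_remove hs hp hi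
    refine ⟨isTableau_removeEntry h.isTableau hle, fun z => ?_,
      w.filter (fun a => decide (a < x)), ?_, hn.filter _, fun z => ?_, hc.filter _⟩
    · rw [openAt_remove hs hp hi, ← h.mem_iff]
      simp [TableauStep.apply, readingWord_removeEntry]
    · have hf : readingWord (removeEntry U x) =
          (readingWord U).filter (fun a => decide (a < x)) := by
        rw [readingWord_removeEntry]
        refine List.filter_congr fun z hz => ?_
        rw [decide_eq_decide]
        exact (hle z hz).lt_iff_ne.symm
      simpa [TableauStep.apply, hf] using hw.filter_lt x
    · rw [openAt_remove hs hp hi, List.mem_filter, hm, decide_eq_true_eq]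
      refine and_congr_right fun hz => ?_
      exact (hz.le_of_remove hs hp hi).lt_iff_ne

theorem IsRun.tableauAt (hs : IsSchedule N s) (hT : IsRun N s T) {p : ℕ} (hp : p ≤ N) :
    TableauAt N s p (T p) := by
  induction hp using Nat.decreasingInduction with
  | self =>
    have ho : ∀ x, ¬ OpenAt N s N x := by
      rintro x ⟨-, q, h, h', -⟩
      omega
    refine TableauAt.congr ⟨IsTableau.nil, fun x => ?_, [], KnuthEquiv.refl _, List.nodup_nil,
      fun x => ?_, List.Pairwise.nil⟩ hT.last.symm <;> simp [readingWord, ho]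
  | of_succ p hp ih => exact (ih.step hs hp).congr (hT.step p hp).symm

/-- A letter present at position 0 would have to be removed to the left of it. -/
theorem IsRun.first (hs : IsSchedule N s) (hT : IsRun N s T) : tabRow (T 0) = tabRow [] := by
  have h := (hT.tableauAt hs (Nat.zero_le N)).mem_iff
  funext i
  rw [tabRow_nil, List.eq_nil_iff_forall_not_mem]
  intro x hx
  obtain ⟨⟨q, hq, -⟩, -⟩ := (h x).1 (mem_readingWord.2 ⟨i, hx⟩)
  omega

theorem IsRun.rowLength_idle (hT : IsRun N s T) {p : ℕ} (hp : p < N) (hi : s p = .idle) :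
    rowLength (T p) = rowLength (T (p + 1)) := by
  rw [rowLength_congr (hT.step p hp), hi, TableauStep.apply]

theorem IsRun.growsAt_insert (hs : IsSchedule N s) (hT : IsRun N s T) {p : ℕ} (hp : p < N) {x : α}
    (hi : s p = .insert x) : ∃ r₀, GrowsAt r₀ (rowLength (T (p + 1))) (rowLength (T p)) := by
  have h := hT.tableauAt hs (p := p + 1) hp
  rw [rowLength_congr (hT.step p hp), hi, TableauStep.apply]
  exact growsAt_rowInsert _ h.isTableau x (h.notMem_of_insert hs hp hi)

theorem IsRun.growsAt_remove (hs : IsSchedule N s) (hT : IsRun N s T) {p : ℕ} (hp : p < N) {x : α}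
    (hi : s p = .remove x) : ∃ r₀, GrowsAt r₀ (rowLength (T p)) (rowLength (T (p + 1))) := by
  have h := hT.tableauAt hs (p := p + 1) hp
  rw [rowLength_congr (hT.step p hp), hi, TableauStep.apply]
  exact growsAt_removeEntry h.isTableau (h.le_of_remove hs hp hi) (h.mem_of_remove hs hp hi)

theorem IsRun.idle_iff (hs : IsSchedule N s) (hT : IsRun N s T) {p : ℕ} (hp : p < N) :
    s p = .idle ↔ rowLength (T p) = rowLength (T (p + 1)) := by
  refine ⟨hT.rowLength_idle hp, fun h => ?_⟩
  cases hi : s p with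
  | idle => rfl
  | insert x =>
    obtain ⟨r, hr⟩ := hT.growsAt_insert hs hp hi
    rw [h] at hr
    exact absurd hr not_growsAt_self
  | remove x =>
    obtain ⟨r, hr⟩ := hT.growsAt_remove hs hp hi
    rw [h] at hr
    exact absurd hr not_growsAt_self

/-- A schedule is determined by its shapes and the labels of the removing steps. -/
theorem IsSchedule.ext_of_rowLength {s' : ℕ → TableauStep α} {T' : ℕ → List (List α)}
    (hs : IsSchedule N s) (hs' : IsSchedule N s') (hT : IsRun N s T) (hT' : IsRun N s' T')
    (hl : ∀ p, p ≤ N → rowLength (T p) = rowLength (T' p))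
    (hx : ∀ p x x', p < N → s p = .remove x → s' p = .remove x' → x = x') {p : ℕ} (hp : p < N) :
    s p = s' p := by
  -- The induction runs from left to right, against the direction of construction. The change of
  -- shape reveals the kind of step; an insertion is inverted by `rowInsert_injective`, and the
  -- label of a removal is given by `hx`.
  have key : ∀ p, p < N → tabRow (T p) = tabRow (T' p) →
      s p = s' p ∧ tabRow (T (p + 1)) = tabRow (T' (p + 1)) := by
    intro p hp h
    have h1 := hT.tableauAt hs (p := p + 1) hp
    have h2 := hT'.tableauAt hs' (p := p + 1) hp
    have e0 := hl p hp.le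
    have e1 := hl (p + 1) hp
    have hh := h
    rw [hT.step p hp, hT'.step p hp] at hh
    cases hi : s p with
    | idle =>
      have g := hT.rowLength_idle hp hi
      cases hi' : s' p with
      | idle =>
        rw [hi, hi'] at hh
        exact ⟨rfl, hh⟩
      | insert x =>
        obtain ⟨r, hr⟩ := hT'.growsAt_insert hs' hp hi'
        rw [← e0, ← e1, g] at hr
        exact absurd hr not_growsAt_self
      | remove x =>
        obtain ⟨r, hr⟩ := hT'.growsAt_remove hs' hp hi'
        rw [← e0, ← e1, g] at hr
        exact absurd hr not_growsAt_self
    | insert x =>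
      obtain ⟨r₀, g⟩ := hT.growsAt_insert hs hp hi
      cases hi' : s' p with
      | idle =>
        have g' := hT'.rowLength_idle hp hi'
        rw [e0, e1, g'] at g
        exact absurd g not_growsAt_self
      | insert x' =>
        rw [hi, hi'] at hh
        obtain ⟨rfl, h3⟩ := rowInsert_injective h1.isTableau h2.isTableau
          (h1.notMem_of_insert hs hp hi) (h2.notMem_of_insert hs' hp hi') e1 hh
        exact ⟨rfl, h3⟩
      | remove x =>
        obtain ⟨r, hr⟩ := hT'.growsAt_remove hs' hp hi'
        rw [← e0, ← e1] at hr
        exact absurd hr g.not_symm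
    | remove x =>
      obtain ⟨r₀, g⟩ := hT.growsAt_remove hs hp hi
      cases hi' : s' p with
      | idle =>
        have g' := hT'.rowLength_idle hp hi'
        rw [e0, e1, g'] at g
        exact absurd g not_growsAt_self
      | insert x' =>
        obtain ⟨r, hr⟩ := hT'.growsAt_insert hs' hp hi'
        rw [← e0, ← e1] at hr
        exact absurd hr g.not_symm
      | remove x' =>
        obtain rfl := hx p x x' hp hi hi'
        rw [hi, hi'] at hh
        exact ⟨rfl, removeEntry_injective h1.isTableau h2.isTableau (h1.le_of_remove hs hp hi)
          (h2.le_of_remove hs' hp hi') e1 hh⟩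
  have all : ∀ p, p ≤ N → tabRow (T p) = tabRow (T' p) := by
    intro p
    induction p with
    | zero => exact fun _ => (hT.first hs).trans (hT'.first hs').symm
    | succ p ih => exact fun hp => (key p hp (ih (by omega))).2
  exact (key p hp (all p hp.le)).1

/-- The word `w` has no repetitions and is ordered by `C`, so its subwords are the subsets of its
letters listed in this order. Such a subword is a chain for `R` exactly if `R` and `C` agree on the
subset. -/
theorem hasChain_iff_exists_finset {R C : α → α → Prop} [Std.Asymm R] [Std.Trichotomous R]
    {w : List α} (hn : w.Nodup) (hw : w.Pairwise C) (hC : ∀ x ∈ w, ∀ y ∈ w, C x y → ¬ C y x)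
    (k : ℕ) : HasChain R w k ↔ ∃ S : Finset α, S.card = k ∧ (∀ x ∈ S, x ∈ w) ∧
      ∀ x ∈ S, ∀ y ∈ S, R x y → C x y := by
  constructor
  · rintro ⟨l, hl, hp, rfl⟩
    refine ⟨l.toFinset, List.toFinset_card_of_nodup (hn.sublist hl),
      fun x hx => hl.subset (List.mem_toFinset.1 hx), fun x hx y hy hxy => ?_⟩
    rw [List.mem_toFinset] at hx hy
    have h2 : l.Pairwise (fun x y => (R x y ∧ C x y) ∨ (R y x ∧ C y x)) :=
      (hp.and (hw.sublist hl)).imp Or.inl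
    have hne : x ≠ y := by
      rintro rfl
      exact asymm hxy hxy
    have : Std.Symm (fun x y => (R x y ∧ C x y) ∨ (R y x ∧ C y x)) := ⟨fun a b h => h.symm⟩
    rcases h2.forall hx hy hne with h | h
    · exact h.2
    · exact absurd h.1 (asymm hxy)
  · rintro ⟨S, rfl, hS, hR⟩
    refine ⟨w.filter (fun x => decide (x ∈ S)), List.filter_sublist, ?_, ?_⟩
    · refine ((hw.filter _).and (hn.filter _)).imp_of_mem ?_
      rintro x y hx hy ⟨hc, hne⟩
      simp only [List.mem_filter, decide_eq_true_eq] at hx hy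
      by_contra hR'
      have : R y x := by
        by_contra hR''
        exact hne (Std.Trichotomous.trichotomous x y hR' hR'')
      exact hC x hx.1 y hy.1 hc (hR y hy.2 x hx.2 this)
    · rw [← List.toFinset_card_of_nodup (hn.filter _)]
      congr 1
      ext x
      simp only [List.mem_toFinset, List.mem_filter, decide_eq_true_eq]
      exact ⟨fun h => h.2, fun h => ⟨hS x h, h⟩⟩

theorem ClosesBefore.not_symm {x y : α} {p p' : ℕ} (hx : OpenAt N s p x) (hy : OpenAt N s p' y)
    (h : ClosesBefore N s x y) : ¬ ClosesBefore N s y x := by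
  obtain ⟨-, a, -, ha, hax⟩ := hx
  obtain ⟨-, b, -, hb, hby⟩ := hy
  intro h'
  exact lt_asymm (h a b ha hb hax hby) (h' b a hb ha hby hax)

/-- The number of rows is the largest number of mutually crossing letters. -/
theorem IsRun.rowLength_pos_iff (hs : IsSchedule N s) (hT : IsRun N s T) {p : ℕ} (hp : p ≤ N)
    (k : ℕ) : 0 < rowLength (T p) k ↔ ∃ S : Finset α, S.card = k + 1 ∧
      (∀ x ∈ S, OpenAt N s p x) ∧ ∀ x ∈ S, ∀ y ∈ S, x < y → ClosesBefore N s x y := by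
  have h := hT.tableauAt hs hp
  obtain ⟨w, hw, hn, hm, hc⟩ := h.word
  rw [← hasChain_gt_readingWord h.isTableau, ← hw.hasChain_gt_iff,
    hasChain_iff_exists_finset hn hc (fun x hx y hy hxy =>
      hxy.not_symm ((hm y).1 hy) ((hm x).1 hx))]
  refine exists_congr fun S => and_congr_right fun _ => and_congr (forall₂_congr fun x _ => hm x) ?_
  exact ⟨fun h x hx y hy hxy => h y hy x hx hxy, fun h x hx y hy hxy => h y hy x hx hxy⟩

/-- The number of columns is the largest number of mutually nesting letters. -/
theorem IsRun.le_rowLength_iff (hs : IsSchedule N s) (hT : IsRun N s T) {p : ℕ} (hp : p ≤ N)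
    (k : ℕ) : k ≤ rowLength (T p) 0 ↔ ∃ S : Finset α, S.card = k ∧
      (∀ x ∈ S, OpenAt N s p x) ∧ ∀ x ∈ S, ∀ y ∈ S, x < y → ClosesBefore N s y x := by
  have h := hT.tableauAt hs hp
  obtain ⟨w, hw, hn, hm, hc⟩ := h.word
  rw [← hasChain_lt_readingWord h.isTableau, ← hw.hasChain_lt_iff,
    hasChain_iff_exists_finset hn hc (fun x hx y hy hxy =>
      hxy.not_symm ((hm y).1 hy) ((hm x).1 hx))]
  refine exists_congr fun S => and_congr_right fun _ => and_congr (forall₂_congr fun x _ => hm x) ?_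
  rfl

/-- The inductive step in the construction of a schedule from its shapes. -/
theorem exists_tableauStep {lam : ℕ → ℕ → ℕ} {ℓ : ℕ → α} (hanti : ∀ p, p ≤ N → Antitone (lam p))
    (hstep : ∀ p, p < N → lam p = lam (p + 1) ∨ (∃ r, GrowsAt r (lam p) (lam (p + 1))) ∨
      ∃ r, GrowsAt r (lam (p + 1)) (lam p))
    (hℓ : ∀ p q, p < q → q < N → (∃ r, GrowsAt r (lam p) (lam (p + 1))) →
      (∃ r, GrowsAt r (lam q) (lam (q + 1))) → ℓ p < ℓ q)
    (p : ℕ) (hp : p < N) (U : List (List α)) (hU : IsTableau U) (hUl : rowLength U = lam p)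
    (hUm : ∀ x ∈ readingWord U, ∃ q, q < p ∧ (∃ r, GrowsAt r (lam q) (lam (q + 1))) ∧ x = ℓ q) :
    ∃ (U' : List (List α)) (t : TableauStep α), IsTableau U' ∧ rowLength U' = lam (p + 1) ∧
      tabRow U = tabRow (t.apply U') ∧
      ((t = .idle ∧ (¬ ∃ r, GrowsAt r (lam p) (lam (p + 1))) ∧
          ∀ z, z ∈ readingWord U ↔ z ∈ readingWord U') ∨
        (∃ x, t = .insert x ∧ (¬ ∃ r, GrowsAt r (lam p) (lam (p + 1))) ∧ x ∉ readingWord U' ∧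
          ∀ z, z ∈ readingWord U ↔ z = x ∨ z ∈ readingWord U') ∨
        (t = .remove (ℓ p) ∧ (∃ r, GrowsAt r (lam p) (lam (p + 1))) ∧
          ∀ z, z ∈ readingWord U' ↔ z = ℓ p ∨ z ∈ readingWord U)) := by
  -- An unchanged shape is an idle step. A new square receives `ℓ p`, which exceeds all entries
  -- present. A lost square is a corner, where a row insertion is undone.
  rcases hstep p hp with h | ⟨r, h⟩ | ⟨r, h⟩
  · refine ⟨U, .idle, hU, hUl.trans h, rfl, Or.inl ⟨rfl, ?_, fun z => Iff.rfl⟩⟩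
    rintro ⟨r, hr⟩
    rw [h] at hr
    exact not_growsAt_self hr
  · have hlt : ∀ z ∈ readingWord U, z < ℓ p := by
      intro z hz
      obtain ⟨q, hq, hup, rfl⟩ := hUm z hz
      exact hℓ q p hq hp hup ⟨r, h⟩
    have hrl : rowLength (addEntry (ℓ p) r U) = lam (p + 1) := by
      funext i
      rw [growsAt_addEntry (ℓ p) r U i, h i, hUl]
    refine ⟨addEntry (ℓ p) r U, .remove (ℓ p), isTableau_addEntry hU hlt ?_, hrl, ?_,
      Or.inr (Or.inr ⟨rfl, ⟨r, h⟩, fun z => ?_⟩)⟩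
    · rw [hrl]
      exact hanti _ hp
    · exact (tabRow_removeEntry_addEntry r fun h => lt_irrefl _ (hlt _ h)).symm
    · exact (perm_readingWord_addEntry (ℓ p) r U).mem_iff.trans List.mem_cons
  · have hc : rowLength U (r + 1) < rowLength U r := by
      rw [hUl, h, h]
      have := hanti (p + 1) hp (Nat.le_succ r)
      simp only [Nat.succ_eq_add_one] at this
      simp
      omega
    obtain ⟨U', x, hU', hx, rfl, hg⟩ := exists_rowInsert_eq hU hc
    refine ⟨U', .insert x, hU', ?_, rfl, Or.inr (Or.inl ⟨x, rfl, ?_, hx, fun z => ?_⟩)⟩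
    · funext i
      have h1 := h i
      have h2 := hg i
      rw [hUl] at h2
      omega
    · rintro ⟨r', h'⟩
      exact h.not_symm h'
    · exact (perm_readingWord_rowInsert U' hU' x hx).mem_iff.trans List.mem_cons

/-- Every sequence of shapes comes from a schedule, with prescribed increasing labels of the
removing steps. -/
theorem exists_schedule {lam : ℕ → ℕ → ℕ} {ℓ : ℕ → α} (hanti : ∀ p, p ≤ N → Antitone (lam p))
    (h0 : lam 0 = fun _ => 0) (hN : lam N = fun _ => 0)
    (hstep : ∀ p, p < N → lam p = lam (p + 1) ∨ (∃ r, GrowsAt r (lam p) (lam (p + 1))) ∨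
      ∃ r, GrowsAt r (lam (p + 1)) (lam p))
    (hℓ : ∀ p q, p < q → q < N → (∃ r, GrowsAt r (lam p) (lam (p + 1))) →
      (∃ r, GrowsAt r (lam q) (lam (q + 1))) → ℓ p < ℓ q) :
    ∃ (s : ℕ → TableauStep α) (T : ℕ → List (List α)), IsSchedule N s ∧ IsRun N s T ∧
      (∀ p, p ≤ N → rowLength (T p) = lam p) ∧
      ∀ p x, p < N → s p = .remove x → x = ℓ p := by
  -- The tableaux are built from left to right, starting with the empty one. All entries stay labels
  -- of growing steps further left, so the next label exceeds them.
  choose! nextT nextS hT hrl hrow hmem using exists_tableauStep hanti hstep hℓ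
  let T : ℕ → List (List α) := fun p => Nat.rec [] (fun p U => nextT p U) p
  let s : ℕ → TableauStep α := fun p => nextS p (T p)
  have good : ∀ p, p ≤ N → IsTableau (T p) ∧ rowLength (T p) = lam p ∧
      ∀ x ∈ readingWord (T p),
        ∃ q, q < p ∧ (∃ r, GrowsAt r (lam q) (lam (q + 1))) ∧ x = ℓ q := by
    intro p
    induction p with
    | zero =>
      intro _
      refine ⟨IsTableau.nil, ?_, by simp [T, readingWord]⟩
      rw [h0]
      funext i
      simp [rowLength, T]
    | succ p ih =>
      intro hp
      obtain ⟨h1, h2, h3⟩ := ih (by omega)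
      refine ⟨hT p hp (T p) h1 h2 h3, hrl p hp (T p) h1 h2 h3, fun x hx => ?_⟩
      rcases hmem p hp (T p) h1 h2 h3 with ⟨-, -, h⟩ | ⟨y, -, -, -, h⟩ | ⟨-, hup, h⟩
      · obtain ⟨q, hq, h'⟩ := h3 x ((h x).2 hx)
        exact ⟨q, by omega, h'⟩
      · obtain ⟨q, hq, h'⟩ := h3 x ((h x).2 (Or.inr hx))
        exact ⟨q, by omega, h'⟩
      · rcases (h x).1 hx with rfl | hx'
        · exact ⟨p, by omega, hup, rfl⟩
        · obtain ⟨q, hq, h'⟩ := h3 x hx'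
          exact ⟨q, by omega, h'⟩
  have hmem' : ∀ p, p < N → (s p = .idle ∧ (¬ ∃ r, GrowsAt r (lam p) (lam (p + 1))) ∧
          ∀ z, z ∈ readingWord (T p) ↔ z ∈ readingWord (T (p + 1))) ∨
        (∃ x, s p = .insert x ∧ (¬ ∃ r, GrowsAt r (lam p) (lam (p + 1))) ∧
          x ∉ readingWord (T (p + 1)) ∧
          ∀ z, z ∈ readingWord (T p) ↔ z = x ∨ z ∈ readingWord (T (p + 1))) ∨
        (s p = .remove (ℓ p) ∧ (∃ r, GrowsAt r (lam p) (lam (p + 1))) ∧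
          ∀ z, z ∈ readingWord (T (p + 1)) ↔ z = ℓ p ∨ z ∈ readingWord (T p)) := by
    intro p hp
    obtain ⟨h1, h2, h3⟩ := good p hp.le
    exact hmem p hp (T p) h1 h2 h3
  have hrun : ∀ p, p < N → tabRow (T p) = tabRow ((s p).apply (T (p + 1))) := by
    intro p hp
    obtain ⟨h1, h2, h3⟩ := good p hp.le
    exact hrow p hp (T p) h1 h2 h3
  clear_value s T
  have hrem : ∀ p x, p < N → s p = .remove x → x = ℓ p ∧
      (∃ r, GrowsAt r (lam p) (lam (p + 1))) ∧ x ∈ readingWord (T (p + 1)) := by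
    intro p x hp hx
    rcases hmem' p hp with ⟨h, -⟩ | ⟨y, h, -⟩ | ⟨h, hup, h'⟩
    · rw [hx] at h; cases h
    · rw [hx] at h; cases h
    · rw [hx] at h; cases h
      exact ⟨rfl, hup, (h' _).2 (Or.inl rfl)⟩
  have hins : ∀ p x, p < N → s p = .insert x →
      x ∈ readingWord (T p) ∧ x ∉ readingWord (T (p + 1)) := by
    intro p x hp hx
    rcases hmem' p hp with ⟨h, -⟩ | ⟨y, h, -, hy, h'⟩ | ⟨h, -⟩
    · rw [hx] at h; cases h
    · rw [hx] at h; cases h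
      exact ⟨(h' _).2 (Or.inl rfl), hy⟩
    · rw [hx] at h; cases h
  have hlast : tabRow (T N) = tabRow [] := by
    funext i
    have := congrFun (good N le_rfl).2.1 i
    rw [hN] at this
    simpa [rowLength] using this
  -- The last tableau is empty, so every letter disappears on the way to the right, and only an
  -- insertion step can make it disappear.
  have hclose : ∀ p x, p ≤ N → x ∈ readingWord (T p) → ∃ q, p ≤ q ∧ q < N ∧ s q = .insert x := by
    intro p x hp
    induction hp using Nat.decreasingInduction with
    | self =>
      intro hx
      rw [readingWord_congr hlast] at hx
      simp [readingWord] at hx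
    | of_succ p hp ih =>
      intro hx
      by_cases h : x ∈ readingWord (T (p + 1))
      · obtain ⟨q, hq, h'⟩ := ih h
        exact ⟨q, by omega, h'⟩
      · rcases hmem' p hp with ⟨-, -, h'⟩ | ⟨y, hy, -, -, h'⟩ | ⟨-, -, h'⟩
        · exact absurd ((h' x).1 hx) h
        · obtain rfl := ((h' x).1 hx).resolve_right h
          exact ⟨p, le_rfl, hp, hy⟩
        · exact absurd ((h' x).2 (Or.inr hx)) h
  -- Letters appear on the way to the right only at growing steps, whose labels strictly increase.
  -- Hence a letter that has disappeared never returns, which makes its insertion unique.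
  have hgone : ∀ p x, p < N → s p = .insert x → ∀ q, p < q → q ≤ N → x ∉ readingWord (T q) := by
    intro p x hp hx q hq
    obtain ⟨q₀, hq₀, hup₀, rfl⟩ := (good p hp.le).2.2 x (hins p x hp hx).1
    induction q, hq using Nat.le_induction with
    | base => exact fun _ => (hins p _ hp hx).2
    | succ q hpq ih =>
      intro hqN hmem
      have ih := ih (by omega)
      rcases hmem' q hqN with ⟨-, -, h'⟩ | ⟨y, -, -, -, h'⟩ | ⟨-, hup, h'⟩
      · exact ih ((h' _).2 hmem)
      · exact ih ((h' _).2 (Or.inr hmem))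
      · rcases (h' _).1 hmem with h | h
        · exact (hℓ q₀ q (by omega) hqN hup₀ hup).ne h
        · exact ih h
  refine ⟨s, T, ⟨?_, ?_, ?_, ?_⟩, ⟨hlast, hrun⟩, fun p hp => (good p hp).2.1,
    fun p x hp hx => (hrem p x hp hx).1⟩
  · intro p q x y hpq hq hx hy
    obtain ⟨rfl, hup, -⟩ := hrem p x (by omega) hx
    obtain ⟨rfl, hup', -⟩ := hrem q y hq hy
    exact hℓ p q hpq hq hup hup'
  · intro q x hq hx
    obtain ⟨p, hp, h⟩ := hclose (q + 1) x hq (hrem q x hq hx).2.2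
    exact ⟨p, hp, h⟩
  · intro p x hp hx
    obtain ⟨q, hq, hup, rfl⟩ := (good p hp.le).2.2 x (hins p x hp hx).1
    refine ⟨q, hq, ?_⟩
    rcases hmem' q (by omega) with ⟨-, h, -⟩ | ⟨y, -, h, -⟩ | ⟨h, -⟩
    · exact absurd hup h
    · exact absurd hup h
    · exact h
  · intro p q x hp hq hx hx'
    rcases lt_trichotomy p q with h | h | h
    · exact absurd (hins q x hq hx').1 (hgone p x hp hx q h hq.le)
    · exact h
    · exact absurd (hins p x hp hx).1 (hgone q x hq hx' p h hp.le)

end Schedule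

/-! ### Labels, and crossings of arcs over a common vertex -/

section Labels

variable {n : ℕ}

/-- The vertex of a label. -/
def vtx (x : Label n) : Fin n := (ofLex x).1

/-- Whether a label is primed. -/
def prm (x : Label n) : Bool := (ofLex x).2

@[simp] theorem vtx_label (i : Fin n) (b : Bool) : vtx (label i b) = i := rfl

@[simp] theorem prm_label (i : Fin n) (b : Bool) : prm (label i b) = b := rfl

@[simp] theorem label_vtx_prm (x : Label n) : label (vtx x) (prm x) = x := rfl

@[simp] theorem label_inj {i j : Fin n} {b c : Bool} : label i b = label j c ↔ i = j ∧ b = c := by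
  simp [label]

theorem label_lt {i j : Fin n} {b c : Bool} :
    label i b < label j c ↔ i < j ∨ i = j ∧ b = false ∧ c = true := by
  simp only [label, Prod.Lex.toLex_lt_toLex, Bool.lt_iff]

theorem label_ext {x y : Label n} (h : vtx x = vtx y) (h' : prm x = prm y) : x = y := by
  rw [← label_vtx_prm x, ← label_vtx_prm y, h, h']

theorem lt_of_vtx_lt {x y : Label n} (h : vtx x < vtx y) : x < y := by
  rw [← label_vtx_prm x, ← label_vtx_prm y, label_lt]
  exact Or.inl h

theorem vtx_le_of_lt {x y : Label n} (h : x < y) : vtx x ≤ vtx y := by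
  rw [← label_vtx_prm x, ← label_vtx_prm y, label_lt] at h
  rcases h with h | h
  · exact h.le
  · exact h.1.le

theorem prm_of_lt {x y : Label n} (h : x < y) (hv : vtx x = vtx y) :
    prm x = false ∧ prm y = true := by
  rw [← label_vtx_prm x, ← label_vtx_prm y, label_lt] at h
  exact (h.resolve_left hv.not_lt).2

/-- The arc between the vertices of two labels. -/
def arcVtx (e : Label n × Label n) : Fin n × Fin n := (vtx e.1, vtx e.2)

/-- The arc `a` has the endpoint `v`. -/
def IsEnd {β : Type*} (a : β × β) (v : β) : Prop := a.1 = v ∨ a.2 = v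

/-- Two arcs with distinct endpoints cross. -/
def CrossPair {β : Type*} [LT β] (e f : β × β) : Prop :=
  (e.1 < f.1 ∧ f.1 < e.2 ∧ e.2 < f.2) ∨ (f.1 < e.1 ∧ e.1 < f.2 ∧ f.2 < e.2)

/-- One of two arcs lies below the other. -/
def NestPair {β : Type*} [LT β] (e f : β × β) : Prop :=
  (e.1 < f.1 ∧ f.2 < e.2) ∨ (f.1 < e.1 ∧ e.2 < f.2)

theorem CrossPair.symm {β : Type*} [LT β] {e f : β × β} (h : CrossPair e f) : CrossPair f e :=
  Or.symm h

theorem crossPair_comm {β : Type*} [LT β] {e f : β × β} : CrossPair e f ↔ CrossPair f e :=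
  ⟨CrossPair.symm, CrossPair.symm⟩

theorem CrossPair.not_nestPair {β : Type*} [LinearOrder β] {e f : β × β} (h : CrossPair e f) :
    ¬ NestPair e f := by
  rintro (h' | h') <;> rcases h with h | h
  · exact lt_asymm h.2.2 h'.2
  · exact lt_asymm h.1 h'.1
  · exact lt_asymm h.1 h'.1
  · exact lt_asymm h.2.2 h'.2

theorem IsEnd.arcVtx {e : Label n × Label n} {x : Label n} (h : IsEnd e x) :
    IsEnd (arcVtx e) (vtx x) := by
  rcases h with rfl | rfl
  · exact Or.inl rfl
  · exact Or.inr rfl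

theorem exists_isEnd_of_arcVtx {e : Label n × Label n} {v : Fin n} (h : IsEnd (arcVtx e) v) :
    ∃ b, IsEnd e (label v b) := by
  rcases h with rfl | rfl
  · exact ⟨prm e.1, Or.inl rfl⟩
  · exact ⟨prm e.2, Or.inr rfl⟩

/-- The arc starting at the unprimed label starts first, so the arcs cross exactly if it also ends
first. -/
theorem crossPair_left {i j j' : Fin n} {b b' c c' : Bool} (h : i < j) (h' : i < j') (hj : j ≠ j')
    (hb : b ≠ b') :
    CrossPair (label i b, label j c) (label i b', label j' c') ↔ (b = true ↔ j' < j) := by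
  have hb' : b' = !b := by revert hb; cases b <;> cases b' <;> simp
  subst hb'
  rcases lt_or_gt_of_ne hj with hlt | hlt <;> cases b <;>
    simp [CrossPair, label_lt, h, h', hlt, hlt.not_gt, hj, hj.symm]

theorem crossPair_right {i i' j : Fin n} {b b' c c' : Bool} (h : i < j) (h' : i' < j) (hi : i ≠ i')
    (hc : c ≠ c') :
    CrossPair (label i b, label j c) (label i' b', label j c') ↔ (c = true ↔ i' < i) := by
  have hc' : c' = !c := by revert hc; cases c <;> cases c' <;> simp
  subst hc'
  rcases lt_or_gt_of_ne hi with hlt | hlt <;> cases c <;>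
    simp [CrossPair, label_lt, h, h', hlt, hlt.not_gt, hi, hi.symm]

/-- The arc that ends over `i` has to end behind the start of the other one, so the start must be
unprimed. -/
theorem crossPair_middle {i j k : Fin n} {b b' c c' : Bool} (h : i < j) (h' : k < i) (hb : b ≠ b') :
    CrossPair (label i b, label j c) (label k c', label i b') ↔ b = false := by
  have hb' : b' = !b := by revert hb; cases b <;> cases b' <;> simp
  subst hb'
  cases b <;> simp [CrossPair, label_lt, h, h', h'.trans h, h'.not_gt, h'.ne, h'.ne']

theorem crossPair_double {i j : Fin n} {b b' c c' : Bool} (h : i < j) (hb : b ≠ b') (hc : c ≠ c') :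
    CrossPair (label i b, label j c) (label i b', label j c') ↔ b = c := by
  have hb' : b' = !b := by revert hb; cases b <;> cases b' <;> simp
  have hc' : c' = !c := by revert hc; cases c <;> cases c' <;> simp
  subst hb' hc'
  cases b <;> cases c <;> simp [CrossPair, label_lt, h]

end Labels

/-! ### Arcs meeting at a vertex, and the inflation -/

namespace TangledDiagram

variable {n : ℕ} (G : TangledDiagram n)

/-- Impossible configurations at a vertex are excluded by exhibiting the arcs in question as a
submultiset whose degree there exceeds two. -/
theorem countP_add_le_of_le {s : Multiset (Fin n × Fin n)} (hs : s ≤ G.arcs) (v : Fin n) :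
    s.countP (fun a => a.1 = v) + s.countP (fun a => a.2 = v) ≤ 2 :=
  (Nat.add_le_add (Multiset.countP_le_of_le _ hs) (Multiset.countP_le_of_le _ hs)).trans
    (G.degree_le v)

variable {G}

theorem countP_singleton_eq {β : Type*} (p : β → Prop) [DecidablePred p] (b : β) :
    ({b} : Multiset β).countP p = if p b then 1 else 0 := by
  rw [← Multiset.cons_zero, Multiset.countP_cons, Multiset.countP_zero, zero_add]

theorem one_le_countP_add {a : Fin n × Fin n} {v : Fin n} (h : IsEnd a v) :
    1 ≤ (if a.1 = v then 1 else 0) + (if a.2 = v then 1 else 0 : ℕ) := by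
  rcases h with h | h <;> simp [h]

theorem not_loop_of_isEnd {a b : Fin n × Fin n} (ha : a ∈ G.arcs) (hb : b ∈ G.arcs) (hab : a ≠ b)
    {v : Fin n} (hbv : IsEnd b v) : ¬ (a.1 = v ∧ a.2 = v) := by
  rintro ⟨h1, h2⟩
  have hs : ({a, b} : Multiset (Fin n × Fin n)) ≤ G.arcs :=
    (Multiset.le_iff_subset (by simp [hab])).2 (by
      intro x hx
      simp only [Multiset.insert_eq_cons, Multiset.mem_cons, Multiset.mem_singleton] at hx
      rcases hx with rfl | rfl <;> assumption)
  have := G.countP_add_le_of_le hs v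
  have h3 := one_le_countP_add hbv
  simp only [Multiset.insert_eq_cons, Multiset.countP_cons, countP_singleton_eq, h1, h2,
    if_true] at this
  rcases hbv with h | h <;> simp only [h, if_true] at this h3 <;> omega

theorem count_eq_one_of_isEnd {a b : Fin n × Fin n} (ha : a ∈ G.arcs) (hb : b ∈ G.arcs)
    (hab : a ≠ b) {v : Fin n} (hav : IsEnd a v) (hbv : IsEnd b v) : G.arcs.count a = 1 := by
  have h1 : 1 ≤ G.arcs.count a := Multiset.one_le_count_iff_mem.2 ha
  by_contra hne
  have hs : (a ::ₘ a ::ₘ {b} : Multiset (Fin n × Fin n)) ≤ G.arcs := by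
    rw [Multiset.le_iff_count]
    intro x
    by_cases hxa : x = a
    · subst hxa
      simp [hab]; omega
    · by_cases hxb : x = b
      · subst hxb
        simp only [Multiset.count_cons, hxa, if_false, Multiset.count_singleton_self]
        exact Multiset.one_le_count_iff_mem.2 hb
      · simp [hxa, hxb]
  have := G.countP_add_le_of_le hs v
  have h3 := one_le_countP_add hbv
  have h4 := one_le_countP_add hav
  simp only [Multiset.countP_cons, countP_singleton_eq] at this
  omega

theorem eq_or_eq_of_isEnd {a b c : Fin n × Fin n} (ha : a ∈ G.arcs) (hb : b ∈ G.arcs)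
    (hc : c ∈ G.arcs) (hab : a ≠ b) {v : Fin n} (hav : IsEnd a v) (hbv : IsEnd b v)
    (hcv : IsEnd c v) : c = a ∨ c = b := by
  by_contra! hne
  have hs : (a ::ₘ b ::ₘ {c} : Multiset (Fin n × Fin n)) ≤ G.arcs :=
    (Multiset.le_iff_subset (by simp [hab, hne.1.symm, hne.2.symm])).2 (by
      intro x hx
      simp only [Multiset.mem_cons, Multiset.mem_singleton] at hx
      rcases hx with rfl | rfl | rfl <;> assumption)
  have := G.countP_add_le_of_le hs v
  have h3 := one_le_countP_add hbv
  have h4 := one_le_countP_add hav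
  have h5 := one_le_countP_add hcv
  simp only [Multiset.countP_cons, countP_singleton_eq] at this
  omega

theorem mem_of_two_le_count {a : Fin n × Fin n} (ha : 2 ≤ G.arcs.count a) : a ∈ G.arcs :=
  Multiset.one_le_count_iff_mem.1 (by omega)

theorem lt_of_two_le_count {a : Fin n × Fin n} (ha : 2 ≤ G.arcs.count a) : a.1 < a.2 := by
  refine lt_of_le_of_ne (G.arcs_le a (mem_of_two_le_count ha)) fun h => ?_
  have := G.countP_add_le_of_le (Multiset.le_count_iff_replicate_le.1 ha) a.1
  simp [Multiset.replicate_succ, ← h, countP_singleton_eq] at this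

theorem count_eq_two {a : Fin n × Fin n} (ha : 2 ≤ G.arcs.count a) : G.arcs.count a = 2 := by
  have := G.countP_add_le_of_le (Multiset.le_count_iff_replicate_le.1 (le_refl (G.arcs.count a))) a.1
  rw [Multiset.countP_eq_card.2 (by
    intro b hb
    rw [Multiset.eq_of_mem_replicate hb]), Multiset.card_replicate] at this
  omega

theorem lt_of_isEnd_left {a b : Fin n × Fin n} (ha : a ∈ G.arcs) (hb : b ∈ G.arcs) (hab : a ≠ b)
    (hbv : IsEnd b a.1) : a.1 < a.2 :=
  lt_of_le_of_ne (G.arcs_le a ha) fun h => not_loop_of_isEnd ha hb hab hbv ⟨rfl, h.symm⟩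

theorem lt_of_isEnd_right {a b : Fin n × Fin n} (ha : a ∈ G.arcs) (hb : b ∈ G.arcs) (hab : a ≠ b)
    (hbv : IsEnd b a.2) : a.1 < a.2 :=
  lt_of_le_of_ne (G.arcs_le a ha) fun h => not_loop_of_isEnd ha hb hab hbv ⟨h, rfl⟩

/-- At a vertex where the drawing involves a choice two arcs meet. -/
theorem exists_of_mem_crossAt {v : Fin n} (hv : v ∈ G.crossAt) :
    ∃ a ∈ G.arcs, IsEnd a v ∧ (2 ≤ G.arcs.count a ∨ ∃ b ∈ G.arcs, b ≠ a ∧ IsEnd b v) := by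
  obtain ⟨hd, hl⟩ := G.crossAt_degree v hv
  have key : ∀ s : Multiset (Fin n × Fin n),
      0 < s.countP (fun a => a.1 = v) + s.countP (fun a => a.2 = v) → ∃ a ∈ s, IsEnd a v := by
    intro s h
    rcases Nat.add_pos_iff_pos_or_pos.1 h with h | h
    · obtain ⟨a, ha, h'⟩ := Multiset.countP_pos.1 h
      exact ⟨a, ha, Or.inl h'⟩
    · obtain ⟨a, ha, h'⟩ := Multiset.countP_pos.1 h
      exact ⟨a, ha, Or.inr h'⟩
  obtain ⟨a, ha, hav⟩ := key G.arcs (by omega)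
  refine ⟨a, ha, hav, ?_⟩
  by_cases hc : 2 ≤ G.arcs.count a
  · exact Or.inl hc
  · right
    obtain ⟨s, hs⟩ := Multiset.exists_cons_of_mem ha
    have hnl : ¬ (a.1 = v ∧ a.2 = v) := fun h => hl (by
      rw [show (v, v) = a from Prod.ext h.1.symm h.2.symm]; exact ha)
    rw [hs, Multiset.countP_cons, Multiset.countP_cons] at hd
    obtain ⟨b, hb, hbv⟩ := key s (by
      by_cases h1 : a.1 = v <;> by_cases h2 : a.2 = v
      · exact absurd ⟨h1, h2⟩ hnl
      all_goals simp [h1, h2] at hd; omega)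
    refine ⟨b, by rw [hs]; exact Multiset.mem_cons_of_mem hb, ?_, hbv⟩
    rintro rfl
    rw [hs, Multiset.count_cons_self] at hc
    have := Multiset.one_le_count_iff_mem.2 hb
    omega

/-- At most two arcs meet at a vertex, so the existential quantifiers in the definition can only
refer to `b`. The same holds for the variants that follow. -/
theorem leftPrimed_of_left {a b : Fin n × Fin n} (ha : a ∈ G.arcs) (hb : b ∈ G.arcs) (hab : a ≠ b)
    (h : b.1 = a.1) : G.leftPrimed a = true ↔ (a.1 ∈ G.crossAt ↔ b.2 < a.2) := by
  have hu : ∀ c ∈ G.arcs, c ≠ a → IsEnd c a.1 → c = b := fun c hc hca hcv =>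
    (eq_or_eq_of_isEnd ha hb hc hab (Or.inl rfl) (Or.inl h) hcv).resolve_left hca
  rw [leftPrimed, decide_eq_true_eq]
  constructor
  · rintro (⟨c, hc, hca, h1, h2⟩ | ⟨c, hc, hca, h1, h2⟩)
    · obtain rfl := hu c hc hca (Or.inl h1)
      exact h2
    · obtain rfl := hu c hc hca (Or.inr h1)
      exact absurd ⟨h, h1⟩ (not_loop_of_isEnd hb ha hab.symm (Or.inl rfl))
  · exact fun h2 => Or.inl ⟨b, hb, hab.symm, h, h2⟩

theorem leftPrimed_of_right {a b : Fin n × Fin n} (ha : a ∈ G.arcs) (hb : b ∈ G.arcs) (hab : a ≠ b)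
    (h : b.2 = a.1) : G.leftPrimed a = true ↔ a.1 ∉ G.crossAt := by
  have hu : ∀ c ∈ G.arcs, c ≠ a → IsEnd c a.1 → c = b := fun c hc hca hcv =>
    (eq_or_eq_of_isEnd ha hb hc hab (Or.inl rfl) (Or.inr h) hcv).resolve_left hca
  rw [leftPrimed, decide_eq_true_eq]
  constructor
  · rintro (⟨c, hc, hca, h1, h2⟩ | ⟨c, hc, hca, h1, h2⟩)
    · obtain rfl := hu c hc hca (Or.inl h1)
      exact absurd ⟨h1, h⟩ (not_loop_of_isEnd hb ha hab.symm (Or.inl rfl))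
    · exact h2
  · exact fun h2 => Or.inr ⟨b, hb, hab.symm, h, h2⟩

theorem leftPrimed_of_alone {a : Fin n × Fin n} (h : ∀ c ∈ G.arcs, IsEnd c a.1 → c = a) :
    G.leftPrimed a = false := by
  rw [leftPrimed, decide_eq_false_iff_not]
  rintro (⟨c, hc, hca, h1, h2⟩ | ⟨c, hc, hca, h1, h2⟩)
  · exact hca (h c hc (Or.inl h1))
  · exact hca (h c hc (Or.inr h1))

theorem rightPrimed_of_right {a b : Fin n × Fin n} (ha : a ∈ G.arcs) (hb : b ∈ G.arcs) (hab : a ≠ b)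
    (h : b.2 = a.2) : G.rightPrimed a = true ↔ (a.2 ∈ G.crossAt ↔ b.1 < a.1) := by
  have hu : ∀ c ∈ G.arcs, c ≠ a → IsEnd c a.2 → c = b := fun c hc hca hcv =>
    (eq_or_eq_of_isEnd ha hb hc hab (Or.inr rfl) (Or.inr h) hcv).resolve_left hca
  rw [rightPrimed, decide_eq_true_eq]
  constructor
  · rintro (h0 | ⟨c, hc, hca, h1, h2⟩ | ⟨c, hc, hca, h1, h2⟩)
    · exact absurd h0 (lt_of_isEnd_right ha hb hab (Or.inr h)).ne
    · obtain rfl := hu c hc hca (Or.inr h1)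
      exact h2
    · obtain rfl := hu c hc hca (Or.inl h1)
      exact absurd ⟨h1, h⟩ (not_loop_of_isEnd hb ha hab.symm (Or.inr rfl))
  · exact fun h2 => Or.inr (Or.inl ⟨b, hb, hab.symm, h, h2⟩)

theorem rightPrimed_of_left {a b : Fin n × Fin n} (ha : a ∈ G.arcs) (hb : b ∈ G.arcs) (hab : a ≠ b)
    (h : b.1 = a.2) : G.rightPrimed a = true ↔ a.2 ∈ G.crossAt := by
  have hu : ∀ c ∈ G.arcs, c ≠ a → IsEnd c a.2 → c = b := fun c hc hca hcv =>
    (eq_or_eq_of_isEnd ha hb hc hab (Or.inr rfl) (Or.inl h) hcv).resolve_left hca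
  rw [rightPrimed, decide_eq_true_eq]
  constructor
  · rintro (h0 | ⟨c, hc, hca, h1, h2⟩ | ⟨c, hc, hca, h1, h2⟩)
    · exact absurd h0 (lt_of_isEnd_right ha hb hab (Or.inl h)).ne
    · obtain rfl := hu c hc hca (Or.inr h1)
      exact absurd ⟨h, h1⟩ (not_loop_of_isEnd hb ha hab.symm (Or.inr rfl))
    · exact h2
  · exact fun h2 => Or.inr (Or.inr ⟨b, hb, hab.symm, h, h2⟩)

theorem rightPrimed_of_alone {a : Fin n × Fin n} (h : ∀ c ∈ G.arcs, IsEnd c a.2 → c = a) :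
    G.rightPrimed a = true ↔ a.1 = a.2 := by
  rw [rightPrimed, decide_eq_true_eq]
  constructor
  · rintro (h0 | ⟨c, hc, hca, h1, h2⟩ | ⟨c, hc, hca, h1, h2⟩)
    · exact h0
    · exact absurd (h c hc (Or.inr h1)) hca
    · exact absurd (h c hc (Or.inl h1)) hca
  · exact Or.inl

/-- The two arcs replacing a double arc are, in both cases, all pairs of labels with equal primes if
it is crossing and with unequal primes if not. -/
theorem mem_inflation {e : Label n × Label n} : e ∈ G.inflation ↔ arcVtx e ∈ G.arcs ∧
    if 2 ≤ G.arcs.count (arcVtx e) then ((arcVtx e).1 ∈ G.crossAt ↔ prm e.1 = prm e.2)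
    else prm e.1 = G.leftPrimed (arcVtx e) ∧ prm e.2 = G.rightPrimed (arcVtx e) := by
  have he : ∀ (a : Fin n × Fin n) (b c : Bool), e = (label a.1 b, label a.2 c) ↔
      a = arcVtx e ∧ prm e.1 = b ∧ prm e.2 = c := by
    intro a b c
    constructor
    · rintro rfl
      exact ⟨rfl, rfl, rfl⟩
    · rintro ⟨rfl, rfl, rfl⟩
      rfl
  simp only [inflation, Finset.mem_biUnion, Multiset.mem_toFinset]
  constructor
  · rintro ⟨a, ha, h⟩
    split_ifs at h with h2 hc
    · simp only [Finset.mem_insert, Finset.mem_singleton, he] at h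
      obtain ⟨rfl, h'⟩ : a = arcVtx e ∧ prm e.1 = prm e.2 := by
        rcases h with ⟨h1, h2, h3⟩ | ⟨h1, h2, h3⟩ <;> simp [h1, h2, h3]
      simp [ha, h2, hc, h']
    · simp only [Finset.mem_insert, Finset.mem_singleton, he] at h
      obtain ⟨rfl, h'⟩ : a = arcVtx e ∧ prm e.1 ≠ prm e.2 := by
        rcases h with ⟨h1, h2, h3⟩ | ⟨h1, h2, h3⟩ <;> simp [h1, h2, h3]
      simp [ha, h2, hc, h']
    · simp only [Finset.mem_singleton, he] at h
      obtain ⟨rfl, h⟩ := h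
      simp [ha, h2, h]
  · rintro ⟨ha, h⟩
    refine ⟨arcVtx e, ha, ?_⟩
    split_ifs at h ⊢ with h2 hc
    · simp only [Finset.mem_insert, Finset.mem_singleton, he]
      have := h.1 hc
      cases h1 : prm e.1 <;> rw [h1] at this <;> simp [← this]
    · simp only [Finset.mem_insert, Finset.mem_singleton, he]
      have : prm e.1 ≠ prm e.2 := fun h' => hc (h.2 h')
      cases h1 : prm e.1 <;> cases h3 : prm e.2 <;> simp [h1, h3] at this ⊢
    · simpa only [Finset.mem_singleton, he, true_and] using h

/-- A double arc exhausts the degree of its vertices, so distinct arcs that meet are both simple. -/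
theorem prm_of_meet {e f : Label n × Label n} (he : e ∈ G.inflation) (hf : f ∈ G.inflation)
    (hne : arcVtx e ≠ arcVtx f) {v : Fin n} (hev : IsEnd (arcVtx e) v) (hfv : IsEnd (arcVtx f) v) :
    (prm e.1 = G.leftPrimed (arcVtx e) ∧ prm e.2 = G.rightPrimed (arcVtx e)) ∧
      prm f.1 = G.leftPrimed (arcVtx f) ∧ prm f.2 = G.rightPrimed (arcVtx f) := by
  rw [mem_inflation] at he hf
  obtain ⟨ha, he⟩ := he
  obtain ⟨hb, hf⟩ := hf
  rw [if_neg (by rw [count_eq_one_of_isEnd ha hb hne hev hfv]; omega)] at he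
  rw [if_neg (by rw [count_eq_one_of_isEnd hb ha hne.symm hfv hev]; omega)] at hf
  exact ⟨he, hf⟩

theorem exists_label (x : Label n) : ∃ i b, x = label i b := ⟨vtx x, prm x, rfl⟩

theorem crossPair_of_meet_left {e f : Label n × Label n} (he : e ∈ G.inflation)
    (hf : f ∈ G.inflation) (hne : arcVtx e ≠ arcVtx f) {v : Fin n} (hev : (arcVtx e).1 = v)
    (hfv : (arcVtx f).1 = v) :
    (∀ b, ¬ (IsEnd e (label v b) ∧ IsEnd f (label v b))) ∧ (v ∈ G.crossAt ↔ CrossPair e f) := by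
  obtain ⟨⟨hb, -⟩, hb', -⟩ := prm_of_meet he hf hne (Or.inl hev) (Or.inl hfv)
  have ha := (mem_inflation.1 he).1
  have ha' := (mem_inflation.1 hf).1
  have hlt := lt_of_isEnd_left ha ha' hne (Or.inl (hfv.trans hev.symm))
  have hlt' := lt_of_isEnd_left ha' ha hne.symm (Or.inl (hev.trans hfv.symm))
  have hl := leftPrimed_of_left ha ha' hne (hfv.trans hev.symm)
  have hl' := leftPrimed_of_left ha' ha hne.symm (hev.trans hfv.symm)
  obtain ⟨x, y⟩ := e
  obtain ⟨x', y'⟩ := f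
  obtain ⟨i, b, rfl⟩ := exists_label x
  obtain ⟨j, c, rfl⟩ := exists_label y
  obtain ⟨i', b', rfl⟩ := exists_label x'
  obtain ⟨j', c', rfl⟩ := exists_label y'
  simp only [arcVtx, vtx_label, prm_label] at *
  subst hev hfv
  rw [← hb] at hl
  rw [← hb'] at hl'
  have hj : j ≠ j' := fun h => hne (by rw [h])
  -- The two priming conditions compare the other endpoints in opposite directions, so exactly one
  -- of them holds.
  have hbb : b ≠ b' := by
    rintro rfl
    rw [hl] at hl'
    rcases lt_or_gt_of_ne hj with h | h <;> by_cases hc : i' ∈ G.crossAt <;>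
      simp [h, h.not_gt, hc] at hl'
  rw [crossPair_left hlt hlt' hj hbb]
  refine ⟨?_, by tauto⟩
  rintro d ⟨h | h, h' | h'⟩ <;> simp only [label_inj, true_and] at h h'
  · exact hbb (h.trans h'.symm)
  · exact hlt'.ne' h'.1
  · exact hlt.ne' h.1
  · exact hlt.ne' h.1

theorem crossPair_of_meet_right {e f : Label n × Label n} (he : e ∈ G.inflation)
    (hf : f ∈ G.inflation) (hne : arcVtx e ≠ arcVtx f) {v : Fin n} (hev : (arcVtx e).2 = v)
    (hfv : (arcVtx f).2 = v) :
    (∀ b, ¬ (IsEnd e (label v b) ∧ IsEnd f (label v b))) ∧ (v ∈ G.crossAt ↔ CrossPair e f) := by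
  obtain ⟨⟨-, hb⟩, -, hb'⟩ := prm_of_meet he hf hne (Or.inr hev) (Or.inr hfv)
  have ha := (mem_inflation.1 he).1
  have ha' := (mem_inflation.1 hf).1
  have hlt := lt_of_isEnd_right ha ha' hne (Or.inr (hfv.trans hev.symm))
  have hlt' := lt_of_isEnd_right ha' ha hne.symm (Or.inr (hev.trans hfv.symm))
  have hl := rightPrimed_of_right ha ha' hne (hfv.trans hev.symm)
  have hl' := rightPrimed_of_right ha' ha hne.symm (hev.trans hfv.symm)
  obtain ⟨x, y⟩ := e
  obtain ⟨x', y'⟩ := f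
  obtain ⟨i, b, rfl⟩ := exists_label x
  obtain ⟨j, c, rfl⟩ := exists_label y
  obtain ⟨i', b', rfl⟩ := exists_label x'
  obtain ⟨j', c', rfl⟩ := exists_label y'
  simp only [arcVtx, vtx_label, prm_label] at *
  subst hev hfv
  rw [← hb] at hl
  rw [← hb'] at hl'
  have hj : i ≠ i' := fun h => hne (by rw [h])
  have hbb : c ≠ c' := by
    rintro rfl
    rw [hl] at hl'
    rcases lt_or_gt_of_ne hj with h | h <;> by_cases hc : j' ∈ G.crossAt <;>
      simp [h, h.not_gt, hc] at hl'
  rw [crossPair_right hlt hlt' hj hbb]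
  refine ⟨?_, by tauto⟩
  rintro d ⟨h | h, h' | h'⟩ <;> simp only [label_inj, true_and] at h h'
  · exact hlt.ne h.1
  · exact hlt.ne h.1
  · exact hlt'.ne h'.1
  · exact hbb (h.trans h'.symm)

theorem crossPair_of_meet_middle {e f : Label n × Label n} (he : e ∈ G.inflation)
    (hf : f ∈ G.inflation) (hne : arcVtx e ≠ arcVtx f) {v : Fin n} (hev : (arcVtx e).1 = v)
    (hfv : (arcVtx f).2 = v) :
    (∀ b, ¬ (IsEnd e (label v b) ∧ IsEnd f (label v b))) ∧ (v ∈ G.crossAt ↔ CrossPair e f) := by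
  obtain ⟨⟨hb, -⟩, -, hb'⟩ := prm_of_meet he hf hne (Or.inl hev) (Or.inr hfv)
  have ha := (mem_inflation.1 he).1
  have ha' := (mem_inflation.1 hf).1
  have hlt := lt_of_isEnd_left ha ha' hne (Or.inr (hfv.trans hev.symm))
  have hlt' := lt_of_isEnd_right ha' ha hne.symm (Or.inl (hev.trans hfv.symm))
  have hl := leftPrimed_of_right ha ha' hne (hfv.trans hev.symm)
  have hl' := rightPrimed_of_left ha' ha hne.symm (hev.trans hfv.symm)
  obtain ⟨x, y⟩ := e
  obtain ⟨x', y'⟩ := f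
  obtain ⟨i, b, rfl⟩ := exists_label x
  obtain ⟨j, c, rfl⟩ := exists_label y
  obtain ⟨i', b', rfl⟩ := exists_label x'
  obtain ⟨j', c', rfl⟩ := exists_label y'
  simp only [arcVtx, vtx_label, prm_label] at *
  subst hev hfv
  rw [← hb] at hl
  rw [← hb'] at hl'
  have hbb : b ≠ c' := by
    rintro rfl
    rw [hl] at hl'
    tauto
  rw [crossPair_middle hlt hlt' hbb, ← Bool.not_eq_true, hl, not_not]
  refine ⟨?_, Iff.rfl⟩
  rintro d ⟨h | h, h' | h'⟩ <;> simp only [label_inj, true_and] at h h'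
  · exact hlt'.ne h'.1
  · exact hbb (h.trans h'.symm)
  · exact hlt.ne' h.1
  · exact hlt.ne' h.1

/-- Two different arcs that meet at `v` get different labels there, and cross in the inflation
exactly if they are drawn crossing. -/
theorem crossPair_of_meet {e f : Label n × Label n} (he : e ∈ G.inflation) (hf : f ∈ G.inflation)
    (hne : arcVtx e ≠ arcVtx f) {v : Fin n} (hev : IsEnd (arcVtx e) v) (hfv : IsEnd (arcVtx f) v) :
    (∀ b, ¬ (IsEnd e (label v b) ∧ IsEnd f (label v b))) ∧ (v ∈ G.crossAt ↔ CrossPair e f) := by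
  rcases hev with hev | hev <;> rcases hfv with hfv | hfv
  · exact crossPair_of_meet_left he hf hne hev hfv
  · exact crossPair_of_meet_middle he hf hne hev hfv
  · obtain ⟨h1, h2⟩ := crossPair_of_meet_middle hf he hne.symm hfv hev
    exact ⟨fun b h => h1 b h.symm, h2.trans crossPair_comm⟩
  · exact crossPair_of_meet_right he hf hne hev hfv

end TangledDiagram

/-! ### Splittings of diagrams into matchings, and their uniqueness -/

/-- A partial matching on the labels that uses `i'` only together with `i`. -/
structure IsLabelMatching {n : ℕ} (M : Finset (Label n × Label n)) : Prop where
  lt : ∀ e ∈ M, e.1 < e.2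
  eq_of_isEnd : ∀ e ∈ M, ∀ f ∈ M, ∀ x, IsEnd e x → IsEnd f x → e = f
  used : ∀ v, (∃ e ∈ M, IsEnd e (label v true)) → ∃ e ∈ M, IsEnd e (label v false)

/-- The matching `M` arises from the tangled-diagram `G` by splitting vertices, such that the
crossings at the vertices become crossings of arcs. -/
structure IsSplitting {n : ℕ} (G : TangledDiagram n) (M : Finset (Label n × Label n)) : Prop where
  matching : IsLabelMatching M
  arcs : M.val.map arcVtx = G.arcs
  cross : ∀ e ∈ M, ∀ f ∈ M, e ≠ f → ∀ v, IsEnd (arcVtx e) v → IsEnd (arcVtx f) v →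
    (v ∈ G.crossAt ↔ CrossPair e f)

namespace TangledDiagram

variable {n : ℕ} {G : TangledDiagram n}

theorem mem_inflation_label {i j : Fin n} {b c : Bool} : (label i b, label j c) ∈ G.inflation ↔
    (i, j) ∈ G.arcs ∧ if 2 ≤ G.arcs.count (i, j) then (i ∈ G.crossAt ↔ b = c)
      else b = G.leftPrimed (i, j) ∧ c = G.rightPrimed (i, j) :=
  mem_inflation

theorem map_inflation : G.inflation.val.map arcVtx = G.arcs := by
  ext a
  obtain ⟨i, j⟩ := a
  rw [Multiset.count_map, ← Finset.filter_val, Finset.card_val]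
  by_cases ha : (i, j) ∈ G.arcs
  · by_cases h2 : 2 ≤ G.arcs.count (i, j)
    · rw [count_eq_two h2]
      by_cases hc : i ∈ G.crossAt
      · rw [Finset.card_eq_two]
        refine ⟨(label i false, label j false), (label i true, label j true), by simp, ?_⟩
        ext ⟨x, y⟩
        obtain ⟨i', b, rfl⟩ := exists_label x
        obtain ⟨j', c, rfl⟩ := exists_label y
        simp only [Finset.mem_filter, arcVtx, vtx_label, Prod.mk.injEq, Finset.mem_insert,
          Finset.mem_singleton, label_inj]
        constructor
        · rintro ⟨h, rfl, rfl⟩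
          rw [mem_inflation_label, if_pos h2] at h
          cases b <;> cases c <;> simp [hc] at h <;> simp
        · rintro (⟨⟨rfl, rfl⟩, rfl, rfl⟩ | ⟨⟨rfl, rfl⟩, rfl, rfl⟩) <;>
          simp [mem_inflation_label, h2, hc, ha]
      · rw [Finset.card_eq_two]
        refine ⟨(label i false, label j true), (label i true, label j false), by simp, ?_⟩
        ext ⟨x, y⟩
        obtain ⟨i', b, rfl⟩ := exists_label x
        obtain ⟨j', c, rfl⟩ := exists_label y
        simp only [Finset.mem_filter, arcVtx, vtx_label, Prod.mk.injEq, Finset.mem_insert,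
          Finset.mem_singleton, label_inj]
        constructor
        · rintro ⟨h, rfl, rfl⟩
          rw [mem_inflation_label, if_pos h2] at h
          cases b <;> cases c <;> simp [hc] at h <;> simp
        · rintro (⟨⟨rfl, rfl⟩, rfl, rfl⟩ | ⟨⟨rfl, rfl⟩, rfl, rfl⟩) <;>
          simp [mem_inflation_label, h2, hc, ha]
    · have h1 := Multiset.one_le_count_iff_mem.2 ha
      rw [show G.arcs.count (i, j) = 1 by omega, Finset.card_eq_one]
      refine ⟨(label i (G.leftPrimed (i, j)), label j (G.rightPrimed (i, j))), ?_⟩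
      ext ⟨x, y⟩
      obtain ⟨i', b, rfl⟩ := exists_label x
      obtain ⟨j', c, rfl⟩ := exists_label y
      simp only [Finset.mem_filter, arcVtx, vtx_label, Prod.mk.injEq, Finset.mem_singleton,
        label_inj]
      constructor
      · rintro ⟨h, rfl, rfl⟩
        rw [mem_inflation_label, if_neg h2] at h
        exact ⟨⟨rfl, h.2.1⟩, rfl, h.2.2⟩
      · rintro ⟨⟨rfl, rfl⟩, rfl, rfl⟩
        simp [mem_inflation_label, h2, ha]
  · rw [Multiset.count_eq_zero_of_notMem ha, Finset.card_eq_zero, Finset.filter_eq_empty_iff]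
    intro e he h
    rw [h] at ha
    exact ha (mem_inflation.1 he).1

theorem exists_mem_inflation {a : Fin n × Fin n} (ha : a ∈ G.arcs) :
    ∃ e ∈ G.inflation, arcVtx e = a := by
  rw [← map_inflation, Multiset.mem_map] at ha
  exact ha

theorem arcVtx_mem {e : Label n × Label n} (he : e ∈ G.inflation) : arcVtx e ∈ G.arcs :=
  (mem_inflation.1 he).1

theorem isLabelMatching_inflation : IsLabelMatching G.inflation where
  lt e he := by
    have ha := arcVtx_mem he
    rcases (G.arcs_le _ ha).lt_or_eq with h | h
    · exact lt_of_vtx_lt h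
    -- A loop is a simple arc and alone at its vertex, so it becomes `(i, i')`.
    · have h2 : ¬ 2 ≤ G.arcs.count (arcVtx e) := fun h2 => (lt_of_two_le_count h2).ne h
      have halone : ∀ c ∈ G.arcs, IsEnd c (arcVtx e).1 → c = arcVtx e := by
        intro c hc hcv
        by_contra hne
        exact not_loop_of_isEnd ha hc (Ne.symm hne) hcv ⟨rfl, h.symm⟩
      have h3 := (mem_inflation.1 he).2
      rw [if_neg h2, leftPrimed_of_alone halone,
        (rightPrimed_of_alone (by rwa [h] at halone)).2 h] at h3
      rw [← label_vtx_prm e.1, ← label_vtx_prm e.2, label_lt]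
      exact Or.inr ⟨h, h3⟩
  eq_of_isEnd e he f hf x hex hfx := by
    by_cases hne : arcVtx e = arcVtx f
    · have he' := (mem_inflation.1 he).2
      have hf' := (mem_inflation.1 hf).2
      have h1 : vtx e.1 = vtx f.1 := (congrArg Prod.fst hne : (arcVtx e).1 = (arcVtx f).1)
      have h2 : vtx e.2 = vtx f.2 := (congrArg Prod.snd hne : (arcVtx e).2 = (arcVtx f).2)
      rw [← hne] at hf'
      split_ifs at he' hf' with hc
      · have hlt : vtx e.1 < vtx e.2 := lt_of_two_le_count hc
        rw [he'] at hf'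
        have hp : prm e.1 = prm f.1 ∧ prm e.2 = prm f.2 := by
          rcases hex with rfl | rfl <;> rcases hfx with h | h
          · rw [h] at hf' ⊢
            revert hf'
            cases prm e.1 <;> cases prm e.2 <;> cases prm f.2 <;> simp
          · exact absurd (h2.trans (congrArg vtx h)) hlt.ne'
          · exact absurd (h1.trans (congrArg vtx h)) hlt.ne
          · rw [h] at hf' ⊢
            revert hf'
            cases prm e.1 <;> cases prm e.2 <;> cases prm f.1 <;> simp
        exact Prod.ext (label_ext h1 hp.1) (label_ext h2 hp.2)
      · exact Prod.ext (label_ext h1 (he'.1.trans hf'.1.symm))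
          (label_ext h2 (he'.2.trans hf'.2.symm))
    · exact absurd ⟨hex, hfx⟩ ((crossPair_of_meet he hf hne hex.arcVtx hfx.arcVtx).1 (prm x))
  used v := by
    rintro ⟨e, he, hev⟩
    have ha := arcVtx_mem he
    have hav : IsEnd (arcVtx e) v := hev.arcVtx
    by_cases hex : ∃ b ∈ G.arcs, b ≠ arcVtx e ∧ IsEnd b v
    · obtain ⟨b, hb, hne, hbv⟩ := hex
      obtain ⟨f, hf, rfl⟩ := exists_mem_inflation hb
      obtain ⟨d, hd⟩ := exists_isEnd_of_arcVtx hbv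
      cases d with
      | false => exact ⟨f, hf, hd⟩
      | true => exact absurd ⟨hev, hd⟩ ((crossPair_of_meet he hf hne.symm hav hbv).1 true)
    -- Without another arc at `v`, the label `v'` can only stem from a double arc, whose companion
    -- has both primes flipped, or from a loop, which uses the unprimed label as well.
    · push Not at hex
      have halone : ∀ c ∈ G.arcs, IsEnd c v → c = arcVtx e := fun c hc hcv => by
        by_contra hne
        exact hex c hc hne hcv
      have he' := (mem_inflation.1 he).2
      split_ifs at he' with h2
      · refine ⟨(label (vtx e.1) (!prm e.1), label (vtx e.2) (!prm e.2)), ?_, ?_⟩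
        · rw [mem_inflation_label]
          refine ⟨ha, ?_⟩
          rw [if_pos (show 2 ≤ G.arcs.count (vtx e.1, vtx e.2) from h2)]
          refine Iff.trans he' ?_
          cases prm e.1 <;> cases prm e.2 <;> simp
        · rcases hev with h | h
          · left; simp [h]
          · right; simp [h]
      · rcases hev with h | h
        · have hv : (arcVtx e).1 = v := by simp [arcVtx, h]
          rw [leftPrimed_of_alone (by rwa [hv])] at he'
          rw [h] at he'
          simp at he'
        · have hv : (arcVtx e).2 = v := by simp [arcVtx, h]
          have h3 : prm e.2 = true := by rw [h]; rfl
          have hloop := (rightPrimed_of_alone (by rwa [hv])).1 (he'.2.symm.trans h3)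
          refine ⟨e, he, Or.inl (label_ext (hloop.trans hv) ?_)⟩
          rw [he'.1, leftPrimed_of_alone (by rwa [hloop, hv])]
          rfl

theorem isSplitting_inflation : IsSplitting G G.inflation where
  matching := isLabelMatching_inflation
  arcs := map_inflation
  cross e he f hf hne v hev hfv := by
    by_cases h : arcVtx e = arcVtx f
    · have he' := (mem_inflation.1 he).2
      have hf' := (mem_inflation.1 hf).2
      have h1 : vtx e.1 = vtx f.1 := (congrArg Prod.fst h : (arcVtx e).1 = (arcVtx f).1)
      have h2 : vtx e.2 = vtx f.2 := (congrArg Prod.snd h : (arcVtx e).2 = (arcVtx f).2)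
      rw [← h] at hf'
      split_ifs at he' hf' with hc
      · have hlt : vtx e.1 < vtx e.2 := lt_of_two_le_count hc
        have hp1 : prm e.1 ≠ prm f.1 := fun h' =>
          hne (isLabelMatching_inflation.eq_of_isEnd e he f hf e.1 (Or.inl rfl)
            (Or.inl (label_ext h1 h').symm))
        have hp2 : prm e.2 ≠ prm f.2 := fun h' =>
          hne (isLabelMatching_inflation.eq_of_isEnd e he f hf e.2 (Or.inr rfl)
            (Or.inr (label_ext h2 h').symm))
        have hcp := crossPair_double hlt hp1 hp2
        rw [label_vtx_prm, label_vtx_prm, h1, h2, label_vtx_prm, label_vtx_prm] at hcp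
        rw [show CrossPair e f ↔ _ from hcp, ← he']
        rcases hev with rfl | rfl
        · rfl
        · exact (G.crossAt_double _ hc).symm
      · exact absurd (Prod.ext (label_ext h1 (he'.1.trans hf'.1.symm))
          (label_ext h2 (he'.2.trans hf'.2.symm))) hne
    · exact (crossPair_of_meet he hf h hev hfv).2

end TangledDiagram

section Matching

variable {n : ℕ} {M : Finset (Label n × Label n)}

/-- The labels of the vertex `v` that are used by `M`. -/
def usedAt (M : Finset (Label n × Label n)) (v : Fin n) : Finset (Label n) :=
  (M.image Prod.fst ∪ M.image Prod.snd).filter (fun x => vtx x = v)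

theorem mem_usedAt {v : Fin n} {x : Label n} :
    x ∈ usedAt M v ↔ (∃ e ∈ M, IsEnd e x) ∧ vtx x = v := by
  simp only [usedAt, Finset.mem_filter, Finset.mem_union, Finset.mem_image, IsEnd]
  refine and_congr_left fun _ => ?_
  constructor
  · rintro (⟨e, he, rfl⟩ | ⟨e, he, rfl⟩)
    · exact ⟨e, he, Or.inl rfl⟩
    · exact ⟨e, he, Or.inr rfl⟩
  · rintro ⟨e, he, h | h⟩
    · exact Or.inl ⟨e, he, h⟩
    · exact Or.inr ⟨e, he, h⟩

theorem usedAt_subset (v : Fin n) : usedAt M v ⊆ {label v false, label v true} := by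
  intro x hx
  obtain ⟨i, b, rfl⟩ := TangledDiagram.exists_label x
  obtain rfl : i = v := (mem_usedAt.1 hx).2
  cases b <;> simp

theorem card_usedAt_le (v : Fin n) : (usedAt M v).card ≤ 2 :=
  (Finset.card_le_card (usedAt_subset v)).trans Finset.card_le_two

namespace IsLabelMatching

/-- Distinct arcs have distinct endpoints, and no label is both a lefthand and a righthand endpoint.
Hence the degree of a vertex counts the labels used over it. -/
theorem countP_add (hM : IsLabelMatching M) (v : Fin n) :
    (M.val.map arcVtx).countP (fun a => a.1 = v) + (M.val.map arcVtx).countP (fun a => a.2 = v) =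
      (usedAt M v).card := by
  rw [usedAt, Finset.filter_union, Finset.filter_image, Finset.filter_image,
    Finset.card_union_of_disjoint, Finset.card_image_of_injOn, Finset.card_image_of_injOn,
    Multiset.countP_map, Multiset.countP_map]
  · rfl
  · intro e he f hf h
    exact hM.eq_of_isEnd e (Finset.mem_filter.1 he).1 f (Finset.mem_filter.1 hf).1 e.2 (Or.inr rfl)
      (Or.inr h.symm)
  · intro e he f hf h
    exact hM.eq_of_isEnd e (Finset.mem_filter.1 he).1 f (Finset.mem_filter.1 hf).1 e.1 (Or.inl rfl)
      (Or.inl h.symm)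
  · rw [Finset.disjoint_left]
    intro x hx hx'
    obtain ⟨e, he, rfl⟩ := Finset.mem_image.1 hx
    obtain ⟨f, hf, h⟩ := Finset.mem_image.1 hx'
    have he := (Finset.mem_filter.1 he).1
    have hf := (Finset.mem_filter.1 hf).1
    obtain rfl := hM.eq_of_isEnd e he f hf e.1 (Or.inl rfl) (Or.inr h)
    exact (hM.lt e he).ne h.symm

theorem card_usedAt_eq_two_iff (hM : IsLabelMatching M) (v : Fin n) :
    (usedAt M v).card = 2 ↔ ∃ e ∈ M, IsEnd e (label v true) := by
  constructor
  · intro h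
    have := Finset.eq_of_subset_of_card_le (usedAt_subset v)
      (Finset.card_le_two.trans h.ge)
    have h' : label v true ∈ usedAt M v := by rw [this]; simp
    exact (mem_usedAt.1 h').1
  · intro h
    refine le_antisymm (card_usedAt_le v) ?_
    have hs : ({label v false, label v true} : Finset (Label n)) ⊆ usedAt M v := by
      intro x hx
      simp only [Finset.mem_insert, Finset.mem_singleton] at hx
      rcases hx with rfl | rfl
      · exact mem_usedAt.2 ⟨hM.used v h, rfl⟩
      · exact mem_usedAt.2 ⟨h, rfl⟩
    have := Finset.card_le_card hs
    rwa [Finset.card_pair (by simp)] at this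

theorem isEnd_ne (hM : IsLabelMatching M) {e f : Label n × Label n} (he : e ∈ M) (hf : f ∈ M)
    (hne : e ≠ f) {v : Fin n} {b c : Bool} (heb : IsEnd e (label v b)) (hfc : IsEnd f (label v c)) :
    b ≠ c := by
  rintro rfl
  exact hne (hM.eq_of_isEnd e he f hf _ heb hfc)

/-- At most two arcs meet in a vertex. -/
theorem eq_or_eq (hM : IsLabelMatching M) {e f g : Label n × Label n} (he : e ∈ M) (hf : f ∈ M)
    (hg : g ∈ M) (hne : e ≠ f) {v : Fin n} (hev : IsEnd (arcVtx e) v) (hfv : IsEnd (arcVtx f) v)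
    (hgv : IsEnd (arcVtx g) v) : g = e ∨ g = f := by
  by_contra! h
  obtain ⟨b, hb⟩ := exists_isEnd_of_arcVtx hev
  obtain ⟨c, hc⟩ := exists_isEnd_of_arcVtx hfv
  obtain ⟨d, hd⟩ := exists_isEnd_of_arcVtx hgv
  have h1 := hM.isEnd_ne he hf hne hb hc
  have h2 := hM.isEnd_ne hg he h.1 hd hb
  have h3 := hM.isEnd_ne hg hf h.2 hd hc
  revert h1 h2 h3
  cases b <;> cases c <;> cases d <;> simp

/-- A loop meets no other arc. -/
theorem not_loop (hM : IsLabelMatching M) {e f : Label n × Label n} (he : e ∈ M) (hf : f ∈ M)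
    (hne : e ≠ f) {v : Fin n} (hfv : IsEnd (arcVtx f) v) : ¬ arcVtx e = (v, v) := by
  intro h
  simp only [arcVtx, Prod.mk.injEq] at h
  obtain ⟨c, hc⟩ := exists_isEnd_of_arcVtx hfv
  have hp := prm_of_lt (hM.lt e he) (h.1.trans h.2.symm)
  have h1 : IsEnd e (label v false) := Or.inl (label_ext h.1 hp.1)
  have h2 : IsEnd e (label v true) := Or.inr (label_ext h.2 hp.2)
  cases c with
  | false => exact hM.isEnd_ne he hf hne h1 hc rfl
  | true => exact hM.isEnd_ne he hf hne h2 hc rfl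

theorem exists_pair_of_count {a : Fin n × Fin n} (ha : 2 ≤ (M.val.map arcVtx).count a) :
    ∃ e ∈ M, ∃ f ∈ M, e ≠ f ∧ arcVtx e = a ∧ arcVtx f = a := by
  rw [Multiset.count_map, ← Finset.filter_val, Finset.card_val] at ha
  obtain ⟨e, he, f, hf, hne⟩ := Finset.one_lt_card.1 ha
  rw [Finset.mem_filter] at he hf
  exact ⟨e, he.1, f, hf.1, hne, he.2.symm, hf.2.symm⟩

theorem two_le_count {a : Fin n × Fin n} {e f : Label n × Label n} (he : e ∈ M) (hf : f ∈ M)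
    (hne : e ≠ f) (hea : arcVtx e = a) (hfa : arcVtx f = a) :
    2 ≤ (M.val.map arcVtx).count a := by
  rw [Multiset.count_map, ← Finset.filter_val, Finset.card_val]
  exact Finset.one_lt_card.2 ⟨e, Finset.mem_filter.2 ⟨he, hea.symm⟩, f,
    Finset.mem_filter.2 ⟨hf, hfa.symm⟩, hne⟩

open Classical in
/-- The tangled-diagram whose inflation is a given matching. -/
noncomputable def deflation (hM : IsLabelMatching M) : TangledDiagram n where
  arcs := M.val.map arcVtx
  arcs_le a ha := by
    obtain ⟨e, he, rfl⟩ := Multiset.mem_map.1 ha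
    exact vtx_le_of_lt (hM.lt e he)
  degree_le v := (hM.countP_add v).trans_le (card_usedAt_le v)
  crossAt := Finset.univ.filter fun v => ∃ e ∈ M, ∃ f ∈ M, e ≠ f ∧ IsEnd (arcVtx e) v ∧
    IsEnd (arcVtx f) v ∧ CrossPair e f
  crossAt_degree v hv := by
    obtain ⟨e, he, f, hf, hne, hev, hfv, -⟩ := (Finset.mem_filter.1 hv).2
    constructor
    · rw [hM.countP_add, hM.card_usedAt_eq_two_iff]
      obtain ⟨b, hb⟩ := exists_isEnd_of_arcVtx hev
      obtain ⟨c, hc⟩ := exists_isEnd_of_arcVtx hfv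
      have h1 := hM.isEnd_ne he hf hne hb hc
      cases b with
      | true => exact ⟨e, he, hb⟩
      | false =>
        cases c with
        | true => exact ⟨f, hf, hc⟩
        | false => exact absurd rfl h1
    · intro hl
      obtain ⟨g, hg, hgv⟩ := Multiset.mem_map.1 hl
      by_cases h : g = e
      · exact hM.not_loop hg hf (h ▸ hne) hfv hgv
      · exact hM.not_loop hg he h hev hgv
  crossAt_double a ha := by
    obtain ⟨e, he, f, hf, hne, rfl, hfa⟩ := exists_pair_of_count ha
    -- The parallel arcs `e` and `f` are the only ones at either of their vertices, so both vertices
    -- ask the same question.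
    have key : ∀ v, IsEnd (arcVtx e) v → ((∃ e ∈ M, ∃ f ∈ M, e ≠ f ∧ IsEnd (arcVtx e) v ∧
        IsEnd (arcVtx f) v ∧ CrossPair e f) ↔ CrossPair e f) := by
      intro v hv
      have hfv : IsEnd (arcVtx f) v := by rwa [hfa]
      constructor
      · rintro ⟨e', he', f', hf', hne', hev', hfv', hc⟩
        rcases hM.eq_or_eq he hf he' hne hv hfv hev' with rfl | rfl <;>
          rcases hM.eq_or_eq he hf hf' hne hv hfv hfv' with rfl | rfl
        · exact absurd rfl hne'
        · exact hc
        · exact hc.symm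
        · exact absurd rfl hne'
      · exact fun h => ⟨e, he, f, hf, hne, hv, hfv, h⟩
    simp only [Finset.mem_filter, Finset.mem_univ, true_and]
    rw [key _ (Or.inl rfl), key _ (Or.inr rfl)]

theorem isSplitting_deflation (hM : IsLabelMatching M) : IsSplitting hM.deflation M where
  matching := hM
  arcs := rfl
  cross e he f hf hne v hv hfv := by
    simp only [deflation, Finset.mem_filter, Finset.mem_univ, true_and]
    constructor
    · rintro ⟨e', he', f', hf', hne', hev', hfv', hc⟩
      rcases hM.eq_or_eq he hf he' hne hv hfv hev' with rfl | rfl <;>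
        rcases hM.eq_or_eq he hf hf' hne hv hfv hfv' with rfl | rfl
      · exact absurd rfl hne'
      · exact hc
      · exact hc.symm
      · exact absurd rfl hne'
    · exact fun h => ⟨e, he, f, hf, hne, hv, hfv, h⟩

end IsLabelMatching

namespace IsSplitting

variable {G : TangledDiagram n}

theorem exists_of_mem (h : IsSplitting G M) {a : Fin n × Fin n} (ha : a ∈ G.arcs) :
    ∃ e ∈ M, arcVtx e = a := by
  rw [← h.arcs, Multiset.mem_map] at ha
  exact ha

theorem arcVtx_mem (h : IsSplitting G M) {e : Label n × Label n} (he : e ∈ M) :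
    arcVtx e ∈ G.arcs := by
  rw [← h.arcs]
  exact Multiset.mem_map_of_mem _ he

theorem degree_eq_two_iff (h : IsSplitting G M) (v : Fin n) :
    G.degree v = 2 ↔ ∃ e ∈ M, IsEnd e (label v true) := by
  rw [TangledDiagram.degree, ← h.arcs, h.matching.countP_add, h.matching.card_usedAt_eq_two_iff]

theorem mem_crossAt_iff (h : IsSplitting G M) (v : Fin n) : v ∈ G.crossAt ↔
    ∃ e ∈ M, ∃ f ∈ M, e ≠ f ∧ IsEnd (arcVtx e) v ∧ IsEnd (arcVtx f) v ∧ CrossPair e f := by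
  constructor
  · intro hv
    have key : ∃ e ∈ M, ∃ f ∈ M, e ≠ f ∧ IsEnd (arcVtx e) v ∧ IsEnd (arcVtx f) v := by
      obtain ⟨a, ha, hav, h2 | ⟨b, hb, hba, hbv⟩⟩ := TangledDiagram.exists_of_mem_crossAt hv
      · rw [← h.arcs] at h2
        obtain ⟨e, he, f, hf, hne, rfl, hfa⟩ := IsLabelMatching.exists_pair_of_count h2
        exact ⟨e, he, f, hf, hne, hav, by rwa [hfa]⟩
      · obtain ⟨e, he, rfl⟩ := h.exists_of_mem ha
        obtain ⟨f, hf, rfl⟩ := h.exists_of_mem hb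
        exact ⟨e, he, f, hf, by rintro rfl; exact hba rfl, hav, hbv⟩
    obtain ⟨e, he, f, hf, hne, hev, hfv⟩ := key
    exact ⟨e, he, f, hf, hne, hev, hfv, (h.cross e he f hf hne v hev hfv).1 hv⟩
  · rintro ⟨e, he, f, hf, hne, hev, hfv, hc⟩
    exact (h.cross e he f hf hne v hev hfv).2 hc

theorem eq_of_isSplitting {G' : TangledDiagram n} (h : IsSplitting G M) (h' : IsSplitting G' M) :
    G = G' := by
  ext1
  · rw [← h.arcs, h'.arcs]
  · ext v
    rw [h.mem_crossAt_iff, h'.mem_crossAt_iff]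

theorem isEnd_prm_ne (h : IsSplitting G M) {e f : Label n × Label n} (he : e ∈ M) (hf : f ∈ M)
    (hne : e ≠ f) {x y : Label n} (hx : IsEnd e x) (hy : IsEnd f y) (hv : vtx x = vtx y) :
    prm x ≠ prm y :=
  h.matching.isEnd_ne he hf hne (v := vtx x) (b := prm x) (c := prm y) hx (by rw [hv]; exact hy)

theorem prm_eq_of_double (h : IsSplitting G M) {e : Label n × Label n} (he : e ∈ M)
    (h2 : 2 ≤ G.arcs.count (arcVtx e)) : (arcVtx e).1 ∈ G.crossAt ↔ prm e.1 = prm e.2 := by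
  have hlt : vtx e.1 < vtx e.2 := TangledDiagram.lt_of_two_le_count h2
  rw [← h.arcs] at h2
  obtain ⟨e₁, he₁, f₁, hf₁, hne₁, he', hf'⟩ := IsLabelMatching.exists_pair_of_count h2
  obtain ⟨f, hf, hne, hfe⟩ : ∃ f ∈ M, e ≠ f ∧ arcVtx f = arcVtx e := by
    by_cases hh : e = e₁
    · exact ⟨f₁, hf₁, hh ▸ hne₁, hf'⟩
    · exact ⟨e₁, he₁, hh, he'⟩
  have h1 : vtx f.1 = vtx e.1 := (congrArg Prod.fst hfe : (arcVtx f).1 = (arcVtx e).1)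
  have h2 : vtx f.2 = vtx e.2 := (congrArg Prod.snd hfe : (arcVtx f).2 = (arcVtx e).2)
  have hcp := crossPair_double hlt
    (h.isEnd_prm_ne he hf hne (Or.inl rfl) (Or.inl rfl) h1.symm)
    (h.isEnd_prm_ne he hf hne (Or.inr rfl) (Or.inr rfl) h2.symm)
  rw [← h1, ← h2, label_vtx_prm, label_vtx_prm, h1, h2, label_vtx_prm, label_vtx_prm] at hcp
  rw [← hcp]
  exact h.cross e he f hf hne _ (Or.inl rfl) (by rw [hfe]; exact Or.inl rfl)

/-- A primed label belongs to a vertex where another arc ends, or to a loop. -/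
theorem exists_other (h : IsSplitting G M) {e : Label n × Label n} (he : e ∈ M)
    (h2 : ¬ 2 ≤ G.arcs.count (arcVtx e)) {x : Label n} (hx : IsEnd e x) (hp : prm x = true)
    (hl : ¬ IsEnd e (label (vtx x) false)) : ∃ c ∈ G.arcs, IsEnd c (vtx x) ∧ c ≠ arcVtx e := by
  obtain ⟨g, hg, hgx⟩ := h.matching.used (vtx x) ⟨e, he, by rw [← hp]; exact hx⟩
  refine ⟨arcVtx g, h.arcVtx_mem hg, hgx.arcVtx, fun hge => h2 ?_⟩
  rw [← h.arcs]
  exact IsLabelMatching.two_le_count he hg (by rintro rfl; exact hl hgx) rfl hge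

/-- In any splitting the prime is forced. If another arc meets `e` over this vertex, whether the two
cross decides it. If `e` is alone there, a primed label would require the unprimed one to be used by
an arc as well. -/
theorem prm_left (h : IsSplitting G M) {e : Label n × Label n} (he : e ∈ M)
    (h2 : ¬ 2 ≤ G.arcs.count (arcVtx e)) : prm e.1 = G.leftPrimed (arcVtx e) := by
  have ha := h.arcVtx_mem he
  by_cases hc : ∃ c ∈ G.arcs, IsEnd c (vtx e.1) ∧ c ≠ arcVtx e
  · obtain ⟨c, hc, hcv, hce⟩ := hc
    obtain ⟨f, hf, rfl⟩ := h.exists_of_mem hc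
    have hne : e ≠ f := by rintro rfl; exact hce rfl
    have hlt : vtx e.1 < vtx e.2 := TangledDiagram.lt_of_isEnd_left ha hc hce.symm hcv
    have hx := h.cross e he f hf hne (vtx e.1) (Or.inl rfl) hcv
    rw [Bool.eq_iff_iff]
    rcases hcv with hv | hv
    · have hv' : vtx f.1 = vtx e.1 := hv
      have hlt' : vtx f.1 < vtx f.2 :=
        TangledDiagram.lt_of_isEnd_left hc ha hce (Or.inl hv.symm)
      have hj : vtx e.2 ≠ vtx f.2 := fun h' => hce (Prod.ext hv h'.symm)
      have hcp := crossPair_left (c := prm e.2) (c' := prm f.2) hlt (hv' ▸ hlt') hj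
        (h.isEnd_prm_ne he hf hne (Or.inl rfl) (Or.inl rfl) hv'.symm)
      rw [← hv', label_vtx_prm, label_vtx_prm, hv', label_vtx_prm, label_vtx_prm] at hcp
      rw [TangledDiagram.leftPrimed_of_left ha hc hce.symm hv]
      change _ ↔ (vtx e.1 ∈ G.crossAt ↔ vtx f.2 < vtx e.2)
      rw [hx, show CrossPair e f ↔ _ from hcp]
      tauto
    · have hv' : vtx f.2 = vtx e.1 := hv
      have hlt' : vtx f.1 < vtx f.2 :=
        TangledDiagram.lt_of_isEnd_right hc ha hce (Or.inl hv.symm)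
      have hcp := crossPair_middle (c := prm e.2) (c' := prm f.1) hlt (hv' ▸ hlt')
        (h.isEnd_prm_ne he hf hne (Or.inl rfl) (Or.inr rfl) hv'.symm)
      rw [label_vtx_prm, label_vtx_prm, label_vtx_prm, ← hv', label_vtx_prm] at hcp
      rw [TangledDiagram.leftPrimed_of_right ha hc hce.symm hv]
      change _ ↔ vtx e.1 ∉ G.crossAt
      rw [hx, show CrossPair e f ↔ _ from hcp, Bool.not_eq_false]
  · push Not at hc
    rw [TangledDiagram.leftPrimed_of_alone hc]
    by_contra hp
    rw [Bool.not_eq_false] at hp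
    obtain ⟨c, hc', hcv, hce⟩ := h.exists_other he h2 (Or.inl rfl) hp (by
      rintro (h' | h')
      · rw [h'] at hp; cases hp
      · have := h.matching.lt e he
        rw [h', ← label_vtx_prm e.1, label_lt, hp] at this
        simp at this)
    exact hce (hc c hc' hcv)

theorem prm_right (h : IsSplitting G M) {e : Label n × Label n} (he : e ∈ M)
    (h2 : ¬ 2 ≤ G.arcs.count (arcVtx e)) : prm e.2 = G.rightPrimed (arcVtx e) := by
  have ha := h.arcVtx_mem he
  rw [Bool.eq_iff_iff]
  by_cases hc : ∃ c ∈ G.arcs, IsEnd c (vtx e.2) ∧ c ≠ arcVtx e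
  · obtain ⟨c, hc, hcv, hce⟩ := hc
    obtain ⟨f, hf, rfl⟩ := h.exists_of_mem hc
    have hne : e ≠ f := by rintro rfl; exact hce rfl
    have hlt : vtx e.1 < vtx e.2 := TangledDiagram.lt_of_isEnd_right ha hc hce.symm hcv
    have hx := h.cross e he f hf hne (vtx e.2) (Or.inr rfl) hcv
    rcases hcv with hv | hv
    · have hv' : vtx f.1 = vtx e.2 := hv
      have hlt' : vtx f.1 < vtx f.2 :=
        TangledDiagram.lt_of_isEnd_left hc ha hce (Or.inr hv.symm)
      have hcp := crossPair_middle (c := prm f.2) (c' := prm e.1) hlt' (hv' ▸ hlt)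
        (h.isEnd_prm_ne hf he hne.symm (Or.inl rfl) (Or.inr rfl) hv')
      rw [label_vtx_prm, label_vtx_prm, label_vtx_prm, hv', label_vtx_prm] at hcp
      have hpne := h.isEnd_prm_ne he hf hne (Or.inr rfl) (Or.inl rfl) hv'.symm
      rw [TangledDiagram.rightPrimed_of_left ha hc hce.symm hv]
      change _ ↔ vtx e.2 ∈ G.crossAt
      rw [hx, crossPair_comm, show CrossPair f e ↔ _ from hcp]
      revert hpne
      cases prm e.2 <;> cases prm f.1 <;> simp
    · have hv' : vtx f.2 = vtx e.2 := hv
      have hlt' : vtx f.1 < vtx f.2 :=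
        TangledDiagram.lt_of_isEnd_right hc ha hce (Or.inr hv.symm)
      have hj : vtx e.1 ≠ vtx f.1 := fun h' => hce (Prod.ext h'.symm hv)
      have hcp := crossPair_right (b := prm e.1) (b' := prm f.1) hlt (hv' ▸ hlt') hj
        (h.isEnd_prm_ne he hf hne (Or.inr rfl) (Or.inr rfl) hv'.symm)
      rw [label_vtx_prm, label_vtx_prm, label_vtx_prm, ← hv', label_vtx_prm] at hcp
      rw [TangledDiagram.rightPrimed_of_right ha hc hce.symm hv]
      change _ ↔ (vtx e.2 ∈ G.crossAt ↔ vtx f.1 < vtx e.1)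
      rw [hx, show CrossPair e f ↔ _ from hcp]
      tauto
  · push Not at hc
    rw [TangledDiagram.rightPrimed_of_alone hc]
    change _ ↔ vtx e.1 = vtx e.2
    constructor
    · intro hp
      by_contra hl
      obtain ⟨c, hc', hcv, hce⟩ := h.exists_other he h2 (Or.inr rfl) hp (by
        rintro (h' | h')
        · exact hl (by rw [h']; rfl)
        · rw [h'] at hp; cases hp)
      exact hce (hc c hc' hcv)
    · exact fun hv => (prm_of_lt (h.matching.lt e he) hv).2

/-- Arcs and crossings determine all primes, so there is only one splitting. Together with
`deflation` this inverts the inflation. -/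
theorem eq_inflation (h : IsSplitting G M) : M = G.inflation := by
  refine Finset.eq_of_subset_of_card_le (fun e he => ?_) ?_
  · rw [TangledDiagram.mem_inflation]
    refine ⟨h.arcVtx_mem he, ?_⟩
    split_ifs with h2
    · exact h.prm_eq_of_double he h2
    · exact ⟨h.prm_left he h2, h.prm_right he h2⟩
  · have h1 := congrArg Multiset.card h.arcs
    have h2 := congrArg Multiset.card (TangledDiagram.map_inflation (G := G))
    rw [Multiset.card_map, Finset.card_val] at h1 h2
    rw [h1, h2]

/-- Only two labels lie over a vertex, so `e` cannot end before `f` starts; the order of the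
righthand endpoints then separates crossing from nesting. -/
theorem cross_or_nest_of_left (h : IsSplitting G M) {e f : Label n × Label n} (he : e ∈ M)
    (hf : f ∈ M) (hne : e ≠ f) (hv : vtx e.1 = vtx f.1) (hlt : e.1 < f.1) :
    CrossPair e f ∨ NestPair e f := by
  have hp := prm_of_lt hlt hv
  have h1 : f.1 < e.2 := by
    rcases lt_trichotomy f.1 e.2 with h' | h' | h'
    · exact h'
    · exact absurd (h.matching.eq_of_isEnd e he f hf f.1 (Or.inr h'.symm) (Or.inl rfl)) hne
    · have h1 := vtx_le_of_lt (h.matching.lt e he)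
      have h2 := vtx_le_of_lt h'
      have h3 := prm_of_lt h' (le_antisymm h2 (hv ▸ h1))
      have h4 := prm_of_lt (h.matching.lt e he) (le_antisymm h1 (hv ▸ h2))
      rw [h3.1] at h4
      cases h4.2
  rcases lt_trichotomy e.2 f.2 with h' | h' | h'
  · exact Or.inl (Or.inl ⟨hlt, h1, h'⟩)
  · exact absurd (h.matching.eq_of_isEnd e he f hf f.2 (Or.inr h') (Or.inr rfl)) hne
  · exact Or.inr (Or.inl ⟨hlt, h'⟩)

theorem cross_or_nest_of_right (h : IsSplitting G M) {e f : Label n × Label n} (he : e ∈ M)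
    (hf : f ∈ M) (hne : e ≠ f) (hv : vtx e.2 = vtx f.2) (hlt : e.2 < f.2) :
    CrossPair e f ∨ NestPair e f := by
  have hp := prm_of_lt hlt hv
  have h1 : f.1 < e.2 := by
    rcases lt_trichotomy f.1 e.2 with h' | h' | h'
    · exact h'
    · exact absurd (h.matching.eq_of_isEnd e he f hf f.1 (Or.inr h'.symm) (Or.inl rfl)) hne
    · have h1 := vtx_le_of_lt (h.matching.lt f hf)
      have h2 := vtx_le_of_lt h'
      have h3 := prm_of_lt h' (le_antisymm h2 (hv ▸ h1))
      have h4 := prm_of_lt (h.matching.lt f hf) (le_antisymm h1 (hv ▸ h2))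
      rw [h3.2] at h4
      cases h4.1
  rcases lt_trichotomy e.1 f.1 with h' | h' | h'
  · exact Or.inl (Or.inl ⟨h', h1, hlt⟩)
  · exact absurd (h.matching.eq_of_isEnd e he f hf f.1 (Or.inl h') (Or.inl rfl)) hne
  · exact Or.inr (Or.inr ⟨h', hlt⟩)

theorem cross_or_nest (h : IsSplitting G M) {e f : Label n × Label n} (he : e ∈ M)
    (hf : f ∈ M) (hne : e ≠ f) (hv : vtx e.1 = vtx f.1 ∨ vtx e.2 = vtx f.2) :
    CrossPair e f ∨ NestPair e f := by
  rcases hv with hv | hv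
  · rcases lt_trichotomy e.1 f.1 with h' | h' | h'
    · exact h.cross_or_nest_of_left he hf hne hv h'
    · exact absurd (h.matching.eq_of_isEnd e he f hf f.1 (Or.inl h') (Or.inl rfl)) hne
    · exact (h.cross_or_nest_of_left hf he hne.symm hv.symm h').imp CrossPair.symm Or.symm
  · rcases lt_trichotomy e.2 f.2 with h' | h' | h'
    · exact h.cross_or_nest_of_right he hf hne hv h'
    · exact absurd (h.matching.eq_of_isEnd e he f hf f.2 (Or.inr h') (Or.inr rfl)) hne
    · exact (h.cross_or_nest_of_right hf he hne.symm hv.symm h').imp CrossPair.symm Or.symm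

/-- Strict inequalities between vertices lift to labels. Conversely, an inequality of labels may
become an equality of vertices; then the arcs meet there, and `IsSplitting.cross` applies. -/
theorem crossing_iff (h : IsSplitting G M) {e f : Label n × Label n} (he : e ∈ M)
    (hf : f ∈ M) (hne : e ≠ f) : G.Crossing (arcVtx e) (arcVtx f) ↔ CrossPair e f := by
  have key : ∀ {e f : Label n × Label n}, e ∈ M → f ∈ M → e ≠ f →
      e.1 < f.1 ∧ f.1 < e.2 ∧ e.2 < f.2 → G.Crossing (arcVtx e) (arcVtx f) := by
    intro e f he hf hne h'
    have hc : CrossPair e f := Or.inl h'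
    rcases (vtx_le_of_lt h'.1).lt_or_eq with h1 | h1
    · rcases (vtx_le_of_lt h'.2.1).lt_or_eq with h2 | h2
      · rcases (vtx_le_of_lt h'.2.2).lt_or_eq with h3 | h3
        · exact Or.inl ⟨h1, h2, h3⟩
        · exact Or.inr (Or.inr ⟨vtx f.2, (h.cross e he f hf hne _ (Or.inr h3) (Or.inr rfl)).2 hc,
            Or.inr h3, Or.inr rfl⟩)
      · exact Or.inr (Or.inr ⟨vtx f.1, (h.cross e he f hf hne _ (Or.inr h2.symm) (Or.inl rfl)).2 hc,
          Or.inr h2.symm, Or.inl rfl⟩)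
    · exact Or.inr (Or.inr ⟨vtx f.1, (h.cross e he f hf hne _ (Or.inl h1) (Or.inl rfl)).2 hc,
        Or.inl h1, Or.inl rfl⟩)
  constructor
  · rintro (h' | h' | ⟨v, hv, h1, h2⟩)
    · exact Or.inl ⟨lt_of_vtx_lt h'.1, lt_of_vtx_lt h'.2.1, lt_of_vtx_lt h'.2.2⟩
    · exact Or.inr ⟨lt_of_vtx_lt h'.1, lt_of_vtx_lt h'.2.1, lt_of_vtx_lt h'.2.2⟩
    · exact (h.cross e he f hf hne v h1 h2).1 hv
  · rintro (h' | h')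
    · exact key he hf hne h'
    · rcases key hf he hne.symm h' with h1 | h1 | ⟨v, hv, h1, h2⟩
      · exact Or.inr (Or.inl h1)
      · exact Or.inl h1
      · exact Or.inr (Or.inr ⟨v, hv, h2, h1⟩)

/-- As for crossings, with one more ingredient: by `cross_or_nest`, arcs with a common lefthand or
righthand vertex nest as soon as they do not cross. -/
theorem nesting_iff (h : IsSplitting G M) {e f : Label n × Label n} (he : e ∈ M)
    (hf : f ∈ M) (hne : e ≠ f) : G.Nesting (arcVtx e) (arcVtx f) ↔ NestPair e f := by
  have key : ∀ {e f : Label n × Label n}, e ∈ M → f ∈ M → e ≠ f →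
      e.1 < f.1 ∧ f.2 < e.2 → ((arcVtx e).1 < (arcVtx f).1 ∧ (arcVtx f).2 < (arcVtx e).2) ∨
        ((arcVtx e).1 = (arcVtx f).1 ∧ (arcVtx e).1 ∉ G.crossAt) ∨
        ((arcVtx e).2 = (arcVtx f).2 ∧ (arcVtx e).2 ∉ G.crossAt) := by
    intro e f he hf hne h'
    have hn : NestPair e f := Or.inl h'
    rcases (vtx_le_of_lt h'.1).lt_or_eq with h1 | h1
    · rcases (vtx_le_of_lt h'.2).lt_or_eq with h2 | h2
      · exact Or.inl ⟨h1, h2⟩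
      · exact Or.inr (Or.inr ⟨h2.symm, fun hv =>
          ((h.cross e he f hf hne _ (Or.inr rfl) (Or.inr h2)).1 hv).not_nestPair hn⟩)
    · exact Or.inr (Or.inl ⟨h1, fun hv =>
        ((h.cross e he f hf hne _ (Or.inl rfl) (Or.inl h1.symm)).1 hv).not_nestPair hn⟩)
  constructor
  · rintro (h' | h' | ⟨h', hv⟩ | ⟨h', hv⟩)
    · exact Or.inl ⟨lt_of_vtx_lt h'.1, lt_of_vtx_lt h'.2⟩
    · exact Or.inr ⟨lt_of_vtx_lt h'.1, lt_of_vtx_lt h'.2⟩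
    · refine (h.cross_or_nest he hf hne (Or.inl h')).resolve_left fun hc => hv ?_
      exact (h.cross e he f hf hne _ (Or.inl rfl) (Or.inl h'.symm)).2 hc
    · refine (h.cross_or_nest he hf hne (Or.inr h')).resolve_left fun hc => hv ?_
      exact (h.cross e he f hf hne _ (Or.inr rfl) (Or.inr h'.symm)).2 hc
  · rintro (h' | h')
    · rcases key he hf hne h' with h1 | h1 | h1
      · exact Or.inl h1
      · exact Or.inr (Or.inr (Or.inl h1))
      · exact Or.inr (Or.inr (Or.inr h1))
    · rcases key hf he hne.symm h' with h1 | h1 | h1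
      · exact Or.inr (Or.inl h1)
      · exact Or.inr (Or.inr (Or.inl ⟨h1.1.symm, h1.1 ▸ h1.2⟩))
      · exact Or.inr (Or.inr (Or.inr ⟨h1.1.symm, h1.1 ▸ h1.2⟩))

/-- The arcs with their multiplicities correspond to the arcs of the splitting. -/
theorem exists_equiv (h : IsSplitting G M) :
    ∃ φ : G.arcs.ToType ≃ {e // e ∈ M}, ∀ t, arcVtx (φ t).1 = t.1 := by
  have hcard : ∀ a, Fintype.card (Fin (G.arcs.count a)) =
      Fintype.card {e : {e // e ∈ M} // arcVtx e.1 = a} := by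
    intro a
    rw [Fintype.card_fin, ← h.arcs, Multiset.count_map, ← Finset.filter_val, Finset.card_val,
      ← Fintype.card_coe]
    refine Fintype.card_congr ⟨fun e => ⟨⟨e.1, (Finset.mem_filter.1 e.2).1⟩,
      (Finset.mem_filter.1 e.2).2.symm⟩, fun e => ⟨e.1.1, Finset.mem_filter.2
        ⟨e.1.2, e.2.symm⟩⟩, fun e => rfl, fun e => rfl⟩
  let ψ := fun a => Fintype.equivOfCardEq (hcard a)
  refine ⟨(Equiv.sigmaCongrRight ψ).trans (Equiv.sigmaFiberEquiv fun e : {e // e ∈ M} =>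
    arcVtx e.1), fun t => ?_⟩
  exact (ψ t.1 t.2).2

theorem exists_finset_iff (h : IsSplitting G M) {R : Fin n × Fin n → Fin n × Fin n → Prop}
    {P : Label n × Label n → Label n × Label n → Prop}
    (hRP : ∀ e ∈ M, ∀ f ∈ M, e ≠ f → (R (arcVtx e) (arcVtx f) ↔ P e f)) (k : ℕ) :
    (∃ S : Finset G.arcs.ToType, S.card = k ∧ ∀ a ∈ S, ∀ b ∈ S, a ≠ b → R a.1 b.1) ↔
      ∃ S : Finset (Label n × Label n), S ⊆ M ∧ S.card = k ∧
        ∀ e ∈ S, ∀ f ∈ S, e ≠ f → P e f := by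
  obtain ⟨φ, hφ⟩ := h.exists_equiv
  constructor
  · rintro ⟨S, rfl, hS⟩
    refine ⟨S.map (φ.toEmbedding.trans (Function.Embedding.subtype _)), ?_, by simp, ?_⟩
    · intro e he
      obtain ⟨t, -, rfl⟩ := Finset.mem_map.1 he
      exact (φ t).2
    · intro e he f hf hne
      obtain ⟨t, ht, rfl⟩ := Finset.mem_map.1 he
      obtain ⟨u, hu, rfl⟩ := Finset.mem_map.1 hf
      have := hS t ht u hu (by rintro rfl; exact hne rfl)
      rw [← hφ t, ← hφ u] at this
      exact (hRP _ (φ t).2 _ (φ u).2 hne).1 this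
  · rintro ⟨S, hSM, rfl, hS⟩
    refine ⟨Finset.univ.filter fun t => (φ t).1 ∈ S, ?_, ?_⟩
    · refine Finset.card_bij (fun t _ => (φ t).1) (fun t ht => (Finset.mem_filter.1 ht).2)
        (fun t _ u _ htu => φ.injective (Subtype.ext htu)) fun e he => ?_
      exact ⟨φ.symm ⟨e, hSM he⟩, by simp [he], by simp⟩
    · intro t ht u hu hne
      have hne' : (φ t).1 ≠ (φ u).1 := fun h' => hne (φ.injective (Subtype.ext h'))
      have := hS _ (Finset.mem_filter.1 ht).2 _ (Finset.mem_filter.1 hu).2 hne'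
      rw [← hRP _ (φ t).2 _ (φ u).2 hne', hφ, hφ] at this
      exact this

end IsSplitting

end Matching

/-! ### Young diagrams through their row lengths, and conjugation -/

section Young

theorem mem_squares {α : Type*} {T : List (List α)} {r c : ℕ} :
    (r, c) ∈ squares T ↔ c < rowLength T r := by
  simp only [squares, Finset.mem_biUnion, Finset.mem_range, Finset.mem_image, Prod.mk.injEq,
    rowLength, tabRow]
  constructor
  · rintro ⟨i, hi, j, hj, rfl, rfl⟩
    exact hj
  · intro h
    refine ⟨r, ?_, c, h, rfl, rfl⟩
    by_contra hr
    rw [List.getD_eq_default _ _ (not_lt.1 hr)] at h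
    simp at h

/-- The Young diagram of a tableau. -/
def tableauShape {α : Type*} (T : List (List α)) (hT : Antitone (rowLength T)) : YoungDiagram where
  cells := squares T
  isLowerSet := by
    rintro ⟨r, c⟩ ⟨r', c'⟩ ⟨h1, h2⟩ h
    rw [Finset.mem_coe, mem_squares] at h ⊢
    exact (h2.trans_lt h).trans_le (hT h1)

theorem rowLen_tableauShape {α : Type*} (T : List (List α)) (hT : Antitone (rowLength T)) :
    (tableauShape T hT).rowLen = rowLength T := by
  funext r
  refine eq_of_forall_lt_iff fun c => ?_
  rw [← YoungDiagram.mem_iff_lt_rowLen, ← YoungDiagram.mem_cells]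
  exact mem_squares

theorem eq_of_rowLen_eq {μ ν : YoungDiagram} (h : μ.rowLen = ν.rowLen) : μ = ν := by
  ext ⟨r, c⟩
  rw [YoungDiagram.mem_cells, YoungDiagram.mem_cells, YoungDiagram.mem_iff_lt_rowLen,
    YoungDiagram.mem_iff_lt_rowLen, h]

theorem rowLen_bot : (⊥ : YoungDiagram).rowLen = fun _ => 0 := by
  funext r
  refine Nat.eq_zero_of_not_pos fun h => ?_
  rw [← YoungDiagram.mem_iff_lt_rowLen] at h
  exact YoungDiagram.notMem_bot _ h

theorem addSquare_iff {μ ν : YoungDiagram} :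
    AddSquare μ ν ↔ ∃ r, GrowsAt r μ.rowLen ν.rowLen := by
  constructor
  · rintro ⟨hle, hc⟩
    have hs := YoungDiagram.cells_subset_iff.2 hle
    have hd : (ν.cells \ μ.cells).card = 1 := by
      rw [Finset.card_sdiff_of_subset hs]
      change ν.card - μ.card = 1
      omega
    obtain ⟨⟨r, c⟩, hrc⟩ := Finset.card_eq_one.1 hd
    have hmem : ∀ i j, j < ν.rowLen i ↔ j < μ.rowLen i ∨ i = r ∧ j = c := by
      intro i j
      have h1 := Finset.ext_iff.1 hrc (i, j)
      rw [Finset.mem_sdiff, YoungDiagram.mem_cells, YoungDiagram.mem_cells,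
        YoungDiagram.mem_iff_lt_rowLen, YoungDiagram.mem_iff_lt_rowLen, Finset.mem_singleton,
        Prod.mk.injEq] at h1
      have h2 : j < μ.rowLen i → j < ν.rowLen i := fun h => by
        rw [← YoungDiagram.mem_iff_lt_rowLen] at h ⊢
        exact hle h
      tauto
    have hc' : ¬ c < μ.rowLen r := by
      have h1 := Finset.ext_iff.1 hrc (r, c)
      rw [Finset.mem_sdiff, YoungDiagram.mem_cells, YoungDiagram.mem_cells,
        YoungDiagram.mem_iff_lt_rowLen, YoungDiagram.mem_iff_lt_rowLen] at h1
      exact (h1.2 (Finset.mem_singleton_self _)).2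
    refine ⟨r, fun i => ?_⟩
    by_cases hi : i = r
    · subst hi
      have h1 : c < ν.rowLen i := (hmem i c).2 (Or.inr ⟨rfl, rfl⟩)
      -- Evaluated around the ends of the two rows, `hmem` forces `c = μ.rowLen i` and `ν.rowLen i =
      -- c + 1`.
      have h2 := hmem i (μ.rowLen i)
      have h3 := hmem i (ν.rowLen i - 1)
      have h4 := hmem i (μ.rowLen i + 1)
      simp only [true_and, if_true] at h2 h3 h4 ⊢
      omega
    · rw [if_neg hi, add_zero]
      refine eq_of_forall_lt_iff fun j => ?_
      rw [hmem]
      tauto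
  · rintro ⟨r, h⟩
    have hcells : ν.cells = insert (r, μ.rowLen r) μ.cells := by
      ext ⟨i, j⟩
      rw [YoungDiagram.mem_cells, YoungDiagram.mem_iff_lt_rowLen, Finset.mem_insert,
        YoungDiagram.mem_cells, YoungDiagram.mem_iff_lt_rowLen, h i, Prod.mk.injEq]
      by_cases hi : i = r
      · subst hi
        simp only [if_true, true_and]
        omega
      · simp [hi]
    refine ⟨?_, ?_⟩
    · rw [← YoungDiagram.cells_subset_iff, hcells]
      exact Finset.subset_insert _ _
    · change ν.cells.card = μ.cells.card + 1
      rw [hcells, Finset.card_insert_of_notMem]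
      rw [YoungDiagram.mem_cells, YoungDiagram.mem_iff_lt_rowLen]
      exact lt_irrefl _

theorem AddSquare.transpose {μ ν : YoungDiagram} (h : AddSquare μ ν) :
    AddSquare μ.transpose ν.transpose := by
  have hc : ∀ μ : YoungDiagram, μ.transpose.card = μ.card := fun μ => Finset.card_map _
  exact ⟨YoungDiagram.transpose_mono h.1, by rw [hc, hc, h.2]⟩

theorem transpose_bot : (⊥ : YoungDiagram).transpose = ⊥ := by
  ext c
  simp

/-- The conjugate of a vacillating tableau. -/
def VacillatingTableau.transpose {n : ℕ} (V : VacillatingTableau n) : VacillatingTableau n where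
  shape h := (V.shape h).transpose
  shape_zero := by rw [V.shape_zero, transpose_bot]
  shape_last := by rw [V.shape_last, transpose_bot]
  move j hj := by
    rcases V.move j hj with h | h | h | h
    · exact Or.inl ⟨by rw [h.1], by rw [h.2]⟩
    · exact Or.inr (Or.inl ⟨h.1.transpose, by rw [h.2]⟩)
    · exact Or.inr (Or.inr (Or.inl ⟨by rw [h.1], h.2.transpose⟩))
    · exact Or.inr (Or.inr (Or.inr ⟨h.1.imp AddSquare.transpose AddSquare.transpose,
        h.2.imp AddSquare.transpose AddSquare.transpose⟩))

/-- Conjugation of vacillating tableaux. -/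
def VacillatingTableau.transposeEquiv (n : ℕ) : VacillatingTableau n ≃ VacillatingTableau n where
  toFun := VacillatingTableau.transpose
  invFun := VacillatingTableau.transpose
  left_inv V := by
    ext1
    funext h
    exact YoungDiagram.transpose_transpose _
  right_inv V := by
    ext1
    funext h
    exact YoungDiagram.transpose_transpose _

/-- All shapes of the vacillating tableau have less than `k` columns. -/
def VacillatingTableau.ColsLT {n : ℕ} (V : VacillatingTableau n) (k : ℕ) : Prop :=
  ∀ h, (V.shape h).rowLen 0 < k

theorem VacillatingTableau.colsLT_transpose {n : ℕ} (V : VacillatingTableau n) (k : ℕ) :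
    V.transpose.ColsLT k ↔ V.RowsLT k := by
  simp only [ColsLT, RowsLT, YoungDiagram.length_rowLens, transpose, YoungDiagram.rowLen_transpose]

end Young

/-! ### The schedule and the vacillating tableau of a diagram -/

namespace TangledDiagram

variable {n : ℕ} (G : TangledDiagram n)

/-- The position in the sequence of tableaux at which the label `x` is treated; `o` tells whether
`x` is a lefthand endpoint. -/
def slot (o : Bool) (x : Label n) : ℕ :=
  2 * (vtx x : ℕ) + if G.degree (vtx x) = 2 then (prm x).toNat else o.toNat

/-- The label treated at the position `2j` or `2j + 1`. -/
def slotLabel (j : Fin n) (b : Bool) : Label n :=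
  label j (if G.degree j = 2 then b else false)

/-- The label `x` is an endpoint of an arc of the inflation. -/
def IsUsed (x : Label n) : Prop := ∃ e ∈ G.inflation, IsEnd e x

variable {G}

theorem degree_eq_two_iff {v : Fin n} : G.degree v = 2 ↔ G.IsUsed (label v true) :=
  isSplitting_inflation.degree_eq_two_iff v

theorem IsUsed.prm_eq_false {x : Label n} (hx : G.IsUsed x) (h : G.degree (vtx x) ≠ 2) :
    prm x = false := by
  by_contra hp
  rw [Bool.not_eq_false] at hp
  refine h (degree_eq_two_iff.2 ?_)
  rw [← hp]
  exact hx

theorem isUsed_left {e : Label n × Label n} (he : e ∈ G.inflation) : G.IsUsed e.1 :=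
  ⟨e, he, Or.inl rfl⟩

theorem isUsed_right {e : Label n × Label n} (he : e ∈ G.inflation) : G.IsUsed e.2 :=
  ⟨e, he, Or.inr rfl⟩

/-- The flags `o`, `o'` do not matter: if `x < y` lie over the same vertex, then `y` is primed, the
degree is two, and the slots are given by the primes. -/
theorem slot_lt {x y : Label n} (hy : G.IsUsed y) (h : x < y) (o o' : Bool) :
    G.slot o x < G.slot o' y := by
  have h1 : ∀ o (x : Label n), G.slot o x ≤ 2 * (vtx x : ℕ) + 1 := by
    intro o x
    rw [slot]
    have h2 := Bool.toNat_le o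
    have h3 := Bool.toNat_le (prm x)
    split_ifs <;> omega
  rcases (vtx_le_of_lt h).lt_or_eq with hv | hv
  · refine (h1 o x).trans_lt ?_
    rw [slot]
    rw [Fin.lt_def] at hv
    omega
  · have hp := prm_of_lt h hv
    have hd : G.degree (vtx x) = 2 := by
      by_contra hd
      rw [hv] at hd
      rw [hy.prm_eq_false hd] at hp
      cases hp.2
    rw [slot, slot, ← hv, if_pos hd, if_pos hd, hp.1, hp.2]
    simp

theorem slot_lt_iff {x y : Label n} (hx : G.IsUsed x) (hy : G.IsUsed y) (hne : x ≠ y)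
    (o o' : Bool) : G.slot o x < G.slot o' y ↔ x < y := by
  refine ⟨fun h => ?_, fun h => slot_lt hy h o o'⟩
  by_contra h'
  exact lt_asymm h (slot_lt hx (lt_of_le_of_ne (not_lt.1 h') hne.symm) o' o)

theorem slot_inj {x y : Label n} (hx : G.IsUsed x) (hy : G.IsUsed y) {o o' : Bool}
    (h : G.slot o x = G.slot o' y) : x = y := by
  rcases lt_trichotomy x y with h' | h' | h'
  · exact absurd h (slot_lt hy h' o o').ne
  · exact h'
  · exact absurd h (slot_lt hx h' o' o).ne'

theorem slot_lt_two_mul (o : Bool) (x : Label n) : G.slot o x < 2 * n := by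
  have h2 := Bool.toNat_le o
  have h3 := Bool.toNat_le (prm x)
  have h4 := (vtx x).isLt
  rw [slot]
  split_ifs <;> omega

theorem slot_eq_iff {x : Label n} (hx : G.IsUsed x) (o : Bool) (j : Fin n) (b : Bool) :
    G.slot o x = 2 * (j : ℕ) + b.toNat ↔ x = G.slotLabel j b ∧ (G.degree j = 2 ∨ o = b) := by
  have h1 := Bool.toNat_le o
  have h2 := Bool.toNat_le b
  have h3 := Bool.toNat_le (prm x)
  have hinj : ∀ b c : Bool, b.toNat = c.toNat ↔ b = c := by decide
  constructor
  · intro h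
    rw [slot] at h
    have hj : vtx x = j := by
      apply Fin.ext
      split_ifs at h <;> omega
    subst hj
    split_ifs at h with hd
    · have hb : prm x = b := (hinj _ _).1 (by omega)
      refine ⟨?_, Or.inl hd⟩
      rw [slotLabel, if_pos hd, ← hb, label_vtx_prm]
    · have hb : o = b := (hinj _ _).1 (by omega)
      refine ⟨?_, Or.inr hb⟩
      rw [slotLabel, if_neg hd, ← hx.prm_eq_false hd, label_vtx_prm]
  · rintro ⟨rfl, h⟩
    by_cases hd : G.degree j = 2
    · simp [slot, slotLabel, hd]
    · simp [slot, slotLabel, hd, h.resolve_left hd]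

variable (G)

open Classical in
/-- The sequence of steps described by the inflation. -/
noncomputable def steps (p : ℕ) : TableauStep (Label n) :=
  if h : ∃ e ∈ G.inflation, G.slot true e.1 = p then .remove h.choose.1
  else if h : ∃ e ∈ G.inflation, G.slot false e.2 = p then .insert h.choose.1
  else .idle

variable {G}

theorem steps_slot_left {e : Label n × Label n} (he : e ∈ G.inflation) :
    G.steps (G.slot true e.1) = .remove e.1 := by
  have h : ∃ f ∈ G.inflation, G.slot true f.1 = G.slot true e.1 := ⟨e, he, rfl⟩
  rw [steps, dif_pos h,
    slot_inj (isUsed_left h.choose_spec.1) (isUsed_left he) h.choose_spec.2]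

theorem inflation_lt {e : Label n × Label n} (he : e ∈ G.inflation) : e.1 < e.2 :=
  isLabelMatching_inflation.lt e he

theorem inflation_unique {e f : Label n × Label n} (he : e ∈ G.inflation) (hf : f ∈ G.inflation)
    {x : Label n} (hx : IsEnd e x) (hx' : IsEnd f x) : e = f :=
  isLabelMatching_inflation.eq_of_isEnd e he f hf x hx hx'

theorem steps_slot_right {e : Label n × Label n} (he : e ∈ G.inflation) :
    G.steps (G.slot false e.2) = .insert e.1 := by
  have h : ∃ f ∈ G.inflation, G.slot false f.2 = G.slot false e.2 := ⟨e, he, rfl⟩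
  have h' : ¬ ∃ f ∈ G.inflation, G.slot true f.1 = G.slot false e.2 := by
    rintro ⟨f, hf, hs⟩
    have hx := slot_inj (isUsed_left hf) (isUsed_right he) hs
    obtain rfl := inflation_unique hf he (Or.inl rfl) (Or.inr hx.symm)
    exact (inflation_lt hf).ne hx
  have hx := slot_inj (isUsed_right h.choose_spec.1) (isUsed_right he) h.choose_spec.2
  rw [steps, dif_neg h', dif_pos h,
    inflation_unique h.choose_spec.1 he (Or.inr hx) (Or.inr rfl)]

theorem steps_eq_remove_iff {p : ℕ} {x : Label n} :
    G.steps p = .remove x ↔ ∃ e ∈ G.inflation, e.1 = x ∧ G.slot true e.1 = p := by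
  constructor
  · intro h
    rw [steps] at h
    split_ifs at h with h1 h2
    cases h
    exact ⟨_, h1.choose_spec.1, rfl, h1.choose_spec.2⟩
  · rintro ⟨e, he, rfl, rfl⟩
    exact steps_slot_left he

theorem steps_eq_insert_iff {p : ℕ} {x : Label n} :
    G.steps p = .insert x ↔ ∃ e ∈ G.inflation, e.1 = x ∧ G.slot false e.2 = p := by
  constructor
  · intro h
    rw [steps] at h
    split_ifs at h with h1 h2
    cases h
    exact ⟨_, h2.choose_spec.1, rfl, h2.choose_spec.2⟩
  · rintro ⟨e, he, rfl, rfl⟩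
    exact steps_slot_right he

theorem isSchedule_steps : IsSchedule (2 * n) G.steps where
  remove_lt p q x y hpq hq hx hy := by
    obtain ⟨e, he, rfl, rfl⟩ := steps_eq_remove_iff.1 hx
    obtain ⟨f, hf, rfl, rfl⟩ := steps_eq_remove_iff.1 hy
    refine (slot_lt_iff (isUsed_left he) (isUsed_left hf) ?_ true true).1 hpq
    intro h
    rw [h] at hpq
    exact lt_irrefl _ hpq
  insert_of_remove q x hq hx := by
    obtain ⟨e, he, rfl, rfl⟩ := steps_eq_remove_iff.1 hx
    exact ⟨_, slot_lt (isUsed_right he) (inflation_lt he) _ _,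
      slot_lt_two_mul _ _, steps_slot_right he⟩
  remove_of_insert p x hp hx := by
    obtain ⟨e, he, rfl, rfl⟩ := steps_eq_insert_iff.1 hx
    exact ⟨_, slot_lt (isUsed_right he) (inflation_lt he) _ _,
      steps_slot_left he⟩
  insert_unique p q x hp hq hx hy := by
    obtain ⟨e, he, rfl, rfl⟩ := steps_eq_insert_iff.1 hx
    obtain ⟨f, hf, h, rfl⟩ := steps_eq_insert_iff.1 hy
    rw [inflation_unique he hf (Or.inl rfl) (Or.inl h)]

theorem partner_eq_some_iff {x i : Label n} : G.partner x = some i ↔ (i, x) ∈ G.inflation := by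
  constructor
  · intro h
    simpa using List.find?_some h
  · intro h
    cases hp : G.partner x with
    | none =>
      rw [partner, List.find?_eq_none] at hp
      have hi : i ∈ (List.finRange n).map (fun i => label i false) ++
          (List.finRange n).map fun i => label i true := by
        obtain ⟨v, b, rfl⟩ := exists_label i
        cases b <;> simp
      exact absurd h (by simpa using hp i hi)
    | some i' =>
      have h' : (i', x) ∈ G.inflation := by simpa using List.find?_some hp
      have := inflation_unique h h' (x := x) (Or.inr rfl) (Or.inr rfl)
      simp only [Prod.mk.injEq, and_true] at this
      rw [this]

theorem closeStep_of_mem {e : Label n × Label n} (he : e ∈ G.inflation) (T : List (List (Label n))) :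
    G.closeStep e.2 T = rowInsert T e.1 := by
  rw [closeStep, partner_eq_some_iff.2 he]

theorem closeStep_of_notMem {x : Label n} (hx : ∀ e ∈ G.inflation, e.2 ≠ x)
    (T : List (List (Label n))) : G.closeStep x T = T := by
  rw [closeStep]
  cases hp : G.partner x with
  | none => rfl
  | some i => exact absurd rfl (hx _ (partner_eq_some_iff.1 hp))

theorem openStep_of_mem {e : Label n × Label n} (he : e ∈ G.inflation) (T : List (List (Label n))) :
    G.openStep e.1 T = removeEntry T e.1 := by
  rw [openStep, if_pos (Finset.mem_image_of_mem _ he)]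

theorem openStep_of_notMem {x : Label n} (hx : ∀ e ∈ G.inflation, e.1 ≠ x)
    (T : List (List (Label n))) : G.openStep x T = T := by
  rw [openStep, if_neg]
  rintro h
  obtain ⟨e, he, h⟩ := Finset.mem_image.1 h
  exact hx e he h

/-- The step at the position `2j` or `2j + 1`. -/
theorem apply_steps (j : Fin n) (b : Bool) (T : List (List (Label n))) :
    (G.steps (2 * (j : ℕ) + b.toNat)).apply T =
      if b = true then G.secondStep j T else G.firstStep j T := by
  have hstep : (if b = true then G.secondStep j T else G.firstStep j T) =
      if G.degree j = 2 then G.closeStep (G.slotLabel j b) (G.openStep (G.slotLabel j b) T)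
      else if b = true then G.openStep (G.slotLabel j b) T
      else G.closeStep (G.slotLabel j b) T := by
    cases b <;> by_cases hd : G.degree j = 2 <;> simp [secondStep, firstStep, slotLabel, hd]
  rw [hstep]
  cases hs : G.steps (2 * (j : ℕ) + b.toNat) with
  | idle =>
    have h1 : ∀ e ∈ G.inflation, (G.degree j = 2 ∨ b = true) → e.1 ≠ G.slotLabel j b := by
      intro e he hd h
      have := steps_slot_left he
      rw [(slot_eq_iff (isUsed_left he) true j b).2 ⟨h, hd.imp_right Eq.symm⟩, hs] at this
      cases this
    have h2 : ∀ e ∈ G.inflation, (G.degree j = 2 ∨ b = false) → e.2 ≠ G.slotLabel j b := by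
      intro e he hd h
      have := steps_slot_right he
      rw [(slot_eq_iff (isUsed_right he) false j b).2 ⟨h, hd.imp_right Eq.symm⟩, hs] at this
      cases this
    rw [TableauStep.apply]
    split_ifs with hd hb
    · rw [openStep_of_notMem fun e he => h1 e he (Or.inl hd),
        closeStep_of_notMem fun e he => h2 e he (Or.inl hd)]
    · rw [openStep_of_notMem fun e he => h1 e he (Or.inr hb)]
    · rw [closeStep_of_notMem fun e he => h2 e he (Or.inr (by simpa using hb))]
  | insert x =>
    obtain ⟨e, he, rfl, hx⟩ := steps_eq_insert_iff.1 hs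
    obtain ⟨hl, hd⟩ := (slot_eq_iff (isUsed_right he) false j b).1 hx
    rw [← hl, closeStep_of_mem he, closeStep_of_mem he, openStep_of_notMem, TableauStep.apply]
    · split_ifs with h1 h2
      · rfl
      · rcases hd with hd | hd
        · exact absurd hd h1
        · rw [h2] at hd; cases hd
      · rfl
    · intro f hf h
      obtain rfl := inflation_unique hf he (Or.inl h) (Or.inr rfl)
      exact (inflation_lt hf).ne h
  | remove x =>
    obtain ⟨e, he, rfl, hx⟩ := steps_eq_remove_iff.1 hs
    obtain ⟨hl, hd⟩ := (slot_eq_iff (isUsed_left he) true j b).1 hx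
    have hn : ∀ f ∈ G.inflation, f.2 ≠ e.1 := by
      intro f hf h
      obtain rfl := inflation_unique hf he (Or.inr h) (Or.inl rfl)
      exact (inflation_lt hf).ne' h
    rw [← hl, closeStep_of_notMem hn, openStep_of_mem he, TableauStep.apply]
    split_ifs with h1 h2
    · rfl
    · rfl
    · rcases hd with hd | hd
      · exact absurd hd h1
      · exact absurd hd.symm h2

variable (G)

/-- The tableaux of a tangled-diagram, indexed by all natural numbers. -/
def tableauNat (p : ℕ) : List (List (Label n)) :=
  if h : p < 2 * n + 1 then G.tableau ⟨p, h⟩ else []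

theorem tableauNat_val (p : Fin (2 * n + 1)) : G.tableauNat p = G.tableau p := by
  rw [tableauNat, dif_pos p.isLt]

theorem isRun_tableauNat : IsRun (2 * n) G.steps G.tableauNat where
  last := by
    have h := G.tableauNat_val (Fin.last (2 * n))
    rw [tableau, Fin.reverseInduction_last] at h
    rw [← h]
    rfl
  step p hp := by
    congr 1
    have h1 := G.tableauNat_val (Fin.castSucc ⟨p, hp⟩)
    have h2 := G.tableauNat_val (Fin.succ ⟨p, hp⟩)
    rw [tableau, Fin.reverseInduction_castSucc] at h1
    change _ = if p % 2 = 1 then G.secondStep ⟨p / 2, _⟩ (G.tableau _)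
      else G.firstStep ⟨p / 2, _⟩ (G.tableau _) at h1
    rw [← h2] at h1
    have h3 := apply_steps (G := G) ⟨p / 2, by omega⟩ (decide (p % 2 = 1)) (G.tableauNat (p + 1))
    have h4 : 2 * (p / 2) + (decide (p % 2 = 1)).toNat = p := by
      by_cases hm : p % 2 = 1
      · simp [hm]; omega
      · simp [hm]; omega
    simp only [decide_eq_true_eq, h4] at h3
    rw [h3]
    exact h1

theorem rowLength_antitone {p : ℕ} (hp : p ≤ 2 * n) : Antitone (rowLength (G.tableauNat p)) :=
  ((isRun_tableauNat G).tableauAt isSchedule_steps hp).isTableau.rowLength_antitone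

variable {G}

theorem steps_idle_iff {p : ℕ} (hp : p < 2 * n) : G.steps p = .idle ↔
    rowLength (G.tableauNat p) = rowLength (G.tableauNat (p + 1)) :=
  G.isRun_tableauNat.idle_iff isSchedule_steps hp

theorem steps_ne_idle {x : Label n} (hx : G.IsUsed x) :
    ∃ o, G.steps (G.slot o x) ≠ .idle := by
  obtain ⟨e, he, rfl | rfl⟩ := hx
  · exact ⟨true, by rw [steps_slot_left he]; simp⟩
  · exact ⟨false, by rw [steps_slot_right he]; simp⟩

/-- A vertex has degree two exactly if something happens in both of its steps. -/
theorem degree_eq_two_iff_steps {j : Fin n} : G.degree j = 2 ↔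
    G.steps (2 * (j : ℕ)) ≠ .idle ∧ G.steps (2 * (j : ℕ) + 1) ≠ .idle := by
  constructor
  · intro hd
    have ht := degree_eq_two_iff.1 hd
    have hf : G.IsUsed (label j false) := isLabelMatching_inflation.used j ht
    constructor
    · obtain ⟨o, ho⟩ := steps_ne_idle hf
      simpa [slot, hd] using ho
    · obtain ⟨o, ho⟩ := steps_ne_idle ht
      simpa [slot, hd] using ho
  · rintro ⟨h0, h1⟩
    by_contra hd
    -- At a vertex of smaller degree, the first step acts only for a righthand and the second only
    -- for a lefthand endpoint, both at the same unprimed label; it cannot be both.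
    have key : ∀ b : Bool, G.steps (2 * (j : ℕ) + b.toNat) ≠ .idle →
        ∃ e ∈ G.inflation, (b = true ∧ e.1 = label j false) ∨ (b = false ∧ e.2 = label j false) := by
      intro b hb
      cases hs : G.steps (2 * (j : ℕ) + b.toNat) with
      | idle => exact absurd hs hb
      | insert x =>
        obtain ⟨e, he, rfl, hx⟩ := steps_eq_insert_iff.1 hs
        obtain ⟨h1, h2⟩ := (slot_eq_iff (isUsed_right he) false j b).1 hx
        rw [slotLabel, if_neg hd] at h1
        exact ⟨e, he, Or.inr ⟨(h2.resolve_left hd).symm, h1⟩⟩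
      | remove x =>
        obtain ⟨e, he, rfl, hx⟩ := steps_eq_remove_iff.1 hs
        obtain ⟨h1, h2⟩ := (slot_eq_iff (isUsed_left he) true j b).1 hx
        rw [slotLabel, if_neg hd] at h1
        exact ⟨e, he, Or.inl ⟨(h2.resolve_left hd).symm, h1⟩⟩
    obtain ⟨e, he, ⟨h, -⟩ | ⟨-, h2⟩⟩ := key false (by simpa using h0)
    · cases h
    · obtain ⟨f, hf, ⟨-, h3⟩ | ⟨h, -⟩⟩ := key true (by simpa using h1)
      · obtain rfl := inflation_unique he hf (Or.inr h2) (Or.inl h3)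
        exact (inflation_lt he).ne (h3.trans h2.symm)
      · cases h

/-- A removal enlarges the shape from left to right. This lemma and the next one exclude the moves
`(+□, ∅)` and `(∅, -□)`. -/
theorem not_remove_of_degree {j : Fin n} (hd : G.degree j ≠ 2) (x : Label n) :
    G.steps (2 * (j : ℕ)) ≠ .remove x := by
  intro h
  obtain ⟨e, he, -, hs⟩ := steps_eq_remove_iff.1 h
  have := ((slot_eq_iff (isUsed_left he) true j false).1 (by simpa using hs)).2
  exact absurd (this.resolve_left hd) (by simp)

theorem not_insert_of_degree {j : Fin n} (hd : G.degree j ≠ 2) (x : Label n) :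
    G.steps (2 * (j : ℕ) + 1) ≠ .insert x := by
  intro h
  obtain ⟨e, he, -, hs⟩ := steps_eq_insert_iff.1 h
  have := ((slot_eq_iff (isUsed_right he) false j true).1 (by simpa using hs)).2
  exact absurd (this.resolve_left hd) (by simp)

variable (G)

/-- The vacillating tableau of a tangled-diagram. -/
def toVacillating : VacillatingTableau n where
  shape h := tableauShape (G.tableauNat h) (G.rowLength_antitone (Nat.lt_succ_iff.1 h.isLt))
  shape_zero := by
    apply eq_of_rowLen_eq
    rw [rowLen_tableauShape, rowLen_bot]
    funext r
    have h := G.isRun_tableauNat.first isSchedule_steps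
    rw [rowLength, Fin.val_zero, h]
    simp
  shape_last := by
    apply eq_of_rowLen_eq
    rw [rowLen_tableauShape, rowLen_bot]
    funext r
    have h := G.isRun_tableauNat.last
    rw [rowLength, Fin.val_last, h]
    simp
  move j hj := by
    have hT := G.isRun_tableauNat
    have hS := isSchedule_steps (G := G)
    have hi : ∀ p (hp : p < 2 * n), G.steps p = .idle →
        tableauShape (G.tableauNat p) (G.rowLength_antitone hp.le) =
          tableauShape (G.tableauNat (p + 1)) (G.rowLength_antitone hp) := by
      intro p hp h
      apply eq_of_rowLen_eq
      rw [rowLen_tableauShape, rowLen_tableauShape, hT.rowLength_idle hp h]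
    have hins : ∀ p (hp : p < 2 * n) x, G.steps p = .insert x →
        AddSquare (tableauShape (G.tableauNat (p + 1)) (G.rowLength_antitone hp))
          (tableauShape (G.tableauNat p) (G.rowLength_antitone hp.le)) := by
      intro p hp x h
      rw [addSquare_iff, rowLen_tableauShape, rowLen_tableauShape]
      exact hT.growsAt_insert hS hp h
    have hrem : ∀ p (hp : p < 2 * n) x, G.steps p = .remove x →
        AddSquare (tableauShape (G.tableauNat p) (G.rowLength_antitone hp.le))
          (tableauShape (G.tableauNat (p + 1)) (G.rowLength_antitone hp)) := by
      intro p hp x h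
      rw [addSquare_iff, rowLen_tableauShape, rowLen_tableauShape]
      exact hT.growsAt_remove hS hp h
    have hp0 : 2 * j < 2 * n := by omega
    have hp1 : 2 * j + 1 < 2 * n := by omega
    by_cases hd : G.degree ⟨j, hj⟩ = 2
    · have hne := degree_eq_two_iff_steps.1 hd
      refine Or.inr (Or.inr (Or.inr ⟨?_, ?_⟩))
      · cases hs : G.steps (2 * j) with
        | idle => exact absurd hs hne.1
        | insert x => exact Or.inr (hins _ hp0 x hs)
        | remove x => exact Or.inl (hrem _ hp0 x hs)
      · cases hs : G.steps (2 * j + 1) with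
        | idle => exact absurd hs hne.2
        | insert x => exact Or.inr (hins _ hp1 x hs)
        | remove x => exact Or.inl (hrem _ hp1 x hs)
    · have hne : ¬ (G.steps (2 * j) ≠ .idle ∧ G.steps (2 * j + 1) ≠ .idle) :=
        fun h => hd (degree_eq_two_iff_steps.2 h)
      cases hs : G.steps (2 * j) with
      | idle =>
        cases hs' : G.steps (2 * j + 1) with
        | idle => exact Or.inl ⟨(hi _ hp0 hs).symm, (hi _ hp1 hs').symm⟩
        | insert x => exact absurd hs' (not_insert_of_degree hd x)
        | remove x => exact Or.inr (Or.inr (Or.inl ⟨(hi _ hp0 hs).symm, hrem _ hp1 x hs'⟩))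
      | insert x =>
        have hs' : G.steps (2 * j + 1) = .idle := by
          by_contra h
          exact hne ⟨by rw [hs]; simp, h⟩
        exact Or.inr (Or.inl ⟨hins _ hp0 x hs, (hi _ hp1 hs').symm⟩)
      | remove x => exact absurd hs (not_remove_of_degree hd x)

theorem rowLen_toVacillating (h : Fin (2 * n + 1)) :
    (G.toVacillating.shape h).rowLen = rowLength (G.tableauNat h) :=
  rowLen_tableauShape _ (G.rowLength_antitone (Nat.lt_succ_iff.1 h.isLt))

theorem cells_toVacillating (h : Fin (2 * n + 1)) :
    (G.toVacillating.shape h).cells = squares (G.tableau h) := by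
  rw [← tableauNat_val]
  rfl

end TangledDiagram

/-! ### Injectivity, and crossings and nestings read off from the shapes -/

namespace TangledDiagram

variable {n : ℕ} {G G' : TangledDiagram n}

theorem exists_eq_two_mul_add {p : ℕ} (hp : p < 2 * n) :
    ∃ (j : Fin n) (b : Bool), p = 2 * (j : ℕ) + b.toNat := by
  refine ⟨⟨p / 2, by omega⟩, decide (p % 2 = 1), ?_⟩
  by_cases hm : p % 2 = 1
  · simp [hm]; omega
  · simp [hm]; omega

/-- Each arc is visible in its inserting step: the letter is the lefthand endpoint, the position
gives the righthand one. -/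
theorem inflation_subset (hsl : ∀ j b, G.slotLabel j b = G'.slotLabel j b)
    (hst : ∀ p, p < 2 * n → G.steps p = G'.steps p) : G.inflation ⊆ G'.inflation := by
  intro e he
  have h1 := steps_slot_right he
  rw [hst _ (slot_lt_two_mul _ _)] at h1
  obtain ⟨f, hf, hfe, hs⟩ := steps_eq_insert_iff.1 h1
  obtain ⟨j, b, hp⟩ := exists_eq_two_mul_add (slot_lt_two_mul (G := G) false e.2)
  rw [hp] at hs
  have h2 := ((slot_eq_iff (isUsed_right he) false j b).1 hp).1
  have h3 := ((slot_eq_iff (isUsed_right hf) false j b).1 hs).1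
  have : f = e := Prod.ext hfe (by rw [h2, h3, hsl])
  rwa [← this]

/-- The shapes determine the idle steps, these the vertices of degree two, and these the labels of
all removals, as required by `IsSchedule.ext_of_rowLength`. -/
theorem toVacillating_injective :
    Function.Injective (toVacillating : TangledDiagram n → VacillatingTableau n) := by
  intro G G' h
  have hl : ∀ p, p ≤ 2 * n → rowLength (G.tableauNat p) = rowLength (G'.tableauNat p) := by
    intro p hp
    have h1 := G.rowLen_toVacillating ⟨p, Nat.lt_succ_of_le hp⟩
    have h2 := G'.rowLen_toVacillating ⟨p, Nat.lt_succ_of_le hp⟩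
    rw [h] at h1
    exact h1.symm.trans h2
  have hidle : ∀ p, p < 2 * n → (G.steps p = .idle ↔ G'.steps p = .idle) := by
    intro p hp
    rw [steps_idle_iff hp, steps_idle_iff hp, hl p hp.le, hl (p + 1) hp]
  have hdeg : ∀ j, G.degree j = 2 ↔ G'.degree j = 2 := by
    intro j
    have hj := j.isLt
    rw [degree_eq_two_iff_steps, degree_eq_two_iff_steps, Ne, Ne, hidle _ (by omega),
      hidle _ (by omega)]
  have hsl : ∀ j b, G.slotLabel j b = G'.slotLabel j b := by
    intro j b
    simp only [slotLabel, hdeg]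
  have hst : ∀ p, p < 2 * n → G.steps p = G'.steps p := by
    intro p hp
    refine isSchedule_steps.ext_of_rowLength isSchedule_steps G.isRun_tableauNat
      G'.isRun_tableauNat hl ?_ hp
    intro p x x' hp hx hx'
    obtain ⟨j, b, rfl⟩ := exists_eq_two_mul_add hp
    obtain ⟨e, he, rfl, hs⟩ := steps_eq_remove_iff.1 hx
    obtain ⟨f, hf, rfl, hs'⟩ := steps_eq_remove_iff.1 hx'
    rw [((slot_eq_iff (isUsed_left he) true j b).1 hs).1,
      ((slot_eq_iff (isUsed_left hf) true j b).1 hs').1, hsl]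
  have hinf : G.inflation = G'.inflation := (inflation_subset hsl hst).antisymm
    (inflation_subset (fun j b => (hsl j b).symm) fun p hp => (hst p hp).symm)
  have h' := isSplitting_inflation (G := G')
  rw [← hinf] at h'
  exact isSplitting_inflation.eq_of_isSplitting h'

theorem openAt_iff {p : ℕ} {x : Label n} : OpenAt (2 * n) G.steps p x ↔
    ∃ e ∈ G.inflation, e.1 = x ∧ G.slot true e.1 < p ∧ p ≤ G.slot false e.2 := by
  constructor
  · rintro ⟨⟨q, hq, h⟩, q', hq', -, h'⟩
    obtain ⟨e, he, rfl, rfl⟩ := steps_eq_remove_iff.1 h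
    obtain ⟨f, hf, hfe, rfl⟩ := steps_eq_insert_iff.1 h'
    obtain rfl := inflation_unique hf he (Or.inl hfe) (Or.inl rfl)
    exact ⟨f, hf, rfl, hq, hq'⟩
  · rintro ⟨e, he, rfl, h1, h2⟩
    exact ⟨⟨_, h1, steps_slot_left he⟩, _, h2, slot_lt_two_mul _ _, steps_slot_right he⟩

theorem closesBefore_iff {e f : Label n × Label n} (he : e ∈ G.inflation) (hf : f ∈ G.inflation)
    (hne : e ≠ f) : ClosesBefore (2 * n) G.steps e.1 f.1 ↔ e.2 < f.2 := by
  have hne' : e.2 ≠ f.2 := fun h => hne (inflation_unique he hf (Or.inr h) (Or.inr rfl))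
  rw [← slot_lt_iff (isUsed_right he) (isUsed_right hf) hne' false false]
  constructor
  · exact fun h => h _ _ (slot_lt_two_mul _ _) (slot_lt_two_mul _ _) (steps_slot_right he)
      (steps_slot_right hf)
  · intro h p q _ _ hp hq
    obtain ⟨e', he', h1, rfl⟩ := steps_eq_insert_iff.1 hp
    obtain ⟨f', hf', h2, rfl⟩ := steps_eq_insert_iff.1 hq
    obtain rfl := inflation_unique he' he (Or.inl h1) (Or.inl rfl)
    obtain rfl := inflation_unique hf' hf (Or.inl h2) (Or.inl rfl)
    exact h

/-- Sets of pairwise related arcs correspond to sets of pairwise related letters that are present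
at the same time, if related arcs lie over a common position. -/
theorem exists_openAt_iff {C : Label n → Label n → Prop}
    {P : Label n × Label n → Label n × Label n → Prop} (hP : ∀ e f, P e f → P f e)
    (hlt : ∀ e ∈ G.inflation, ∀ f ∈ G.inflation, P e f → e.1 < f.1 → f.1 < e.2)
    (hPC : ∀ e ∈ G.inflation, ∀ f ∈ G.inflation, e.1 < f.1 → f.1 < e.2 → (P e f ↔ C e.1 f.1))
    (k : ℕ) :
    (∃ p, p ≤ 2 * n ∧ ∃ S : Finset (Label n), S.card = k ∧
        (∀ x ∈ S, OpenAt (2 * n) G.steps p x) ∧ ∀ x ∈ S, ∀ y ∈ S, x < y → C x y) ↔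
      ∃ S : Finset (Label n × Label n), S ⊆ G.inflation ∧ S.card = k ∧
        ∀ e ∈ S, ∀ f ∈ S, e ≠ f → P e f := by
  have hinj : ∀ S : Finset (Label n × Label n), S ⊆ G.inflation →
      Set.InjOn Prod.fst (S : Set (Label n × Label n)) := fun S hS e he f hf h =>
    inflation_unique (hS he) (hS hf) (Or.inl h) (Or.inl rfl)
  constructor
  · rintro ⟨p, -, S, rfl, hopen, hC⟩
    have hsub : G.inflation.filter (fun e => e.1 ∈ S) ⊆ G.inflation := Finset.filter_subset _ _
    have hover : ∀ e ∈ G.inflation.filter (fun e => e.1 ∈ S),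
        G.slot true e.1 < p ∧ p ≤ G.slot false e.2 := by
      intro e he
      rw [Finset.mem_filter] at he
      obtain ⟨f, hf, hfe, h⟩ := openAt_iff.1 (hopen _ he.2)
      obtain rfl := inflation_unique hf he.1 (Or.inl hfe) (Or.inl rfl)
      exact h
    have key : ∀ e ∈ G.inflation.filter (fun e => e.1 ∈ S),
        ∀ f ∈ G.inflation.filter (fun e => e.1 ∈ S), e.1 < f.1 → P e f := by
      intro e he f hf h
      -- Both arcs are open at `p`, so `f` starts before `e` ends.
      have h1 := (hover f hf).1.trans_le (hover e he).2
      have he' := hsub he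
      have hf' := hsub hf
      have hne : f.1 ≠ e.2 := fun h' => by
        obtain rfl := inflation_unique he' hf' (Or.inr h'.symm) (Or.inl rfl)
        exact lt_irrefl _ h
      rw [slot_lt_iff (isUsed_left hf') (isUsed_right he') hne] at h1
      exact (hPC e he' f hf' h h1).2
        (hC _ (Finset.mem_filter.1 he).2 _ (Finset.mem_filter.1 hf).2 h)
    refine ⟨_, hsub, ?_, ?_⟩
    · rw [← Finset.card_image_of_injOn (hinj _ hsub)]
      congr 1
      ext x
      rw [Finset.mem_image]
      constructor
      · rintro ⟨e, he, rfl⟩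
        exact (Finset.mem_filter.1 he).2
      · intro hx
        obtain ⟨e, he, rfl, -⟩ := openAt_iff.1 (hopen x hx)
        exact ⟨e, Finset.mem_filter.2 ⟨he, hx⟩, rfl⟩
    · intro e he f hf hne
      rcases lt_trichotomy e.1 f.1 with h | h | h
      · exact key e he f hf h
      · exact absurd (hinj _ hsub he hf h) hne
      · exact hP _ _ (key f hf e he h)
  · rintro ⟨S, hsub, rfl, hS⟩
    -- Every arc of the family starts before any of them ends, so all are open right after the last
    -- start, which is the position chosen below.
    have hlt' : ∀ e ∈ S, ∀ f ∈ S, e.1 < f.2 := by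
      intro e he f hf
      by_cases hne : e = f
      · rw [hne]
        exact inflation_lt (hsub hf)
      · rcases lt_trichotomy e.1 f.1 with h | h | h
        · exact h.trans (inflation_lt (hsub hf))
        · exact absurd (hinj _ hsub he hf h) hne
        · exact hlt f (hsub hf) e (hsub he) (hS f hf e he (Ne.symm hne)) h
    refine ⟨S.sup fun e => G.slot true e.1 + 1, Finset.sup_le fun e _ => slot_lt_two_mul _ _,
      S.image Prod.fst, Finset.card_image_of_injOn (hinj S hsub), ?_, ?_⟩
    · intro x hx
      obtain ⟨e, he, rfl⟩ := Finset.mem_image.1 hx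
      refine openAt_iff.2 ⟨e, hsub he, rfl,
        Nat.lt_of_succ_le (Finset.le_sup (f := fun e => G.slot true e.1 + 1) he),
        Finset.sup_le fun f hf => ?_⟩
      exact slot_lt (isUsed_right (hsub he)) (hlt' f hf e he) _ _
    · intro x hx y hy hxy
      obtain ⟨e, he, rfl⟩ := Finset.mem_image.1 hx
      obtain ⟨f, hf, rfl⟩ := Finset.mem_image.1 hy
      have hne : e ≠ f := fun h => by
        rw [h] at hxy
        exact lt_irrefl _ hxy
      exact (hPC e (hsub he) f (hsub hf) hxy (hlt' f hf e he)).1 (hS e he f hf hne)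

/-- For arcs with `e.1 < f.1 < e.2`, crossing means that `e` closes first. Rows are numbered from 0,
so `k + 1` crossing arcs correspond to a nonempty row `k`. -/
theorem isNoncrossing_succ_iff (k : ℕ) : G.IsNoncrossing (k + 1) ↔
    ∀ p, p ≤ 2 * n → rowLength (G.tableauNat p) k = 0 := by
  have h := exists_openAt_iff (G := G) (C := ClosesBefore (2 * n) G.steps) (P := CrossPair)
    (fun _ _ => CrossPair.symm)
    (fun e _ f _ h hlt => by
      rcases h with h | h
      · exact h.2.1
      · exact absurd h.1 hlt.not_gt)
    (fun e he f hf h1 h2 => by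
      rw [closesBefore_iff he hf fun h => by rw [h] at h1; exact lt_irrefl _ h1]
      constructor
      · rintro (h | h)
        · exact h.2.2
        · exact absurd h.1 h1.not_gt
      · exact fun h => Or.inl ⟨h1, h2, h⟩) (k + 1)
  rw [IsNoncrossing, isSplitting_inflation.exists_finset_iff
    (fun e he f hf hne => isSplitting_inflation.crossing_iff he hf hne), ← h]
  push Not
  refine forall₂_congr fun p hp => ?_
  rw [← Nat.le_zero, ← not_lt, G.isRun_tableauNat.rowLength_pos_iff isSchedule_steps hp]
  push Not
  rfl

theorem isNonnesting_iff (k : ℕ) : G.IsNonnesting k ↔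
    ∀ p, p ≤ 2 * n → rowLength (G.tableauNat p) 0 < k := by
  have h := exists_openAt_iff (G := G) (C := fun x y => ClosesBefore (2 * n) G.steps y x)
    (P := NestPair) (fun _ _ h => Or.symm h)
    (fun e _ f hf h hlt => by
      rcases h with h | h
      · exact (inflation_lt hf).trans h.2
      · exact absurd h.1 hlt.not_gt)
    (fun e he f hf h1 h2 => by
      rw [closesBefore_iff hf he fun h => by rw [h] at h1; exact lt_irrefl _ h1]
      constructor
      · rintro (h | h)
        · exact h.2
        · exact absurd h.1 h1.not_gt
      · exact fun h => Or.inl ⟨h1, h⟩) k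
  rw [IsNonnesting, isSplitting_inflation.exists_finset_iff
    (fun e he f hf hne => isSplitting_inflation.nesting_iff he hf hne), ← h]
  push Not
  refine forall₂_congr fun p hp => ?_
  rw [← not_le, G.isRun_tableauNat.le_rowLength_iff isSchedule_steps hp]
  push Not
  rfl

theorem isNoncrossing_iff_rowsLT (k : ℕ) : G.IsNoncrossing k ↔ G.toVacillating.RowsLT k := by
  cases k with
  | zero =>
    -- For `k = 0` both sides fail: the empty family consists of 0 crossing arcs, and no shape has
    -- fewer than 0 rows.
    refine iff_of_false (fun h => h ⟨∅, by simp⟩) fun h => Nat.not_lt_zero _ (h 0)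
  | succ k =>
    have key : ∀ h : Fin (2 * n + 1), (G.toVacillating.shape h).rowLens.length < k + 1 ↔
        rowLength (G.tableauNat h) k = 0 := by
      intro h
      rw [YoungDiagram.length_rowLens, ← rowLen_toVacillating, Nat.lt_succ_iff, ← not_lt,
        ← YoungDiagram.mem_iff_lt_colLen, YoungDiagram.mem_iff_lt_rowLen]
      omega
    rw [isNoncrossing_succ_iff]
    exact ⟨fun H h => (key h).2 (H h (Nat.lt_succ_iff.1 h.isLt)),
      fun H p hp => (key ⟨p, Nat.lt_succ_of_le hp⟩).1 (H _)⟩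

theorem isNonnesting_iff_colsLT (k : ℕ) : G.IsNonnesting k ↔ G.toVacillating.ColsLT k := by
  rw [isNonnesting_iff]
  constructor
  · intro H h
    rw [rowLen_toVacillating]
    exact H h (Nat.lt_succ_iff.1 h.isLt)
  · intro H p hp
    have := H ⟨p, Nat.lt_succ_of_le hp⟩
    rwa [rowLen_toVacillating] at this

end TangledDiagram

/-! ### Realizing a schedule by a tangled-diagram -/

section Schedule

variable {α : Type*}

/-- Whether the step does something. -/
def TableauStep.isActive : TableauStep α → Bool
  | .idle => false
  | .insert _ => true
  | .remove _ => true

theorem TableauStep.isActive_eq_false {t : TableauStep α} : t.isActive = false ↔ t = .idle := by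
  cases t <;> simp [isActive]

theorem TableauStep.isActive_of_insert {t : TableauStep α} {x : α} (h : t = .insert x) :
    t.isActive = true := by rw [h, isActive]

theorem TableauStep.isActive_of_remove {t : TableauStep α} {x : α} (h : t = .remove x) :
    t.isActive = true := by rw [h, isActive]

variable [LinearOrder α] {N : ℕ} {s : ℕ → TableauStep α} {T : ℕ → List (List α)}

theorem IsRun.tabRow_eq {T' : ℕ → List (List α)} {s' : ℕ → TableauStep α} (hT : IsRun N s T)
    (hT' : IsRun N s' T') (hs : ∀ p, p < N → s p = s' p) {p : ℕ} (hp : p ≤ N) :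
    tabRow (T p) = tabRow (T' p) := by
  induction hp using Nat.decreasingInduction with
  | self => rw [hT.last, hT'.last]
  | of_succ p hp ih =>
    rw [hT.step p hp, hT'.step p hp, hs p hp]
    exact TableauStep.tabRow_apply_congr ih _

end Schedule

namespace TangledDiagram

variable {n : ℕ}

/-- A schedule is the one of a tangled-diagram if the removed labels fit the positions and a vertex
with two steps is the only one which starts with a removal or ends with an insertion. -/
theorem exists_steps_eq {s : ℕ → TableauStep (Label n)} (hs : IsSchedule (2 * n) s)
    (hrem : ∀ (j : Fin n) (b : Bool) (x : Label n), s (2 * (j : ℕ) + b.toNat) = .remove x →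
      x = label j (b && (s (2 * (j : ℕ))).isActive))
    (hfst : ∀ (j : Fin n) (x : Label n), s (2 * (j : ℕ)) = .remove x →
      (s (2 * (j : ℕ) + 1)).isActive = true)
    (hsnd : ∀ (j : Fin n) (x : Label n), s (2 * (j : ℕ) + 1) = .insert x →
      (s (2 * (j : ℕ))).isActive = true) :
    ∃ G : TangledDiagram n, ∀ p, p < 2 * n → G.steps p = s p := by
  classical
  -- The label that an active position `P j b` has to treat: it is primed only in the second step of
  -- a vertex whose first step is active too.
  let L : Fin n → Bool → Label n := fun j b => label j (b && (s (2 * (j : ℕ))).isActive)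
  let P : Fin n → Bool → ℕ := fun j b => 2 * (j : ℕ) + b.toNat
  have hP : ∀ j b, P j b < 2 * n := by
    intro j b
    have := j.isLt
    have := Bool.toNat_le b
    change 2 * (j : ℕ) + b.toNat < 2 * n
    omega
  have hex : ∀ p, p < 2 * n → ∃ j b, p = P j b := fun p hp => exists_eq_two_mul_add hp
  have hlt : ∀ j b j' b', P j b < P j' b' → (s (P j b)).isActive = true → L j b < L j' b' := by
    intro j b j' b' h ha
    change 2 * (j : ℕ) + b.toNat < 2 * (j' : ℕ) + b'.toNat at h
    have := Bool.toNat_le b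
    have := Bool.toNat_le b'
    rw [label_lt]
    rcases lt_or_ge (j : ℕ) j' with hj | hj
    · exact Or.inl hj
    · obtain rfl : j = j' := Fin.ext (by omega)
      cases b <;> cases b' <;> simp [P] at h ha ⊢
      exact ha
  have hinj : ∀ j b j' b', L j b = L j' b' → (s (P j b)).isActive = true →
      (s (P j' b')).isActive = true → P j b = P j' b' := by
    intro j b j' b' h h1 h2
    rcases lt_trichotomy (P j b) (P j' b') with h' | h' | h'
    · exact absurd h (hlt _ _ _ _ h' h1).ne
    · exact h'
    · exact absurd h (hlt _ _ _ _ h' h2).ne'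
  -- An arc joins each letter to the label of the position at which the letter is inserted; by
  -- `hrem` the letter is itself the label of the position of its removal.
  let M : Finset (Label n × Label n) := Finset.univ.filter fun e =>
    ∃ j b, s (P j b) = .insert e.1 ∧ e.2 = L j b
  have hM : ∀ e, e ∈ M → ∃ i b j c, P i b < P j c ∧ s (P i b) = .remove e.1 ∧
      s (P j c) = .insert e.1 ∧ e.1 = L i b ∧ e.2 = L j c := by
    intro e he
    obtain ⟨j, c, h1, h2⟩ := (Finset.mem_filter.1 he).2
    obtain ⟨q, hq, h3⟩ := hs.remove_of_insert _ _ (hP j c) h1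
    obtain ⟨i, b, rfl⟩ := hex q (hq.trans (hP j c))
    exact ⟨i, b, j, c, hq, h3, h1, hrem i b _ h3, h2⟩
  have hMi : ∀ j b x, s (P j b) = .insert x → (x, L j b) ∈ M := fun j b x h =>
    Finset.mem_filter.2 ⟨Finset.mem_univ _, j, b, h, rfl⟩
  have hMr : ∀ j b x, s (P j b) = .remove x → ∃ e ∈ M, e.1 = x := by
    intro j b x h
    obtain ⟨p, -, hp, h'⟩ := hs.insert_of_remove _ _ (hP j b) h
    obtain ⟨i, c, rfl⟩ := hex p hp
    exact ⟨_, hMi i c x h', rfl⟩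
  have hend : ∀ j b, (s (P j b)).isActive = true → ∃ e ∈ M, IsEnd e (L j b) := by
    intro j b h
    cases hp : s (P j b) with
    | idle => rw [hp] at h; cases h
    | insert x => exact ⟨_, hMi j b x hp, Or.inr rfl⟩
    | remove x =>
      obtain ⟨e, he, rfl⟩ := hMr j b x hp
      exact ⟨e, he, Or.inl (hrem j b _ hp)⟩
  have hact : ∀ e ∈ M, ∀ x, IsEnd e x → ∃ j b, (s (P j b)).isActive = true ∧ x = L j b := by
    rintro e he x (rfl | rfl)
    · obtain ⟨i, b, j, c, -, h1, -, h2, -⟩ := hM e he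
      exact ⟨i, b, TableauStep.isActive_of_remove h1, h2⟩
    · obtain ⟨i, b, j, c, -, -, h1, -, h2⟩ := hM e he
      exact ⟨j, c, TableauStep.isActive_of_insert h1, h2⟩
  have htrue : ∀ v : Fin n, (∃ e ∈ M, IsEnd e (label v true)) ↔
      (s (P v false)).isActive = true ∧ (s (P v true)).isActive = true := by
    intro v
    constructor
    · rintro ⟨e, he, hx⟩
      obtain ⟨j, b, h1, h2⟩ := hact e he _ hx
      obtain ⟨rfl, h3⟩ := label_inj.1 h2
      have h4 := (Bool.and_eq_true_iff.1 h3.symm)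
      rw [h4.1] at h1
      exact ⟨h4.2, h1⟩
    · rintro ⟨h1, h2⟩
      have h3 := hend v true h2
      have h4 : L v true = label v true := label_inj.2 ⟨rfl, by simpa [P] using h1⟩
      rwa [h4] at h3
  have hmatch : IsLabelMatching M :=
    { lt := fun e he => by
        obtain ⟨i, b, j, c, hp, h1, h2, h3, h4⟩ := hM e he
        rw [h3, h4]
        exact hlt _ _ _ _ hp (TableauStep.isActive_of_remove h1)
      eq_of_isEnd := by
        have hfstInj : ∀ e ∈ M, ∀ f ∈ M, e.1 = f.1 → e = f := by
          intro e he f hf h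
          obtain ⟨j, c, h1, h2⟩ := (Finset.mem_filter.1 he).2
          obtain ⟨j', c', h1', h2'⟩ := (Finset.mem_filter.1 hf).2
          rw [← h] at h1'
          have h3 := hs.insert_unique _ _ _ (hP j c) (hP j' c') h1 h1'
          refine Prod.ext h ?_
          rw [h2, h2']
          by_contra hne
          have h5 : j = j' ∧ c = c' := by
            change 2 * (j : ℕ) + c.toNat = 2 * (j' : ℕ) + c'.toNat at h3
            have := Bool.toNat_le c
            have := Bool.toNat_le c'
            obtain rfl : j = j' := Fin.ext (by omega)
            refine ⟨rfl, ?_⟩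
            cases c <;> cases c' <;> simp at h3 ⊢
          exact hne (by rw [h5.1, h5.2])
        have hmix : ∀ e ∈ M, ∀ f ∈ M, e.1 ≠ f.2 := by
          intro e he f hf h
          obtain ⟨i, b, -, -, -, h1, -, h2, -⟩ := hM e he
          obtain ⟨j, c, h3, h4⟩ := (Finset.mem_filter.1 hf).2
          rw [h2, h4] at h
          have h5 := hinj _ _ _ _ h (TableauStep.isActive_of_remove h1)
            (TableauStep.isActive_of_insert h3)
          rw [← h5, h1] at h3
          cases h3
        rintro e he f hf x (rfl | rfl) (h | h)
        · exact hfstInj e he f hf h.symm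
        · exact absurd h.symm (hmix e he f hf)
        · exact absurd h (hmix f hf e he)
        · obtain ⟨j, c, h1, h2⟩ := (Finset.mem_filter.1 he).2
          obtain ⟨j', c', h1', h2'⟩ := (Finset.mem_filter.1 hf).2
          rw [h2, h2'] at h
          have h5 := hinj _ _ _ _ h (TableauStep.isActive_of_insert h1')
            (TableauStep.isActive_of_insert h1)
          rw [h5, h1] at h1'
          exact hfstInj e he f hf (TableauStep.insert.inj h1')
      used := fun v hv => by
        have h := hend v false ((htrue v).1 hv).1
        simpa [L] using h }
  -- By uniqueness of splittings the diagram obtained from `M` has `M` as its inflation.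
  have hinf : hmatch.deflation.inflation = M := hmatch.isSplitting_deflation.eq_inflation.symm
  set G := hmatch.deflation
  have hdeg : ∀ v, G.degree v = 2 ↔
      (s (P v false)).isActive = true ∧ (s (P v true)).isActive = true := fun v =>
    (hmatch.isSplitting_deflation.degree_eq_two_iff v).trans (htrue v)
  have hL : ∀ j b, (s (P j b)).isActive = true → L j b = G.slotLabel j b := by
    intro j b h
    cases b with
    | false => simp [L, slotLabel]
    | true =>
      by_cases hd : G.degree j = 2
      · have h1 := ((hdeg j).1 hd).1
        rw [slotLabel, if_pos hd]
        exact label_inj.2 ⟨rfl, by simpa [P] using h1⟩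
      · rw [slotLabel, if_neg hd]
        refine label_inj.2 ⟨rfl, ?_⟩
        have h1 : ¬ (s (P j false)).isActive = true := fun h1 => hd ((hdeg j).2 ⟨h1, h⟩)
        simpa [P] using h1
  have hslot_left : ∀ j b, ∀ e ∈ M, s (P j b) = .remove e.1 → G.slot true e.1 = P j b := by
    intro j b e he h
    have ha := TableauStep.isActive_of_remove h
    refine (slot_eq_iff (isUsed_left (hinf ▸ he)) true j b).2
      ⟨(hrem j b _ h).trans (hL j b ha), ?_⟩
    -- A lefthand endpoint is treated in the first step only at vertices of degree two; `hfst`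
    -- guarantees this. For righthand endpoints, `hsnd` does the same below.
    cases b with
    | true => exact Or.inr rfl
    | false => exact Or.inl ((hdeg j).2 ⟨ha, hfst j _ h⟩)
  have hslot_right : ∀ j b, ∀ e ∈ M, s (P j b) = .insert e.1 → e.2 = L j b →
      G.slot false e.2 = P j b := by
    intro j b e he h h'
    have ha := TableauStep.isActive_of_insert h
    refine (slot_eq_iff (isUsed_right (hinf ▸ he)) false j b).2 ⟨h'.trans (hL j b ha), ?_⟩
    cases b with
    | false => exact Or.inr rfl
    | true => exact Or.inl ((hdeg j).2 ⟨hsnd j _ h, ha⟩)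
  refine ⟨G, fun p hp => ?_⟩
  obtain ⟨j, b, rfl⟩ := hex p hp
  cases h : s (P j b) with
  | insert x =>
    have he := hMi j b x h
    rw [← hslot_right j b _ he h rfl]
    exact steps_slot_right (hinf ▸ he)
  | remove x =>
    obtain ⟨e, he, rfl⟩ := hMr j b x h
    rw [← hslot_left j b e he h]
    exact steps_slot_left (hinf ▸ he)
  | idle =>
    cases h' : G.steps (P j b) with
    | idle => rfl
    | insert x =>
      obtain ⟨e, he, rfl, hx⟩ := steps_eq_insert_iff.1 h'
      rw [hinf] at he
      obtain ⟨-, -, j', c, -, -, h1, -, h2⟩ := hM e he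
      rw [← hx, hslot_right j' c e he h1 h2, h1] at h
      cases h
    | remove x =>
      obtain ⟨e, he, rfl, hx⟩ := steps_eq_remove_iff.1 h'
      rw [hinf] at he
      obtain ⟨i, c, -, -, -, h1, -⟩ := hM e he
      rw [← hx, hslot_left i c e he h1, h1] at h
      cases h

end TangledDiagram

/-! ### Schedules for vacillating tableaux -/

namespace VacillatingTableau

variable {n : ℕ} (V : VacillatingTableau n)

/-- The row lengths of the shapes, indexed by all natural numbers. -/
def rowLen (p : ℕ) : ℕ → ℕ :=
  if h : p < 2 * n + 1 then (V.shape ⟨p, h⟩).rowLen else fun _ => 0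

theorem rowLen_of_lt {p : ℕ} (h : p < 2 * n + 1) : V.rowLen p = (V.shape ⟨p, h⟩).rowLen :=
  dif_pos h

/-- Some row grows by one at the step from `p` to `p + 1`. -/
def Up (p : ℕ) : Prop := ∃ r, GrowsAt r (V.rowLen p) (V.rowLen (p + 1))

/-- Some row shrinks by one at the step from `p` to `p + 1`. -/
def Down (p : ℕ) : Prop := ∃ r, GrowsAt r (V.rowLen (p + 1)) (V.rowLen p)

variable {V}

theorem Up.ne {p : ℕ} (h : V.Up p) : V.rowLen p ≠ V.rowLen (p + 1) := by
  obtain ⟨r, h⟩ := h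
  intro h'
  rw [h'] at h
  exact not_growsAt_self h

theorem Down.ne {p : ℕ} (h : V.Down p) : V.rowLen p ≠ V.rowLen (p + 1) := by
  obtain ⟨r, h⟩ := h
  intro h'
  rw [h'] at h
  exact not_growsAt_self h

theorem Up.not_down {p : ℕ} (h : V.Up p) : ¬ V.Down p := by
  obtain ⟨r, h⟩ := h
  rintro ⟨r', h'⟩
  exact h.not_symm h'

variable (V)

theorem rowLen_move (j : Fin n) :
    (V.rowLen (2 * j) = V.rowLen (2 * j + 1) ∧ V.rowLen (2 * j + 1) = V.rowLen (2 * j + 1 + 1)) ∨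
    (V.Down (2 * j) ∧ V.rowLen (2 * j + 1) = V.rowLen (2 * j + 1 + 1)) ∨
    (V.rowLen (2 * j) = V.rowLen (2 * j + 1) ∧ V.Up (2 * j + 1)) ∨
    ((V.Up (2 * j) ∨ V.Down (2 * j)) ∧ (V.Up (2 * j + 1) ∨ V.Down (2 * j + 1))) := by
  have hj := j.isLt
  have h0 := V.rowLen_of_lt (p := 2 * (j : ℕ)) (by omega)
  have h1 := V.rowLen_of_lt (p := 2 * (j : ℕ) + 1) (by omega)
  have h2 := V.rowLen_of_lt (p := 2 * (j : ℕ) + 1 + 1) (by omega)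
  have h := V.move j hj
  simp only [addSquare_iff] at h
  simp only [Up, Down, h0, h1, h2]
  rcases h with h | h | h | h
  · exact Or.inl ⟨by rw [h.1], congrArg _ h.2.symm⟩
  · exact Or.inr (Or.inl ⟨h.1, congrArg _ h.2.symm⟩)
  · exact Or.inr (Or.inr (Or.inl ⟨by rw [h.1], h.2⟩))
  · exact Or.inr (Or.inr (Or.inr h))

theorem rowLen_step {p : ℕ} (hp : p < 2 * n) :
    V.rowLen p = V.rowLen (p + 1) ∨ V.Up p ∨ V.Down p := by
  obtain ⟨j, b, rfl⟩ := TangledDiagram.exists_eq_two_mul_add hp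
  have h := V.rowLen_move j
  cases b
  · simp only [Bool.toNat_false, add_zero]
    tauto
  · simp only [Bool.toNat_true]
    tauto

/-- Among the admissible moves, only those with two changes of shape grow in the first step. This
and the next lemma supply the hypotheses `hfst` and `hsnd` of `exists_steps_eq`. -/
theorem rowLen_ne_of_up {j : Fin n} (h : V.Up (2 * j)) :
    V.rowLen (2 * j + 1) ≠ V.rowLen (2 * j + 1 + 1) := by
  rcases V.rowLen_move j with h' | h' | h' | h'
  · exact absurd h'.1 h.ne
  · exact absurd h'.1 h.not_down
  · exact h'.2.ne
  · exact h'.2.elim Up.ne Down.ne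

theorem rowLen_ne_of_down {j : Fin n} (h : V.Down (2 * j + 1)) :
    V.rowLen (2 * j) ≠ V.rowLen (2 * j + 1) := by
  rcases V.rowLen_move j with h' | h' | h' | h'
  · exact absurd h'.2 h.ne
  · exact h'.1.ne
  · exact absurd h h'.2.not_down
  · exact h'.1.elim Up.ne Down.ne

/-- A removal is labelled with the vertex of its position, primed in the second step exactly if the
first one also changes the shape. The variable `c` allows this condition to be supplied in terms of
active steps. -/
theorem exists_schedule (hn : 0 < n) :
    ∃ (s : ℕ → TableauStep (Label n)) (T : ℕ → List (List (Label n))),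
      IsSchedule (2 * n) s ∧ IsRun (2 * n) s T ∧ (∀ p, p ≤ 2 * n → rowLength (T p) = V.rowLen p) ∧
      ∀ (j : Fin n) (b c : Bool) (x : Label n), s (2 * (j : ℕ) + b.toNat) = .remove x →
        (c = true ↔ V.rowLen (2 * j) ≠ V.rowLen (2 * j + 1)) → x = label j (b && c) := by
  classical
  have : NeZero n := ⟨hn.ne'⟩
  -- The labels must be defined at all natural numbers, hence `Fin.ofNat`, for which `n` has to be
  -- nonzero.
  let ℓ : ℕ → Label n := fun p => label (Fin.ofNat n (p / 2))
    (decide (p % 2 = 1) && decide (V.rowLen (2 * (p / 2)) ≠ V.rowLen (2 * (p / 2) + 1)))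
  have hℓ : ∀ (j : Fin n) (b : Bool), ℓ (2 * (j : ℕ) + b.toNat) =
      label j (b && decide (V.rowLen (2 * j) ≠ V.rowLen (2 * j + 1))) := by
    intro j b
    have h1 : (2 * (j : ℕ) + b.toNat) / 2 = j := by
      have := Bool.toNat_le b
      omega
    have h2 : decide ((2 * (j : ℕ) + b.toNat) % 2 = 1) = b := by
      cases b <;> simp [Nat.add_mod]
    simp only [ℓ, h1, h2]
    congr 1
    exact Fin.ofNat_val_eq_self j
  obtain ⟨s, T, hs, hT, hl, hx⟩ := _root_.exists_schedule (N := 2 * n) (lam := V.rowLen) (ℓ := ℓ)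
    (fun p hp => by
      rw [V.rowLen_of_lt (Nat.lt_succ_of_le hp)]
      exact fun i j h => YoungDiagram.rowLen_anti _ _ _ h)
    (by
      rw [V.rowLen_of_lt (Nat.succ_pos _), ← rowLen_bot, ← V.shape_zero]
      rfl)
    (by
      rw [V.rowLen_of_lt (Nat.lt_succ_self _), ← rowLen_bot, ← V.shape_last]
      rfl)
    (fun p hp => V.rowLen_step hp)
    (fun p q hpq hq hup _ => by
      obtain ⟨j, b, rfl⟩ := TangledDiagram.exists_eq_two_mul_add (hpq.trans hq)
      obtain ⟨j', b', rfl⟩ := TangledDiagram.exists_eq_two_mul_add hq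
      rw [hℓ, hℓ, label_lt]
      have := Bool.toNat_le b
      have := Bool.toNat_le b'
      rcases lt_or_ge (j : ℕ) j' with hj | hj
      · exact Or.inl hj
      · obtain rfl : j = j' := Fin.ext (by omega)
        have h := Up.ne hup
        cases b <;> cases b' <;> simp at hpq h ⊢
        exact h)
  refine ⟨s, T, hs, hT, hl, fun j b c x h hc => ?_⟩
  have hj := j.isLt
  have hb := Bool.toNat_le b
  have hc' : c = decide (V.rowLen (2 * j) ≠ V.rowLen (2 * j + 1)) := by
    rw [Bool.eq_iff_iff, hc, decide_eq_true_eq]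
  rw [hc', ← hℓ]
  exact hx _ x (by omega) h

end VacillatingTableau

/-! ### Surjectivity and the theorem -/

namespace TangledDiagram

variable {n : ℕ}

/-- The schedule built from the shapes is that of some diagram `G`. Runs of the same schedule agree
up to empty rows, so `G` has the given shapes. -/
theorem toVacillating_surjective :
    Function.Surjective (toVacillating : TangledDiagram n → VacillatingTableau n) := by
  classical
  intro V
  rcases Nat.eq_zero_or_pos n with rfl | hn
  · have hM : IsLabelMatching (∅ : Finset (Label 0 × Label 0)) :=
      ⟨by simp, by simp, fun v => v.elim0⟩
    refine ⟨hM.deflation, ?_⟩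
    ext1
    funext h
    obtain rfl : h = 0 := Subsingleton.elim (α := Fin 1) _ _
    rw [V.shape_zero, VacillatingTableau.shape_zero]
  · obtain ⟨s, T, hs, hT, hl, hx⟩ := V.exists_schedule hn
    have hact : ∀ p, p < 2 * n →
        ((s p).isActive = true ↔ V.rowLen p ≠ V.rowLen (p + 1)) := by
      intro p hp
      rw [← not_iff_not, Bool.not_eq_true, TableauStep.isActive_eq_false, not_not,
        hT.idle_iff hs hp, hl p hp.le, hl (p + 1) hp]
    have hup : ∀ p x, p < 2 * n → s p = .remove x → V.Up p := by
      intro p x hp h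
      have := hT.growsAt_remove hs hp h
      rwa [hl p hp.le, hl (p + 1) hp] at this
    have hdown : ∀ p x, p < 2 * n → s p = .insert x → V.Down p := by
      intro p x hp h
      have := hT.growsAt_insert hs hp h
      rwa [hl p hp.le, hl (p + 1) hp] at this
    obtain ⟨G, hG⟩ := exists_steps_eq hs
      (fun j b x h => by
        have hj := j.isLt
        exact hx j b _ x h (hact _ (by omega)))
      (fun j x h => by
        have hj := j.isLt
        rw [hact _ (by omega)]
        exact V.rowLen_ne_of_up (hup _ x (by omega) h))
      (fun j x h => by
        have hj := j.isLt
        rw [hact _ (by omega)]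
        exact V.rowLen_ne_of_down (hdown _ x (by omega) h))
    refine ⟨G, ?_⟩
    ext1
    funext h
    apply eq_of_rowLen_eq
    have hle := Nat.lt_succ_iff.1 h.isLt
    rw [rowLen_toVacillating, rowLength_congr (G.isRun_tableauNat.tabRow_eq hT hG hle), hl _ hle,
      V.rowLen_of_lt h.isLt]

/-- The correspondence between tangled-diagrams and vacillating tableaux. -/
noncomputable def equivVacillating (n : ℕ) : TangledDiagram n ≃ VacillatingTableau n :=
  Equiv.ofBijective toVacillating ⟨toVacillating_injective, toVacillating_surjective⟩

end TangledDiagram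

/-- The bijection `β` is the one given by the RSK construction: the shapes of the vacillating tableau
corresponding to `G` are those of the tableaux `G.tableau h`. -/
theorem theorem2 (n : ℕ) :
    ∃ β : VacillatingTableau n ≃ TangledDiagram n,
      (∀ (G : TangledDiagram n) (h : Fin (2 * n + 1)),
        ((β.symm G).shape h).cells = squares (G.tableau h)) ∧
      (∀ (k : ℕ) (G : TangledDiagram n), G.IsNoncrossing k ↔ (β.symm G).RowsLT k) ∧
      (∀ k : ℕ, Set.BijOn β {V | V.RowsLT k} {G | G.IsNoncrossing k}) ∧
      (∀ k : ℕ,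
        Nonempty ({G : TangledDiagram n // G.IsNoncrossing k} ≃
          {G : TangledDiagram n // G.IsNonnesting k})) := by
  have hnc : ∀ (k : ℕ) (G : TangledDiagram n),
      G.IsNoncrossing k ↔ (TangledDiagram.equivVacillating n G).RowsLT k := fun k G =>
    TangledDiagram.isNoncrossing_iff_rowsLT k
  refine ⟨(TangledDiagram.equivVacillating n).symm, ?_, hnc, ?_, ?_⟩
  · exact fun G h => G.cells_toVacillating h
  · refine fun k => ⟨fun V hV => ?_, (Equiv.injective _).injOn, fun G hG =>
      ⟨_, (hnc k G).1 hG, Equiv.symm_apply_apply _ _⟩⟩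
    change TangledDiagram.IsNoncrossing _ k
    rw [hnc, Equiv.apply_symm_apply]
    exact hV
  -- Passing to the vacillating tableau, conjugating it and returning turns the bound on rows into a
  -- bound on columns.
  · refine fun k => ⟨Equiv.subtypeEquiv ((TangledDiagram.equivVacillating n).trans
      ((VacillatingTableau.transposeEquiv n).trans (TangledDiagram.equivVacillating n).symm))
      fun G => ?_⟩
    have h : ∀ G : TangledDiagram n, G.IsNonnesting k ↔
        (TangledDiagram.equivVacillating n G).ColsLT k := fun G =>
      TangledDiagram.isNonnesting_iff_colsLT k
    rw [hnc, h, Equiv.trans_apply, Equiv.trans_apply, Equiv.apply_symm_apply]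
    exact (VacillatingTableau.colsLT_transpose _ k).symm
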